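/- Let $Z$ be a two-dimensional topological manifold, possibly with boundary (Hausdorff, with countable base), and let $\Delta$ be a one-dimensional ($C^0$) foliation of $Z$ such that each connected component of $\partial Z$ is a leaf of $\Delta$. Suppose that each leaf of $\Delta$ is homeomorphic to $\mathbb{R}$ and is a closed subset of $Z$. Definitions. (i) A *cross section* of $\Delta$ is a continuous map $\gamma: J\to Z$, where $J=[a,b)$ or $J=(a,b)$ with $a<b$ real, such that $\gamma(J\cap\{a\})\subset\partial Z$ and such that distinct points of $J$ are mapped to distinct leaves of $\Delta$. A leaf $\omega$ *admits a cross section* if $\gamma(J)\cap\omega\neq\varnothing$ for some cross section $\gamma$. (ii) A leaf $\omega\subset\operatorname{Int}Z$ (respectively $\omega\subset\partial Z$) is *regular* if it has a saturated neighbourhood $U$ (a neighbourhood that is a union of leaves) and a homeomorphism from $\overline{U}$ onto $\mathbb{R}\times[-1,1]$ (respectively $\mathbb{R}\times[0,1]$) that maps leaves onto horizontal lines $\mathbb{R}\times\{t\}$, maps $U$ onto $\mathbb{R}\times(-1,1)$ (respectively $\mathbb{R}\times[0,1)$), and maps $\omega$ onto $\mathbb{R}\times\{0\}$. A leaf is *singular*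 if it is not regular. (iii) A *strip* is a set $S$ with $\mathbb{R}\times(u,v)\subset S\subset\mathbb{R}\times[u,v]$ for some $u<v$ that is open in $\mathbb{R}\times[u,v]$. Its *boundary intervals* are the connected components of $S\cap(\mathbb{R}\times\{u,v\})$, and the leaves of its canonical foliation are the lines $\mathbb{R}\times\{t\}$, $u<t<v$, and the boundary intervals. (iv) A *striped atlas* on $Z$ is a quotient map $q:\bigsqcup_{\lambda\in\Lambda}S_\lambda\to Z$ from the disjoint union of an at most countable family of strips, such that there are two disjoint families $\{X_\gamma\}_{\gamma\in\Gamma}$ and $\{Y_\gamma\}_{\gamma\in\Gamma}$ of mutually distinct boundary intervals of the strips for which: $q$ is injective on the complement of $\bigcup_\gamma (X_\gamma\cup Y_\gamma)$; $q(X_\gamma)=q(Y_\gamma)$ for each $\gamma$; and the restrictions $q|_{X_\gamma}$ and $q|_{Y_\gamma}$ are embeddings with closed images. The foliated surface $(Z,\Delta)$ is *striped* if $Z$ has a striped atlas $q$ such that the leaves of $\Delta$ are exactly the $q$-images of the leaves of the canonical foliations of the strips. Theorem. Suppose that the family of all singular leaves of $\Delta$ is locally finite and that each leaf of $\Delta$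 contained in $\operatorname{Int}Z$ admits a cross section. Then each leaf of $\Delta$ contained in $\partial Z$ also admits a cross section, and $(Z,\Delta)$ is a striped surface. -/

import Mathlib

open Set Topology

namespace FoliatedSurface

/-- Interior points of a surface (possibly with boundary): the points that have an open
neighbourhood homeomorphic to the plane. -/
def surfInt (Z : Type*) [TopologicalSpace Z] : Set Z :=
  {z | ∃ U : Set Z, IsOpen U ∧ z ∈ U ∧ Nonempty (U ≃ₜ ℝ × ℝ)}

/-- The boundary of a surface: the points that are not interior. -/
def surfBd (Z : Type*) [TopologicalSpace Z] : Set Z := (surfInt Z)ᶜ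

section

variable {Z : Type*} [TopologicalSpace Z]

/-- The element of the partition `Δ` that contains `z`. The set of all leaves is `Δ.classes`, and
the space of leaves is `Quotient Δ`. -/
def leafOf (Δ : Setoid Z) (z : Z) : Set Z := {w | Δ w z}

/-- A chart `h : U ≃ₜ ℝ × T` (with `T = ℝ` or `T = [0, ∞)`) is foliated if the connected components
of the intersections of the leaves with `U` are exactly the horizontal lines of the chart. -/
def IsFoliatedChart (Δ : Setoid Z) (U : Set Z) {T : Type*} [TopologicalSpace T]
    (h : U ≃ₜ ℝ × T) : Prop :=
  ∀ x : U, connectedComponentIn (leafOf Δ x ∩ U) (x : Z) =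
    (fun y : U => (y : Z)) '' {y : U | (h y).2 = (h x).2}

/-- `Δ` is a one-dimensional foliation of the surface `Z` and each connected component of the
boundary is a leaf. The charts express at the same time that `Z` is a two-dimensional topological
manifold with boundary (Hausdorffness and a countable base are assumed separately). -/
structure IsFoliatedSurface (Δ : Setoid Z) : Prop where
  leaf_pathConnected : ∀ z : Z, IsPathConnected (leafOf Δ z)
  chart_int : ∀ z ∈ surfInt Z, ∃ U : Set Z, IsOpen U ∧ z ∈ U ∧
    ∃ h : U ≃ₜ ℝ × ℝ, IsFoliatedChart Δ U h
  chart_bd : ∀ z ∈ surfBd Z, ∃ (U : Set Z) (_ : IsOpen U) (hz : z ∈ U)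
    (h : U ≃ₜ ℝ × Ici (0 : ℝ)), IsFoliatedChart Δ U h ∧ ((h ⟨z, hz⟩).2 : ℝ) = 0
  bd_component : ∀ z ∈ surfBd Z, connectedComponentIn (surfBd Z) z = leafOf Δ z

/-- A set is saturated if it is a union of leaves. -/
def IsSaturated (Δ : Setoid Z) (U : Set Z) : Prop := ∀ x ∈ U, leafOf Δ x ⊆ U

/-- `γ : J → Z` is a cross section, where `J = [a, b)` or `J = (a, b)` with `a < b`: it is
continuous, sends `a` (if it lies in `J`) into the boundary, and meets each leaf at most once. -/
def IsCrossSection (Δ : Setoid Z) (a b : ℝ) (J : Set ℝ) (γ : J → Z) : Prop :=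
  a < b ∧ (J = Ico a b ∨ J = Ioo a b) ∧ Continuous γ ∧
    (∀ t : J, (t : ℝ) = a → γ t ∈ surfBd Z) ∧
    Function.Injective (fun t : J => (Quotient.mk Δ (γ t) : Quotient Δ))

/-- A leaf admits a cross section if some cross section meets it. -/
def AdmitsCrossSection (Δ : Setoid Z) (ω : Set Z) : Prop :=
  ∃ (a b : ℝ) (J : Set ℝ) (γ : J → Z), IsCrossSection Δ a b J γ ∧ ∃ t : J, γ t ∈ ω

/-- `ω` has a saturated neighbourhood `U` such that `(closure U, U)` is foliated homeomorphic to
`(ℝ × K, ℝ × K₀)` by a homeomorphism that sends `ω` onto `ℝ × {0}`. -/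
def HasTube (Δ : Setoid Z) (ω : Set Z) (K K₀ : Set ℝ) : Prop :=
  ∃ U : Set Z, U ∈ 𝓝ˢ ω ∧ IsSaturated Δ U ∧ ∃ h : closure U ≃ₜ ℝ × K,
    (∀ x : closure U, (x : Z) ∈ U ↔ ((h x).2 : ℝ) ∈ K₀) ∧
    (∀ x y : closure U, Δ (x : Z) (y : Z) ↔ (h x).2 = (h y).2) ∧
    (∀ x : closure U, (x : Z) ∈ ω ↔ ((h x).2 : ℝ) = 0)

/-- Regular leaves, for interior and for boundary leaves respectively. -/
def IsRegularLeaf (Δ : Setoid Z) (ω : Set Z) : Prop :=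
  (ω ⊆ surfInt Z ∧ HasTube Δ ω (Icc (-1) 1) (Ioo (-1) 1)) ∨
    (ω ⊆ surfBd Z ∧ HasTube Δ ω (Icc 0 1) (Ico 0 1))

/-- The family of singular (that is, not regular) leaves. -/
def singLeaves (Δ : Setoid Z) : Set (Set Z) := {ω ∈ Δ.classes | ¬ IsRegularLeaf Δ ω}

end

/-- A strip: a subset of the plane between `ℝ × (u, v)` and `ℝ × [u, v]` that is open
in `ℝ × [u, v]`. -/
structure Strip where
  u : ℝ
  v : ℝ
  u_lt_v : u < v
  carrier : Set (ℝ × ℝ)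
  le_carrier : univ ×ˢ Ioo u v ⊆ carrier
  carrier_le : carrier ⊆ univ ×ˢ Icc u v
  carrier_open : ∃ O : Set (ℝ × ℝ), IsOpen O ∧ carrier = O ∩ (univ ×ˢ Icc u v)

/-- The boundary of a strip: its points on the two lines `ℝ × {u}` and `ℝ × {v}`. -/
def Strip.bd (S : Strip) : Set S.carrier := {p | p.1.2 = S.u ∨ p.1.2 = S.v}

/-- The boundary intervals of a strip. -/
def Strip.bdIntervals (S : Strip) : Set (Set S.carrier) :=
  {I | ∃ p ∈ S.bd, I = connectedComponentIn S.bd p}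

/-- The leaves of the canonical foliation of a strip: the lines `ℝ × {t}` with `u < t < v` and the
boundary intervals. -/
def Strip.leaves (S : Strip) : Set (Set S.carrier) :=
  {I | ∃ t ∈ Ioo S.u S.v, I = {p | p.1.2 = t}} ∪ S.bdIntervals

/-- The disjoint union of a family of strips. -/
abbrev StripSum {L : Type} (S : L → Strip) : Type := Σ i, (S i).carrier

/-- The boundary intervals of a disjoint union of strips. -/
def bdIntervals {L : Type} (S : L → Strip) : Set (Set (StripSum S)) :=
  {A | ∃ i, ∃ I ∈ (S i).bdIntervals, A = Sigma.mk i '' I}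

/-- The leaves of the canonical foliation of a disjoint union of strips. -/
def stripLeaves {L : Type} (S : L → Strip) : Set (Set (StripSum S)) :=
  {A | ∃ i, ∃ I ∈ (S i).leaves, A = Sigma.mk i '' I}

/-- `q` is a striped atlas on `Z`, for which the boundary intervals `X g` and `Y g` of the strips
are glued together. -/
def IsStripedAtlas {Z : Type*} [TopologicalSpace Z] {L : Type} (S : L → Strip)
    (q : StripSum S → Z) : Prop :=
  Countable L ∧ IsQuotientMap q ∧ ∃ (G : Type) (X Y : G → Set (StripSum S)),
    (∀ g, X g ∈ bdIntervals S) ∧ (∀ g, Y g ∈ bdIntervals S) ∧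
    Function.Injective X ∧ Function.Injective Y ∧ (∀ g g', X g ≠ Y g') ∧
    InjOn q ((⋃ g, X g) ∪ (⋃ g, Y g))ᶜ ∧
    (∀ g, q '' X g = q '' Y g) ∧
    (∀ g, IsClosedEmbedding (fun p : X g => q p)) ∧
    (∀ g, IsClosedEmbedding (fun p : Y g => q p))

/-- `(Z, Δ)` is striped: `Z` has a striped atlas whose canonical foliation, formed by the images
of the leaves of the strips, is `Δ`. -/
def IsStriped {Z : Type*} [TopologicalSpace Z] (Δ : Setoid Z) : Prop :=
  ∃ (L : Type) (S : L → Strip) (q : StripSum S → Z),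
    IsStripedAtlas S q ∧ Δ.classes = {ω | ∃ A ∈ stripLeaves S, ω = q '' A}

end FoliatedSurface

set_option linter.unusedSectionVars false
namespace FoliatedSurface

/-! ### Straightening a family of ordered fibres. -/

section FibreOrder

variable {N B : Type*} [TopologicalSpace N] [TopologicalSpace B]

/-- `R` is a strict linear order on each fibre of `t`, and it is an open relation on the
fibre product. -/
structure FibOrder (t : N → B) (R : N → N → Prop) : Prop where
  fib : ∀ {x y}, R x y → t x = t y
  total : ∀ {x y}, t x = t y → x ≠ y → R x y ∨ R y x
  irrefl : ∀ x, ¬ R x x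
  trans : ∀ {x y z}, R x y → R y z → R x z
  isOpen : ∀ {x y}, R x y → ∀ᶠ q : N × N in 𝓝 (x, y), t q.1 = t q.2 → R q.1 q.2

/-- A box around `z`: increasing local parametrisations of the fibres near that of `z`. -/
def HasFibBox (t : N → B) (R : N → N → Prop) (z : N) : Prop :=
  ∃ Q ∈ 𝓝 (t z), ∃ κ : ℝ → B → N, ContinuousOn (fun q : ℝ × B => κ q.1 q.2) (univ ×ˢ Q) ∧
    (∀ x, ∀ s ∈ Q, t (κ x s) = s) ∧ (∀ s ∈ Q, ∀ x x', x < x' → R (κ x s) (κ x' s)) ∧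
    κ 0 (t z) = z

namespace FibOrder

variable {t : N → B} {R : N → N → Prop}

theorem asymm (h : FibOrder t R) {x y : N} (hxy : R x y) : ¬ R y x :=
  fun hyx => h.irrefl x (h.trans hxy hyx)

theorem eventually_lt (h : FibOrder t R) {X : Type*} [TopologicalSpace X] {l : Filter X}
    {u v : X → N} {x y : N} (hu : Filter.Tendsto u l (𝓝 x)) (hv : Filter.Tendsto v l (𝓝 y))
    (hR : R x y) : ∀ᶠ a in l, t (u a) = t (v a) → R (u a) (v a) :=
  (hu.prodMk_nhds hv).eventually (h.isOpen hR)

end FibOrder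

/-- The clipped coordinate of a box: `0` before the box, `1` after it. -/
noncomputable def clipCoord (t : N → B) (R : N → N → Prop) (κ : ℝ → B → N) (z : N) : ℝ :=
  sSup (insert 0 {x | x ∈ Icc (0 : ℝ) 1 ∧ R (κ x (t z)) z})

section Clip

variable {t : N → B} {R : N → N → Prop} {κ : ℝ → B → N} {Q : Set B}

theorem clipCoord_bddAbove (z : N) :
    BddAbove (insert 0 {x | x ∈ Icc (0 : ℝ) 1 ∧ R (κ x (t z)) z}) := by
  refine ⟨1, ?_⟩
  rintro x (rfl | hx)
  · exact zero_le_one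
  · exact hx.1.2

theorem clipCoord_nonneg (z : N) : 0 ≤ clipCoord t R κ z :=
  le_csSup (clipCoord_bddAbove z) (mem_insert _ _)

theorem clipCoord_le_one (z : N) : clipCoord t R κ z ≤ 1 := by
  refine csSup_le (insert_nonempty _ _) ?_
  rintro x (rfl | hx)
  · exact zero_le_one
  · exact hx.1.2

theorem le_clipCoord {z : N} {x : ℝ} (hx : x ∈ Icc (0 : ℝ) 1) (h : R (κ x (t z)) z) :
    x ≤ clipCoord t R κ z :=
  le_csSup (clipCoord_bddAbove z) (mem_insert_of_mem _ ⟨hx, h⟩)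

theorem clipCoord_le (hR : FibOrder t R) (hmono : ∀ s ∈ Q, ∀ x x', x < x' → R (κ x s) (κ x' s))
    {z : N} (hz : t z ∈ Q) {x : ℝ} (hx : 0 ≤ x) (h : R z (κ x (t z))) :
    clipCoord t R κ z ≤ x := by
  refine csSup_le (insert_nonempty _ _) ?_
  rintro y (rfl | hy)
  · exact hx
  · by_contra! hxy
    exact hR.irrefl _ (hR.trans (hR.trans h (hmono _ hz _ _ hxy)) hy.2)

theorem clipCoord_mono (hR : FibOrder t R) {z z' : N} (h : R z z') :
    clipCoord t R κ z ≤ clipCoord t R κ z' := by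
  have e := hR.fib h
  refine csSup_le (insert_nonempty _ _) ?_
  rintro y (rfl | hy)
  · exact clipCoord_nonneg _
  · exact le_clipCoord hy.1 (hR.trans (e ▸ hy.2) h)

/-- Each of the two semicontinuities is the openness of `R` along a section `w ↦ κ x (t w)`. -/
theorem clipCoord_continuousAt (hR : FibOrder t R) (ht : Continuous t)
    (hκ : ContinuousOn (fun q : ℝ × B => κ q.1 q.2) (univ ×ˢ Q))
    (hfib : ∀ x, ∀ s ∈ Q, t (κ x s) = s)
    (hmono : ∀ s ∈ Q, ∀ x x', x < x' → R (κ x s) (κ x' s)) {z : N} (hz : Q ∈ 𝓝 (t z)) :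
    ContinuousAt (clipCoord t R κ) z := by
  have hQ := mem_of_mem_nhds hz
  have hsec : ∀ x, ContinuousAt (fun w => κ x (t w)) z := fun x => by
    have h1 : ContinuousAt (fun q : ℝ × B => κ q.1 q.2) (x, t z) :=
      hκ.continuousAt (prod_mem_nhds Filter.univ_mem hz)
    exact h1.comp (f := fun w => (x, t w)) (by fun_prop)
  have hev : ∀ᶠ w in 𝓝 z, t w ∈ Q := ht.continuousAt.eventually hz
  refine tendsto_order.2 ⟨fun α hα => ?_, fun β hβ => ?_⟩
  · rcases lt_or_ge α 0 with h0 | h0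
    · exact Filter.Eventually.of_forall fun w => h0.trans_le (clipCoord_nonneg w)
    · obtain ⟨x, hx, hαx⟩ := exists_lt_of_lt_csSup (insert_nonempty _ _) hα
      rcases hx with rfl | hx
      · exact absurd hαx (not_lt.2 h0)
      · filter_upwards [hR.eventually_lt (hsec x) continuousAt_id hx.2, hev] with w hw hwQ
        exact hαx.trans_le (le_clipCoord hx.1 (hw (hfib _ _ hwQ)))
  · rcases lt_or_ge 1 β with h1 | h1
    · exact Filter.Eventually.of_forall fun w => (clipCoord_le_one w).trans_lt h1
    · obtain ⟨x, hx1, hx2⟩ := exists_between hβ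
      obtain ⟨y, hy1, hy2⟩ := exists_between hx2
      -- Two intermediate values are needed: `x` gives only that `z` is not after `κ x`, perhaps
      -- with equality, and passing to `y` makes the relation strict, hence open.
      have hx0 : 0 ≤ x := (clipCoord_nonneg z).trans hx1.le
      have hxI : x ∈ Icc (0 : ℝ) 1 := ⟨hx0, (hx2.trans_le h1).le⟩
      have hzy : R z (κ y (t z)) := by
        by_cases hzx : z = κ x (t z)
        · have := hmono _ hQ _ _ hy1
          rwa [← hzx] at this
        · rcases hR.total (hfib x _ hQ).symm hzx with h | h
          · exact hR.trans h (hmono _ hQ _ _ hy1)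
          · exact absurd (le_clipCoord hxI h) (not_le.2 hx1)
      filter_upwards [hR.eventually_lt continuousAt_id (hsec y) hzy, hev] with w hw hwQ
      exact (clipCoord_le hR hmono hwQ (hx0.trans hy1.le) (hw (hfib _ _ hwQ).symm)).trans_lt hy2

/-- If `κ c` were before `z`, so would be `κ x` for slightly larger `x`; if it were after `z`, so
would be `κ x` for slightly smaller `x`. Both contradict the choice of `c` as a supremum. A box
curve thus skips no point between its walls, and the fibre itself need not be connected. -/
theorem eq_of_between (hR : FibOrder t R)
    (hκ : ContinuousOn (fun q : ℝ × B => κ q.1 q.2) (univ ×ˢ Q))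
    (hfib : ∀ x, ∀ s ∈ Q, t (κ x s) = s)
    (hmono : ∀ s ∈ Q, ∀ x x', x < x' → R (κ x s) (κ x' s)) {z : N} (hz : t z ∈ Q)
    (h0 : R (κ 0 (t z)) z) (h1 : R z (κ 1 (t z))) :
    κ (clipCoord t R κ z) (t z) = z ∧ clipCoord t R κ z < 1 := by
  set c := clipCoord t R κ z with hc
  have hcon : Continuous fun x => κ x (t z) := by
    refine continuous_iff_continuousAt.2 fun x => ?_
    have : ContinuousOn (fun x => κ x (t z)) univ :=
      hκ.comp (f := fun x : ℝ => (x, t z)) (by fun_prop) (fun x _ => ⟨mem_univ _, hz⟩)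
    exact this.continuousAt Filter.univ_mem
  have key : κ c (t z) = z := by
    by_contra hne
    rcases hR.total (hfib c _ hz) hne with h | h
    · have hc1 : c < 1 := by
        by_contra! hc1
        have : c = 1 := le_antisymm (clipCoord_le_one z) hc1
        exact hR.asymm h1 (this ▸ h)
      have hev : ∀ᶠ x in 𝓝[>] c, R (κ x (t z)) z := by
        have := (hR.eventually_lt hcon.continuousAt (tendsto_const_nhds (x := z)) h)
        filter_upwards [nhdsWithin_le_nhds this] with x hx using hx (hfib _ _ hz)
      obtain ⟨x, hx, hxc⟩ := (hev.and (Ioo_mem_nhdsGT hc1)).exists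
      exact absurd (le_clipCoord ⟨(clipCoord_nonneg z).trans hxc.1.le, hxc.2.le⟩ hx)
        (not_le.2 hxc.1)
    · have hc0 : 0 < c := by
        by_contra! hc0
        have : c = 0 := le_antisymm hc0 (clipCoord_nonneg z)
        exact hR.asymm h0 (this ▸ h)
      have hev : ∀ᶠ x in 𝓝[<] c, R z (κ x (t z)) := by
        have := (hR.eventually_lt (tendsto_const_nhds (x := z)) hcon.continuousAt h)
        filter_upwards [nhdsWithin_le_nhds this] with x hx using hx (hfib _ _ hz).symm
      obtain ⟨x, hx, hxc⟩ := (hev.and (Ioo_mem_nhdsLT hc0)).exists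
      exact absurd (clipCoord_le hR hmono hz hxc.1.le hx) (not_le.2 hxc.2)
  refine ⟨key, lt_of_le_of_ne (clipCoord_le_one z) fun h => ?_⟩
  rw [h] at key
  exact hR.irrefl _ (key ▸ h1)

/-- Only `z` has to lie between the walls: it is on the curve at a parameter below 1, and slightly
larger parameters still give points before `z'`. -/
theorem clipCoord_strict (hR : FibOrder t R)
    (hκ : ContinuousOn (fun q : ℝ × B => κ q.1 q.2) (univ ×ˢ Q))
    (hfib : ∀ x, ∀ s ∈ Q, t (κ x s) = s)
    (hmono : ∀ s ∈ Q, ∀ x x', x < x' → R (κ x s) (κ x' s)) {z z' : N} (hz : t z ∈ Q)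
    (h0 : R (κ 0 (t z)) z) (h1 : R z (κ 1 (t z))) (hzz' : R z z') :
    clipCoord t R κ z < clipCoord t R κ z' := by
  obtain ⟨hk, hlt⟩ := eq_of_between hR hκ hfib hmono hz h0 h1
  set c := clipCoord t R κ z
  have hcon : Continuous fun x => κ x (t z) := by
    have : ContinuousOn (fun x => κ x (t z)) univ :=
      hκ.comp (f := fun x : ℝ => (x, t z)) (by fun_prop) (fun x _ => ⟨mem_univ _, hz⟩)
    exact continuousOn_univ.1 this
  have e := hR.fib hzz'
  have hev : ∀ᶠ x in 𝓝[>] c, R (κ x (t z)) z' := by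
    have := hR.eventually_lt (hcon.continuousAt (x := c)) (tendsto_const_nhds (x := z'))
      (show R (κ c (t z)) z' by rwa [hk])
    filter_upwards [nhdsWithin_le_nhds this] with x hx using hx ((hfib _ _ hz).trans e)
  obtain ⟨x, hx, hxc⟩ := (hev.and (Ioo_mem_nhdsGT hlt)).exists
  exact hxc.1.trans_le (le_clipCoord ⟨(clipCoord_nonneg z).trans hxc.1.le, hxc.2.le⟩ (e ▸ hx))

end Clip

section Straighten

/-- Weighted sums of clipped box coordinates, one for each index `i`. -/
structure BoxFamily (t : N → B) (R : N → N → Prop) (ι : Type*) where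
  κ : ι → ℝ → B → N
  w : ι → ℝ
  w_pos : ∀ i, 0 < w i
  w_summable : Summable w
  ρ : ι → B → ℝ
  ρ_cont : ∀ i, Continuous (ρ i)
  ρ_nonneg : ∀ i s, 0 ≤ ρ i s
  ρ_le_one : ∀ i s, ρ i s ≤ 1
  Q : ι → Set B
  Q_nhds : ∀ i, ∀ s ∈ closure {s | ρ i s ≠ 0}, Q i ∈ 𝓝 s
  κ_cont : ∀ i, ContinuousOn (fun q : ℝ × B => κ i q.1 q.2) (univ ×ˢ Q i)
  κ_fib : ∀ i x, ∀ s ∈ Q i, t (κ i x s) = s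
  κ_mono : ∀ i, ∀ s ∈ Q i, ∀ x x', x < x' → R (κ i x s) (κ i x' s)
  cover : ∀ z, ∃ i, 0 < ρ i (t z) ∧ R (κ i 0 (t z)) z ∧ R z (κ i 1 (t z))

namespace BoxFamily

variable {t : N → B} {R : N → N → Prop} {ι : Type*} (F : BoxFamily t R ι)

theorem Q_mem (i : ι) {s : B} (h : F.ρ i s ≠ 0) : s ∈ F.Q i :=
  mem_of_mem_nhds (F.Q_nhds i s (subset_closure h))

/-- The summand of index `i`. -/
noncomputable def term (i : ι) (z : N) : ℝ := F.w i * (F.ρ i (t z) * clipCoord t R (F.κ i) z)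

/-- The total weight at `s`. -/
noncomputable def weight (s : B) : ℝ := ∑' i, F.w i * F.ρ i s

theorem term_nonneg (i : ι) (z : N) : 0 ≤ F.term i z :=
  mul_nonneg (F.w_pos i).le (mul_nonneg (F.ρ_nonneg _ _) (clipCoord_nonneg z))

theorem term_le (i : ι) (z : N) : F.term i z ≤ F.w i * F.ρ i (t z) :=
  mul_le_mul_of_nonneg_left (mul_le_of_le_one_right (F.ρ_nonneg _ _) (clipCoord_le_one z))
    (F.w_pos i).le

theorem weight_term_le (i : ι) (s : B) : F.w i * F.ρ i s ≤ F.w i :=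
  mul_le_of_le_one_right (F.w_pos i).le (F.ρ_le_one _ _)

theorem weight_term_nonneg (i : ι) (s : B) : 0 ≤ F.w i * F.ρ i s :=
  mul_nonneg (F.w_pos i).le (F.ρ_nonneg _ _)

theorem summable_weight (s : B) : Summable fun i => F.w i * F.ρ i s :=
  F.w_summable.of_nonneg_of_le (fun i => F.weight_term_nonneg i s) fun i => F.weight_term_le i s

theorem summable_term (z : N) : Summable fun i => F.term i z :=
  (F.summable_weight (t z)).of_nonneg_of_le (fun i => F.term_nonneg i z) fun i => F.term_le i z

theorem continuous_weight : Continuous F.weight := by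
  refine continuous_tsum (fun i => continuous_const.mul (F.ρ_cont i)) F.w_summable fun i s => ?_
  rw [Real.norm_of_nonneg (F.weight_term_nonneg i s)]
  exact F.weight_term_le i s

/-- Over the closure of the support of the cutoff the box is available; elsewhere the term vanishes
locally. -/
theorem continuous_term (hR : FibOrder t R) (ht : Continuous t) (i : ι) :
    Continuous (F.term i) := by
  refine continuous_const.mul (continuous_iff_continuousAt.2 fun z => ?_)
  by_cases hz : t z ∈ closure {s | F.ρ i s ≠ 0}
  · exact ((F.ρ_cont i).comp ht).continuousAt.mul
      (clipCoord_continuousAt hR ht (F.κ_cont i) (F.κ_fib i) (F.κ_mono i) (F.Q_nhds i _ hz))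
  · have : ∀ᶠ w in 𝓝 z, 0 = F.ρ i (t w) * clipCoord t R (F.κ i) w := by
      filter_upwards [ht.continuousAt.eventually (isClosed_closure.isOpen_compl.mem_nhds hz)]
        with w hw
      have : F.ρ i (t w) = 0 := by
        by_contra h
        exact hw (subset_closure h)
      rw [this, zero_mul]
    exact continuousAt_const.congr this

theorem weight_pos (z : N) : 0 < F.weight (t z) := by
  obtain ⟨i, hi, -⟩ := F.cover z
  exact (F.summable_weight _).tsum_pos (fun i => F.weight_term_nonneg i _) i
    (mul_pos (F.w_pos i) hi)

/-- The straightening function. -/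
noncomputable def fn (z : N) : ℝ := (∑' i, F.term i z) / F.weight (t z)

theorem continuous_fn (hR : FibOrder t R) (ht : Continuous t) : Continuous F.fn := by
  refine Continuous.div ?_ (F.continuous_weight.comp ht) fun z => (F.weight_pos z).ne'
  refine continuous_tsum (F.continuous_term hR ht) F.w_summable fun i z => ?_
  rw [Real.norm_of_nonneg (F.term_nonneg i z)]
  exact (F.term_le i z).trans (F.weight_term_le i _)

/-- The weight depends on the fibre only, no summand decreases along a fibre, and the box that has
`z` between its walls contributes a strict increase. -/
theorem fn_strict (hR : FibOrder t R) {z z' : N} (h : R z z') : F.fn z < F.fn z' := by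
  have e := hR.fib h
  obtain ⟨i, hi, h0, h1⟩ := F.cover z
  unfold fn
  rw [← e]
  refine div_lt_div_of_pos_right ?_ (F.weight_pos z)
  refine (F.summable_term z).tsum_lt_tsum (i := i) (fun j => ?_) ?_ (F.summable_term z')
  · unfold term
    rw [← e]
    exact mul_le_mul_of_nonneg_left (mul_le_mul_of_nonneg_left (clipCoord_mono hR h)
      (F.ρ_nonneg _ _)) (F.w_pos j).le
  · unfold term
    rw [← e]
    exact mul_lt_mul_of_pos_left (mul_lt_mul_of_pos_left
      (clipCoord_strict hR (F.κ_cont i) (F.κ_fib i) (F.κ_mono i) (F.Q_mem i hi.ne') h0 h1 h) hi)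
      (F.w_pos i)

theorem fn_nonneg (z : N) : 0 ≤ F.fn z :=
  div_nonneg (tsum_nonneg fun i => F.term_nonneg i z) (F.weight_pos z).le

theorem fn_le_one (z : N) : F.fn z ≤ 1 :=
  (div_le_one (F.weight_pos z)).2
    ((F.summable_term z).tsum_le_tsum (fun i => F.term_le i z) (F.summable_weight _))

theorem fn_mem (hR : FibOrder t R) (z : N) : F.fn z ∈ Ioo (0 : ℝ) 1 := by
  obtain ⟨i, hi, h0, h1⟩ := F.cover z
  exact ⟨(F.fn_nonneg _).trans_lt (F.fn_strict hR h0),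
    (F.fn_strict hR h1).trans_le (F.fn_le_one _)⟩

/-- Among finitely many lower walls in a fibre there is a first one, and there all the terms vanish.
Since the tails of the weights are small, `fn` then comes arbitrarily close to 0 on each fibre. -/
theorem exists_all_zero (hR : FibOrder t R) (z : N) (A : Finset ι) :
    ∃ y, t y = t z ∧ ∀ i ∈ A, F.term i y = 0 := by
  classical
  induction A using Finset.induction_on with
  | empty => exact ⟨z, rfl, by simp⟩
  | insert i A hi ih =>
    obtain ⟨y, hy, hA⟩ := ih
    have main : ∀ y', t y' = t z → (y' = y ∨ R y' y) → F.term i y' = 0 →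
        ∃ y, t y = t z ∧ ∀ j ∈ insert i A, F.term j y = 0 := fun y' hy' hle h0 => by
      refine ⟨y', hy', fun j hj => ?_⟩
      rcases Finset.mem_insert.1 hj with rfl | hj
      · exact h0
      · rcases hle with rfl | hle
        · exact hA j hj
        · refine le_antisymm ?_ (F.term_nonneg _ _)
          rw [← hA j hj]
          unfold term
          rw [hy, hy']
          exact mul_le_mul_of_nonneg_left (mul_le_mul_of_nonneg_left (clipCoord_mono hR hle)
            (F.ρ_nonneg _ _)) (F.w_pos j).le
    by_cases hρ : F.ρ i (t z) = 0
    · exact main y hy (Or.inl rfl) (by unfold term; rw [hy, hρ]; simp)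
    · have hQ := F.Q_mem i hρ
      have hf := F.κ_fib i 0 _ hQ
      have hz0 : ∀ y', t y' = t z → (y' = F.κ i 0 (t z) ∨ R y' (F.κ i 0 (t z))) →
          F.term i y' = 0 := fun y' hy' hle => by
        have hlt : R y' (F.κ i 0 (t z)) → clipCoord t R (F.κ i) y' = 0 := fun h =>
          le_antisymm (clipCoord_le hR (F.κ_mono i) (hy' ▸ hQ) le_rfl (hy' ▸ h))
            (clipCoord_nonneg _)
        have : clipCoord t R (F.κ i) y' = 0 := by
          rcases hle with h | h
          · refine le_antisymm (le_of_forall_pos_le_add fun ε hε => ?_) (clipCoord_nonneg _)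
            rw [zero_add]
            refine clipCoord_le hR (F.κ_mono i) (hy' ▸ hQ) hε.le ?_
            rw [hy', h]
            exact F.κ_mono i _ hQ _ _ hε
          · exact hlt h
        unfold term
        rw [this]; simp
      by_cases hyy : F.κ i 0 (t z) = y
      · exact main y hy (Or.inl rfl) (hz0 y hy (Or.inl hyy.symm))
      · rcases hR.total (hf.trans hy.symm) hyy with h | h
        · exact main _ hf (Or.inr h) (hz0 _ hf (Or.inl rfl))
        · exact main y hy (Or.inl rfl) (hz0 y hy (Or.inr h))

theorem exists_all_one (hR : FibOrder t R) (z : N) (A : Finset ι) :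
    ∃ y, t y = t z ∧ ∀ i ∈ A, F.term i y = F.w i * F.ρ i (t z) := by
  classical
  induction A using Finset.induction_on with
  | empty => exact ⟨z, rfl, by simp⟩
  | insert i A hi ih =>
    obtain ⟨y, hy, hA⟩ := ih
    have main : ∀ y', t y' = t z → (y' = y ∨ R y y') → F.term i y' = F.w i * F.ρ i (t z) →
        ∃ y, t y = t z ∧ ∀ j ∈ insert i A, F.term j y = F.w j * F.ρ j (t z) :=
        fun y' hy' hle h0 => by
      refine ⟨y', hy', fun j hj => ?_⟩
      rcases Finset.mem_insert.1 hj with rfl | hj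
      · exact h0
      · rcases hle with rfl | hle
        · exact hA j hj
        · refine le_antisymm (hy' ▸ F.term_le _ _) ?_
          rw [← hA j hj]
          unfold term
          rw [hy, hy']
          exact mul_le_mul_of_nonneg_left (mul_le_mul_of_nonneg_left (clipCoord_mono hR hle)
            (F.ρ_nonneg _ _)) (F.w_pos j).le
    by_cases hρ : F.ρ i (t z) = 0
    · exact main y hy (Or.inl rfl) (by unfold term; rw [hy, hρ]; simp)
    · have hQ := F.Q_mem i hρ
      have hf := F.κ_fib i 1 _ hQ
      -- The point at parameter 2 lies strictly beyond the wall at parameter 1, so its clipped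
      -- coordinate is 1.
      have hf2 := F.κ_fib i 2 _ hQ
      have hz0 : ∀ y', t y' = t z → R (F.κ i 1 (t z)) y' →
          F.term i y' = F.w i * F.ρ i (t z) := fun y' hy' h => by
        have : clipCoord t R (F.κ i) y' = 1 :=
          le_antisymm (clipCoord_le_one _) (le_clipCoord ⟨zero_le_one, le_rfl⟩ (hy' ▸ h))
        unfold term
        rw [this, hy', mul_one]
      have h12 := F.κ_mono i _ hQ 1 2 (by norm_num)
      by_cases hyy : F.κ i 2 (t z) = y
      · exact main y hy (Or.inl rfl) (hz0 y hy (hyy ▸ h12))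
      · rcases hR.total (hf2.trans hy.symm) hyy with h | h
        · exact main y hy (Or.inl rfl) (hz0 y hy (hR.trans h12 h))
        · exact main _ hf2 (Or.inr h) (hz0 _ hf2 h12)

/-- Values near 0 and near 1 occur on every fibre, by truncation of the series; a connected fibre
takes all values in between. On a disconnected fibre values may be omitted, which is how gaps
between boundary intervals of a strip arise. -/
theorem surj_fn (hR : FibOrder t R) (ht : Continuous t) (z : N)
    (hc : IsPreconnected (t ⁻¹' {t z})) : Ioo (0 : ℝ) 1 ⊆ F.fn '' (t ⁻¹' {t z}) := by
  intro v hv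
  have hW := F.weight_pos z
  have hs := F.summable_weight (t z)
  have tail : ∀ ε > 0, ∃ A : Finset ι, F.weight (t z) - ∑ i ∈ A, F.w i * F.ρ i (t z) < ε := by
    intro ε hε
    obtain ⟨A, hA⟩ := (hs.hasSum.eventually (lt_mem_nhds (sub_lt_self _ hε))).exists
    exact ⟨A, by unfold weight; linarith⟩
  have lo : ∃ y, t y = t z ∧ F.fn y < v := by
    obtain ⟨A, hA⟩ := tail (v * F.weight (t z)) (mul_pos hv.1 hW)
    obtain ⟨y, hy, h0⟩ := F.exists_all_zero hR z A
    refine ⟨y, hy, ?_⟩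
    unfold fn
    rw [hy, div_lt_iff₀ hW]
    refine lt_of_le_of_lt ?_ hA
    have h1 : ∑' i, F.term i y + ∑ i ∈ A, F.w i * F.ρ i (t z) ≤ F.weight (t z) := by
      have e1 : ∑ i ∈ A, F.w i * F.ρ i (t z) = ∑ i ∈ A, (F.w i * F.ρ i (t z) - F.term i y) :=
        Finset.sum_congr rfl fun i hi => by rw [h0 i hi, sub_zero]
      have e2 := (hs.sub (F.summable_term y)).sum_le_tsum A fun i _ =>
        sub_nonneg.2 (hy ▸ F.term_le i y)
      rw [hs.tsum_sub (F.summable_term y)] at e2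
      rw [e1]
      unfold weight
      linarith
    linarith
  have hi : ∃ y, t y = t z ∧ v < F.fn y := by
    obtain ⟨A, hA⟩ := tail ((1 - v) * F.weight (t z)) (mul_pos (sub_pos.2 hv.2) hW)
    obtain ⟨y, hy, h0⟩ := F.exists_all_one hR z A
    refine ⟨y, hy, ?_⟩
    unfold fn
    rw [hy, lt_div_iff₀ hW]
    have h1 : ∑ i ∈ A, F.w i * F.ρ i (t z) ≤ ∑' i, F.term i y := by
      rw [← Finset.sum_congr rfl h0]
      exact (F.summable_term y).sum_le_tsum A fun i _ => F.term_nonneg i y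
    linarith
  obtain ⟨y₁, hy₁, h₁⟩ := lo
  obtain ⟨y₂, hy₂, h₂⟩ := hi
  exact hc.intermediate_value hy₁ hy₂ (F.continuous_fn hR ht).continuousOn ⟨h₁.le, h₂.le⟩

end BoxFamily

/-- The Lindelöf property leaves countably many boxes. Summable weights take the place of a
partition of unity, so no local finiteness is needed. -/
theorem exists_boxFamily {N B : Type*} [TopologicalSpace N] [SecondCountableTopology N]
    [PseudoMetricSpace B] {t : N → B} {R : N → N → Prop} (ht : Continuous t) (hR : FibOrder t R)
    (hbox : ∀ z, HasFibBox t R z) : ∃ ι : Set N, Nonempty (BoxFamily t R ι) := by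
  choose Q hQ κ hκ hfib hmono h0 using hbox
  -- The cutoffs vanish outside the closed ball of radius `ε`; the factor 2 makes `Q` a
  -- neighbourhood of the closure of their support.
  have hε : ∀ z, ∃ ε > 0, Metric.ball (t z) (2 * ε) ⊆ Q z := fun z => by
    obtain ⟨ε, hε, h⟩ := Metric.mem_nhds_iff.1 (hQ z)
    exact ⟨ε / 2, half_pos hε, by rwa [mul_div_cancel₀ _ two_ne_zero]⟩
  choose ε hε hεQ using hε
  -- The shift by 1/2 puts `z` strictly between the walls at parameters 0 and 1.
  let κ' : N → ℝ → B → N := fun z x s => κ z (x - 1 / 2) s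
  let O : N → Set N := fun z =>
    {y | dist (t y) (t z) < ε z ∧ R (κ' z 0 (t y)) y ∧ R y (κ' z 1 (t y))}
  have hO : ∀ z, O z ∈ 𝓝 z := fun z => by
    have hd : ∀ᶠ y in 𝓝 z, dist (t y) (t z) < ε z :=
      ht.continuousAt.eventually (Metric.ball_mem_nhds _ (hε z))
    have hs : ∀ x, Filter.Tendsto (fun y => κ z x (t y)) (𝓝 z) (𝓝 (κ z x (t z))) := fun x => by
      have h1 : ContinuousAt (fun q : ℝ × B => κ z q.1 q.2) (x, t z) :=
        (hκ z).continuousAt (prod_mem_nhds Filter.univ_mem (hQ z))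
      exact h1.comp (f := fun w => (x, t w)) (by fun_prop)
    have hQz := mem_of_mem_nhds (hQ z)
    have e1 := hR.eventually_lt (hs (0 - 1 / 2)) Filter.tendsto_id
      (by have := hmono z _ hQz (0 - 1 / 2) 0 (by norm_num); rwa [h0] at this)
    have e2 := hR.eventually_lt Filter.tendsto_id (hs (1 - 1 / 2))
      (by have := hmono z _ hQz 0 (1 - 1 / 2) (by norm_num); rwa [h0] at this)
    filter_upwards [hd, e1, e2, ht.continuousAt.eventually (hQ z)] with y hy h1 h2 hyQ
    exact ⟨hy, h1 (hfib z _ _ hyQ), h2 (hfib z _ _ hyQ).symm⟩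
  obtain ⟨ι, hι, hcov⟩ := TopologicalSpace.countable_cover_nhds hO
  have := hι.to_subtype
  have := Encodable.ofCountable ι
  obtain ⟨w, hw, c, hc, -⟩ := posSumOfEncodable one_pos ι
  refine ⟨ι, ⟨{
    κ := fun i => κ' i
    w := w
    w_pos := hw
    w_summable := hc.summable
    ρ := fun i s => max 0 (min 1 (ε i - dist s (t i)))
    ρ_cont := fun i => by fun_prop
    ρ_nonneg := fun i s => le_max_left _ _
    ρ_le_one := fun i s => max_le zero_le_one (min_le_left _ _)
    Q := fun i => Metric.ball (t i) (2 * ε i)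
    Q_nhds := fun i s hs => ?_
    κ_cont := fun i => ?_
    κ_fib := fun i x s hs => hfib _ _ _ (hεQ _ hs)
    κ_mono := fun i s hs x x' hx => hmono _ _ (hεQ _ hs) _ _ (by linarith)
    cover := fun z => ?_ }⟩⟩
  · refine Metric.isOpen_ball.mem_nhds ?_
    have hsub : {s | max 0 (min 1 (ε i - dist s (t i))) ≠ 0} ⊆ Metric.closedBall (t i) (ε i) := by
      intro s hs
      by_contra hlt
      rw [Metric.mem_closedBall, not_le] at hlt
      exact hs (max_eq_left ((min_le_right _ _).trans (by linarith)))
    have := closure_minimal hsub Metric.isClosed_closedBall hs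
    rw [Metric.mem_closedBall] at this
    rw [Metric.mem_ball]
    linarith [hε i]
  · refine (hκ i).comp (f := fun q : ℝ × B => (q.1 - 1 / 2, q.2)) (by fun_prop) ?_
    exact fun q hq => ⟨mem_univ _, hεQ _ hq.2⟩
  · have hz : z ∈ ⋃ x ∈ ι, O x := hcov ▸ mem_univ z
    simp only [mem_iUnion] at hz
    obtain ⟨i, hi, h1, h2, h3⟩ := hz
    exact ⟨⟨i, hi⟩, lt_max_of_lt_right (lt_min one_pos (sub_pos.2 h1)), h2, h3⟩

/-- Straightening: a space with an ordered family of fibres that is locally a product embeds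
over the base into the product of the unit interval with the base. -/
theorem exists_straightening {N B : Type*} [TopologicalSpace N] [SecondCountableTopology N]
    [PseudoMetricSpace B] {t : N → B} {R : N → N → Prop} (ht : Continuous t) (hR : FibOrder t R)
    (hbox : ∀ z, HasFibBox t R z) :
    ∃ f : N → ℝ, Continuous f ∧ (∀ z, f z ∈ Ioo (0 : ℝ) 1) ∧ (∀ z z', R z z' → f z < f z') ∧
      (∀ z, IsPreconnected (t ⁻¹' {t z}) → Ioo (0 : ℝ) 1 ⊆ f '' (t ⁻¹' {t z})) ∧
      IsOpenMap fun z => (f z, t z) := by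
  obtain ⟨ι, ⟨F⟩⟩ := exists_boxFamily ht hR hbox
  refine ⟨F.fn, F.continuous_fn hR ht, F.fn_mem hR, fun z z' => F.fn_strict hR,
    F.surj_fn hR ht, IsOpenMap.of_nhds_le fun z => ?_⟩
  have hf := F.continuous_fn hR ht
  intro V hV
  obtain ⟨Q, hQ, κ, hκ, hfib, hmono, h0⟩ := hbox z
  have hQz := mem_of_mem_nhds hQ
  have hat : ∀ x, ContinuousAt (fun q : ℝ × B => κ q.1 q.2) (x, t z) := fun x =>
    hκ.continuousAt (prod_mem_nhds Filter.univ_mem hQ)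
  have h1 : ∀ᶠ q : ℝ × B in 𝓝 (0, t z), (F.fn (κ q.1 q.2), t (κ q.1 q.2)) ∈ V := by
    have := (hat 0).eventually (show ∀ᶠ y in 𝓝 (κ 0 (t z)), y ∈ (fun z => (F.fn z, t z)) ⁻¹' V by
      rw [h0]; exact hV)
    exact this
  rw [nhds_prod_eq, Filter.eventually_prod_iff] at h1
  obtain ⟨pa, hpa, pb, hpb, hpab⟩ := h1
  obtain ⟨η, hη, hball⟩ := Metric.mem_nhds_iff.1 hpa
  have hη2 : 0 < η / 2 := half_pos hη
  have hsec : ∀ x, ContinuousAt (fun q : ℝ × B => F.fn (κ x q.2)) (F.fn z, t z) := fun x =>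
    hf.continuousAt.comp (f := fun q : ℝ × B => κ x q.2)
      ((hat x).comp (f := fun q : ℝ × B => (x, q.2)) (x := (F.fn z, t z)) (by fun_prop))
  have hlo : F.fn (κ (-(η / 2)) (t z)) < F.fn z := by
    have := F.fn_strict hR (hmono _ hQz (-(η / 2)) 0 (by linarith))
    rwa [h0] at this
  have hhi : F.fn z < F.fn (κ (η / 2) (t z)) := by
    have := F.fn_strict hR (hmono _ hQz 0 (η / 2) (by linarith))
    rwa [h0] at this
  have elo := (hsec (-(η / 2))).eventually_lt (continuousAt_fst (p := (F.fn z, t z))) hlo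
  have ehi := (continuousAt_fst (p := (F.fn z, t z))).eventually_lt (hsec (η / 2)) hhi
  have eQ : ∀ᶠ q : ℝ × B in 𝓝 (F.fn z, t z), q.2 ∈ Q ∧ pb q.2 :=
    (continuousAt_snd (p := (F.fn z, t z))).eventually
      (show ∀ᶠ s in 𝓝 (t z), s ∈ Q ∧ pb s from Filter.Eventually.and hQ hpb)
  filter_upwards [elo, ehi, eQ] with q hq1 hq2 ⟨hqQ, hqb⟩
  -- Over a base point near `t z` the ends of the short curve bracket the prescribed value of `fn`.
  -- The intermediate value theorem gives a point with this value, and it satisfies the condition on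
  -- `V` because the curve is short.
  have hcon : Continuous fun x => F.fn (κ x q.2) := by
    refine hf.comp (continuousOn_univ.1 ?_)
    exact hκ.comp (f := fun x : ℝ => (x, q.2)) (by fun_prop) (fun x _ => ⟨mem_univ _, hqQ⟩)
  obtain ⟨x, hx, hxq⟩ := intermediate_value_Icc (by linarith : -(η / 2) ≤ η / 2)
    hcon.continuousOn ⟨hq1.le, hq2.le⟩
  have hxV := hpab (hball (show x ∈ Metric.ball 0 η by
    rw [Metric.mem_ball, Real.dist_eq, sub_zero, abs_lt]; constructor <;> linarith [hx.1, hx.2])) hqb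
  have : q = (F.fn (κ x q.2), t (κ x q.2)) := Prod.ext hxq.symm (hfib x _ hqQ).symm
  rw [this]
  exact hxV

end Straighten

end FibreOrder

end FoliatedSurface
namespace FoliatedSurface

/-! ### Foliated charts, the open projection to the leaves, and cross sections. -/

section Charts

variable {Z : Type*} [TopologicalSpace Z] {T : Type*} [TopologicalSpace T]

/-- The inverse of a foliated chart, as an open embedding. -/
structure IsFolEmb (Δ : Setoid Z) (k : ℝ × T → Z) : Prop where
  isOpenEmbedding : IsOpenEmbedding k
  plaque : ∀ q, connectedComponentIn (leafOf Δ (k q) ∩ range k) (k q) = k '' {r | r.2 = q.2}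

theorem IsFoliatedChart.isFolEmb {Δ : Setoid Z} {U : Set Z} (hU : IsOpen U) {h : U ≃ₜ ℝ × T}
    (hh : IsFoliatedChart Δ U h) : IsFolEmb Δ (fun q => (h.symm q : Z)) := by
  refine ⟨hU.isOpenEmbedding_subtypeVal.comp h.symm.isOpenEmbedding, fun q => ?_⟩
  have hr : range (fun q => (h.symm q : Z)) = U := by
    ext z
    constructor
    · rintro ⟨q, rfl⟩; exact (h.symm q).2
    · intro hz; exact ⟨h ⟨z, hz⟩, by simp⟩
  have := hh (h.symm q)
  rw [hr, this]
  ext z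
  constructor
  · rintro ⟨y, hy, rfl⟩
    exact ⟨h y, by simpa using hy, by simp⟩
  · rintro ⟨r, hr, rfl⟩
    exact ⟨h.symm r, by simpa using hr, rfl⟩

namespace IsFolEmb

variable {Δ : Setoid Z} {k : ℝ × T → Z}

theorem rel (hk : IsFolEmb Δ k) (x x' : ℝ) (t : T) : Δ (k (x, t)) (k (x', t)) := by
  have : k (x, t) ∈ k '' {r | r.2 = t} := ⟨_, rfl, rfl⟩
  rw [← hk.plaque (x', t)] at this
  exact (connectedComponentIn_subset _ _ this).1

theorem eq_of_preconnected (hk : IsFolEmb Δ k) {q r : ℝ × T} {c : Set Z} (hc : IsPreconnected c)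
    (hsub : c ⊆ leafOf Δ (k q) ∩ range k) (hq : k q ∈ c) (hr : k r ∈ c) : q.2 = r.2 := by
  have := hc.subset_connectedComponentIn hq hsub hr
  rw [hk.plaque] at this
  obtain ⟨r', hr', he⟩ := this
  rw [← hk.isOpenEmbedding.injective he]
  exact hr'.symm

theorem preconnected_plaque (hk : IsFolEmb Δ k) {I : Set ℝ} (hI : IsPreconnected I) (t : T) :
    IsPreconnected ((fun x => k (x, t)) '' I) :=
  hI.image _ (hk.isOpenEmbedding.continuous.comp (by fun_prop)).continuousOn

end IsFolEmb

variable {Δ : Setoid Z}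

/-- Here it matters that a leaf is a line in the subspace topology: the line is locally connected,
so the other plaques of the same leaf do not accumulate at `z`. -/
theorem plaque_mem_nhdsWithin {z : Z} (hl : Nonempty (leafOf Δ z ≃ₜ ℝ)) {U : Set Z}
    (hU : IsOpen U) (hz : z ∈ U) :
    connectedComponentIn (leafOf Δ z ∩ U) z ∈ 𝓝[leafOf Δ z] z := by
  obtain ⟨e⟩ := hl
  have : LocallyConnectedSpace (leafOf Δ z) := e.locallyConnectedSpace
  have hz' : z ∈ leafOf Δ z := Δ.refl z
  let F : Set (leafOf Δ z) := Subtype.val ⁻¹' U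
  have hF : IsOpen F := hU.preimage continuous_subtype_val
  have hzF : (⟨z, hz'⟩ : leafOf Δ z) ∈ F := hz
  have h1 : connectedComponentIn F ⟨z, hz'⟩ ∈ 𝓝 (⟨z, hz'⟩ : leafOf Δ z) :=
    hF.connectedComponentIn.mem_nhds (mem_connectedComponentIn hzF)
  rw [mem_nhdsWithin_iff_exists_mem_nhds_inter]
  rw [nhds_subtype_eq_comap, Filter.mem_comap] at h1
  obtain ⟨V, hV, hVs⟩ := h1
  refine ⟨V, hV, fun w hw => ?_⟩
  have hpre : IsPreconnected (Subtype.val '' connectedComponentIn F ⟨z, hz'⟩) :=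
    isPreconnected_connectedComponentIn.image _ continuous_subtype_val.continuousOn
  refine hpre.subset_connectedComponentIn ⟨_, mem_connectedComponentIn hzF, rfl⟩ ?_
    ⟨⟨w, hw.2⟩, hVs hw.1, rfl⟩
  rintro _ ⟨y, hy, rfl⟩
  exact ⟨y.2, connectedComponentIn_subset F _ hy⟩

theorem leafOf_eq {z w : Z} (h : Δ w z) : leafOf Δ w = leafOf Δ z := by
  ext y
  exact ⟨fun hy => Δ.trans hy h, fun hy => Δ.trans hy (Δ.symm h)⟩

/-- A property that is constant on plaques is constant on leaves. -/
theorem leaf_induction (hΔ : IsFoliatedSurface Δ) (hl : ∀ z, Nonempty (leafOf Δ z ≃ₜ ℝ))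
    (Q : Z → Prop) (hQ : ∀ z, ∃ U : Set Z, IsOpen U ∧ z ∈ U ∧
      ∀ w ∈ connectedComponentIn (leafOf Δ z ∩ U) z, (Q w ↔ Q z)) {z w : Z} (h : Δ w z) :
    Q w ↔ Q z := by
  refine (hΔ.leaf_pathConnected z).isConnected.isPreconnected.induction₂ (fun a b => (Q a ↔ Q b))
    (fun a ha => ?_) (fun _ _ _ _ _ _ h1 h2 => h1.trans h2) (fun _ _ _ _ h1 => h1.symm) h
    (Δ.refl z)
  obtain ⟨U, hU, haU, hw⟩ := hQ a
  have := plaque_mem_nhdsWithin (hl a) hU haU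
  rw [leafOf_eq ha] at this hw
  filter_upwards [this] with b hb using (hw b hb).symm

/-- The end point of the closed half-line. -/
def zeroIci : Ici (0 : ℝ) := ⟨0, le_refl (0 : ℝ)⟩

/-- Every point lies in a foliated chart, modelled on the plane or on the half-plane. -/
theorem exists_folEmb (hΔ : IsFoliatedSurface Δ) (z : Z) :
    (∃ (k : ℝ × ℝ → Z) (q : ℝ × ℝ), IsFolEmb Δ k ∧ k q = z ∧ z ∈ surfInt Z) ∨
      (∃ (k : ℝ × Ici (0 : ℝ) → Z) (x : ℝ), IsFolEmb Δ k ∧ k (x, zeroIci) = z ∧ z ∈ surfBd Z) := by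
  by_cases hz : z ∈ surfInt Z
  · obtain ⟨U, hU, hzU, h, hh⟩ := hΔ.chart_int z hz
    exact Or.inl ⟨_, h ⟨z, hzU⟩, hh.isFolEmb hU, by simp, hz⟩
  · obtain ⟨U, hU, hzU, h, hh, h0⟩ := hΔ.chart_bd z hz
    refine Or.inr ⟨_, (h ⟨z, hzU⟩).1, hh.isFolEmb hU, ?_, hz⟩
    have : ((h ⟨z, hzU⟩).1, zeroIci) = h ⟨z, hzU⟩ := Prod.ext rfl (Subtype.ext h0.symm)
    simp [this]

/-- The arbitrary transversal `T` allows plane and half-plane charts to be treated by one argument.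
-/
theorem leaf_induction_chart (hΔ : IsFoliatedSurface Δ) (hl : ∀ z, Nonempty (leafOf Δ z ≃ₜ ℝ))
    (Q : Z → Prop)
    (hQ : ∀ (T : Type) [TopologicalSpace T] (k : ℝ × T → Z), IsFolEmb Δ k →
      ∀ x x' t, Q (k (x, t)) → Q (k (x', t))) {z w : Z} (h : Δ w z) (hw : Q w) : Q z := by
  refine (leaf_induction hΔ hl Q (fun z => ?_) h).1 hw
  have main : ∀ (T : Type) [TopologicalSpace T] (k : ℝ × T → Z) (q : ℝ × T), IsFolEmb Δ k →
      k q = z → ∃ U : Set Z, IsOpen U ∧ z ∈ U ∧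
      ∀ w ∈ connectedComponentIn (leafOf Δ z ∩ U) z, (Q w ↔ Q z) := by
    rintro T _ k q hk rfl
    refine ⟨range k, hk.isOpenEmbedding.isOpen_range, ⟨q, rfl⟩, fun w hw => ?_⟩
    rw [hk.plaque] at hw
    obtain ⟨⟨x, t⟩, ht, rfl⟩ := hw
    obtain ⟨x', t'⟩ := q
    obtain rfl : t = t' := ht
    exact ⟨hQ T k hk _ _ _, hQ T k hk _ _ _⟩
  rcases exists_folEmb hΔ z with ⟨k, q, hk, hq, -⟩ | ⟨k, x, hk, hq, -⟩
  · exact main _ k q hk hq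
  · exact main _ k _ hk hq

/-- The projection onto the space of leaves is open. -/
theorem isOpenMap_mk (hΔ : IsFoliatedSurface Δ) (hl : ∀ z, Nonempty (leafOf Δ z ≃ₜ ℝ)) :
    IsOpenMap (Quotient.mk Δ) := by
  intro O hO
  have hsat : ∀ {z w}, Δ w z → w ∈ Quotient.mk Δ ⁻¹' (Quotient.mk Δ '' O) →
      z ∈ Quotient.mk Δ ⁻¹' (Quotient.mk Δ '' O) := by
    rintro z w h ⟨y, hy, e⟩
    exact ⟨y, hy, e.trans (Quotient.sound h)⟩
  refine isOpen_coinduced.2 (isOpen_iff_mem_nhds.2 fun z hz => ?_)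
  obtain ⟨y, hy, e⟩ := hz
  refine leaf_induction_chart hΔ hl
    (fun z => Quotient.mk Δ ⁻¹' (Quotient.mk Δ '' O) ∈ 𝓝 z) ?_ (Quotient.exact e)
    (Filter.mem_of_superset (hO.mem_nhds hy) (subset_preimage_image _ _))
  intro T _ k hk x x' t h
  have hc := hk.isOpenEmbedding.continuous
  -- A saturated set that contains a piece of transversal through `(x, t)` contains the whole
  -- plaques through this piece, hence a neighbourhood of `(x', t)`.
  have h1 : ∀ᶠ t' in 𝓝 t, k (x, t') ∈ Quotient.mk Δ ⁻¹' (Quotient.mk Δ '' O) :=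
    (hc.comp (by fun_prop : Continuous fun t' : T => (x, t'))).continuousAt.eventually h
  have h2 : ∀ᶠ q : ℝ × T in 𝓝 (x', t), k q ∈ Quotient.mk Δ ⁻¹' (Quotient.mk Δ '' O) := by
    filter_upwards [continuousAt_snd.eventually h1] with q hq
    exact hsat (hk.rel _ _ _) hq
  rw [← hk.isOpenEmbedding.map_nhds_eq]
  exact h2

theorem leafOf_subset_surfBd (hΔ : IsFoliatedSurface Δ) {z : Z} (hz : z ∈ surfBd Z) :
    leafOf Δ z ⊆ surfBd Z :=
  hΔ.bd_component z hz ▸ connectedComponentIn_subset _ _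

theorem isOpen_surfInt : IsOpen (surfInt Z) := by
  refine isOpen_iff_mem_nhds.2 fun z hz => ?_
  obtain ⟨U, hU, hzU, h⟩ := hz
  exact Filter.mem_of_superset (hU.mem_nhds hzU) fun w hw => ⟨U, hU, hw, h⟩

theorem surfInt_of_chart {k : ℝ × Ici (0 : ℝ) → Z} (hk : IsFolEmb Δ k) {q : ℝ × Ici (0 : ℝ)}
    (hq : 0 < q.2.1) : k q ∈ surfInt Z := by
  let V : Set (ℝ × Ici (0 : ℝ)) := {q | 0 < q.2.1}
  have hV : IsOpen V := isOpen_lt continuous_const (by fun_prop)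
  refine ⟨k '' V, hk.isOpenEmbedding.isOpenMap _ hV, mem_image_of_mem _ hq, ⟨?_⟩⟩
  have e1 : V ≃ₜ k '' V := hk.isOpenEmbedding.isEmbedding.homeomorphImage V
  let e2 : V ≃ₜ ℝ × ℝ :=
    { toFun := fun q => (q.1.1, Real.log q.1.2.1)
      invFun := fun q => ⟨(q.1, ⟨Real.exp q.2, (Real.exp_pos _).le⟩), Real.exp_pos _⟩
      left_inv := fun q => by
        have : 0 < q.1.2.1 := q.2
        ext <;> simp [Real.exp_log this]
      right_inv := fun q => by simp
      continuous_toFun := by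
        refine Continuous.prodMk (by fun_prop) (Continuous.log (by fun_prop) fun q => ?_)
        have : 0 < q.1.2.1 := q.2
        exact this.ne'
      continuous_invFun := by fun_prop }
  exact e1.symm.trans e2

/-- Points close to `z` on the same leaf are joined by a connected part of the leaf
close to `z`. -/
def LocLeafConn (Δ : Setoid Z) (z : Z) : Prop :=
  ∀ O ∈ 𝓝 z, ∃ O' ∈ 𝓝 z, ∀ w ∈ O', ∀ w' ∈ O', Δ w' w →
    ∃ c, IsPreconnected c ∧ c ⊆ leafOf Δ w ∩ O ∧ w ∈ c ∧ w' ∈ c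

/-- Plaques of the chart near height `t` lie on different leaves. -/
def PlaqueInj (Δ : Setoid Z) (k : ℝ × T → Z) (t : T) : Prop :=
  ∃ T' ∈ 𝓝 t, ∀ q r : ℝ × T, q.2 ∈ T' → r.2 ∈ T' → Δ (k r) (k q) → q.2 = r.2

/-- `LocLeafConn` mentions no chart, while `PlaqueInj` depends on the height only and not on the
position along the plaque. Passing back and forth between the two moves the property along a leaf
from chart to chart. -/
theorem LocLeafConn.plaqueInj {k : ℝ × T → Z} (hk : IsFolEmb Δ k) {x : ℝ} {t : T}
    (h : LocLeafConn Δ (k (x, t))) : PlaqueInj Δ k t := by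
  obtain ⟨O', hO', hO⟩ := h (range k) (hk.isOpenEmbedding.isOpen_range.mem_nhds ⟨_, rfl⟩)
  refine ⟨{t' | k (x, t') ∈ O'}, ?_, ?_⟩
  · exact (hk.isOpenEmbedding.continuous.comp
      (by fun_prop : Continuous fun t' : T => (x, t'))).continuousAt.eventually hO'
  · rintro ⟨a, s⟩ ⟨b, s'⟩ hs hs' hrel
    obtain ⟨c, hc, hcs, hw, hw'⟩ := hO (k (x, s)) hs (k (x, s')) hs'
      (Δ.trans (hk.rel _ _ _) (Δ.trans hrel (hk.rel _ _ _)))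
    exact hk.eq_of_preconnected (q := (x, s)) (r := (x, s')) hc hcs hw hw'

theorem PlaqueInj.locLeafConn {k : ℝ × T → Z} (hk : IsFolEmb Δ k) {x : ℝ} {t : T}
    (h : PlaqueInj Δ k t) : LocLeafConn Δ (k (x, t)) := by
  intro O hO
  obtain ⟨T', hT', hinj⟩ := h
  have h1 : k ⁻¹' O ∈ 𝓝 (x, t) := hk.isOpenEmbedding.continuous.continuousAt.eventually hO
  rw [nhds_prod_eq, Filter.mem_prod_iff] at h1
  obtain ⟨I, hI, T'', hT'', hsub⟩ := h1
  obtain ⟨ε, hε, hball⟩ := Metric.mem_nhds_iff.1 hI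
  refine ⟨k '' (Metric.ball x ε ×ˢ (T' ∩ T'')), hk.isOpenEmbedding.isOpenMap.image_mem_nhds
    (prod_mem_nhds (Metric.ball_mem_nhds _ hε) (Filter.inter_mem hT' hT'')), ?_⟩
  rintro _ ⟨⟨a, s⟩, ⟨ha, hs⟩, rfl⟩ _ ⟨⟨b, s'⟩, ⟨hb, hs'⟩, rfl⟩ hrel
  obtain rfl : s = s' := hinj _ _ hs.1 hs'.1 hrel
  refine ⟨(fun y => k (y, s)) '' Metric.ball x ε,
    hk.preconnected_plaque (convex_ball x ε).isPreconnected s, ?_, ⟨a, ha, rfl⟩, ⟨b, hb, rfl⟩⟩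
  rintro _ ⟨y, hy, rfl⟩
  exact ⟨hk.rel _ _ _, hsub ⟨hball hy, hs.2⟩⟩

theorem LocLeafConn.of_rel (hΔ : IsFoliatedSurface Δ) (hl : ∀ z, Nonempty (leafOf Δ z ≃ₜ ℝ))
    {z w : Z} (h : Δ w z) (hw : LocLeafConn Δ w) : LocLeafConn Δ z :=
  leaf_induction_chart hΔ hl (LocLeafConn Δ)
    (fun _ _ _ hk _ _ _ h => (h.plaqueInj hk).locLeafConn hk) h hw

theorem image_mem_nhds_of_injOn {g : ℝ → ℝ} {t ε : ℝ} (hε : 0 < ε)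
    (hg : ContinuousOn g (Icc (t - ε) (t + ε))) (hinj : InjOn g (Icc (t - ε) (t + ε))) :
    g '' Icc (t - ε) (t + ε) ∈ 𝓝 (g t) := by
  have hl : t - ε ∈ Icc (t - ε) (t + ε) := ⟨le_rfl, by linarith⟩
  have hr : t + ε ∈ Icc (t - ε) (t + ε) := ⟨by linarith, le_rfl⟩
  have hm : t ∈ Icc (t - ε) (t + ε) := ⟨by linarith, by linarith⟩
  rcases hg.strictMonoOn_of_injOn_Icc' (by linarith) hinj with h | h
  · exact Filter.mem_of_superset (Icc_mem_nhds (h hl hm (by linarith)) (h hm hr (by linarith)))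
      (intermediate_value_Icc (by linarith) hg)
  · exact Filter.mem_of_superset (Icc_mem_nhds (h hm hr (by linarith)) (h hl hm (by linarith)))
      (intermediate_value_Icc' (by linarith) hg)

-- As `γ t` is interior, `t` is not the end point `a`, and `γ` is defined on both sides of `t`. In a
-- chart the height of `γ` is continuous and injective near `t`, so its values fill a neighbourhood
-- of the height of `γ t`. Two plaques at such heights on one leaf would make `γ` meet that leaf
-- twice.
open Classical in
theorem IsCrossSection.locLeafConn (hΔ : IsFoliatedSurface Δ) {a b : ℝ} {J : Set ℝ} {γ : J → Z}
    (hγ : IsCrossSection Δ a b J γ) (t : J) (ht : γ t ∈ surfInt Z) : LocLeafConn Δ (γ t) := by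
  obtain ⟨-, hJ, hcont, hbd, hinj⟩ := hγ
  have hta : (t : ℝ) ≠ a := fun h => hbd t h ht
  have hJt : J ∈ 𝓝 (t : ℝ) := by
    have ht2 := t.2
    generalize (t : ℝ) = t' at hta ht2
    rcases hJ with rfl | rfl
    · exact Ico_mem_nhds (lt_of_le_of_ne ht2.1 hta.symm) ht2.2
    · exact Ioo_mem_nhds ht2.1 ht2.2
  rcases exists_folEmb hΔ (γ t) with ⟨k, q, hk, hq, -⟩ | ⟨k, x, hk, hq, hb⟩
  swap
  · exact absurd ht hb
  let h := hk.isOpenEmbedding.toOpenPartialHomeomorph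
  let g : ℝ → ℝ := fun s => if hs : s ∈ J then (h.symm (γ ⟨s, hs⟩)).2 else 0
  have hev : ∀ᶠ s in 𝓝 (t : ℝ), ∃ hs : s ∈ J, γ ⟨s, hs⟩ ∈ range k := by
    have h1 : ∀ᶠ s : J in 𝓝 t, γ s ∈ range k :=
      hcont.continuousAt.eventually (hk.isOpenEmbedding.isOpen_range.mem_nhds ⟨q, hq⟩)
    rw [nhds_subtype_eq_comap, Filter.eventually_comap] at h1
    filter_upwards [h1, hJt] with s hs hsJ
    exact ⟨hsJ, hs ⟨s, hsJ⟩ rfl⟩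
  obtain ⟨ε, hε, hball⟩ := Metric.nhds_basis_closedBall.mem_iff.1 hev
  rw [Real.closedBall_eq_Icc] at hball
  have hkh : ∀ s (hs : s ∈ J), γ ⟨s, hs⟩ ∈ range k → k (h.symm (γ ⟨s, hs⟩)) = γ ⟨s, hs⟩ :=
    fun s hs hr => h.right_inv (by simpa [h] using hr)
  have hgc : ContinuousOn g (Icc (t - ε) (t + ε)) := by
    rw [continuousOn_iff_continuous_domRestrict]
    have hJ' : ∀ s : Icc ((t : ℝ) - ε) (t + ε), (s : ℝ) ∈ J := fun s => (hball s.2).1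
    have e : (Icc ((t : ℝ) - ε) (t + ε)).domRestrict g =
        fun s : Icc ((t : ℝ) - ε) (t + ε) => (h.symm (γ ⟨(s : ℝ), hJ' s⟩)).2 := by
      ext s
      simp [g, hJ' s]
    rw [e]
    refine continuous_snd.comp ?_
    refine h.symm.continuousOn.comp_continuous (f := fun s : Icc ((t : ℝ) - ε) (t + ε) => γ ⟨(s : ℝ), hJ' s⟩)
      (hcont.comp (by fun_prop)) fun s => ?_
    simpa [h] using (hball s.2).2
  have hgi : InjOn g (Icc (t - ε) (t + ε)) := by
    intro s hs s' hs' he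
    obtain ⟨hsJ, hsr⟩ := hball hs
    obtain ⟨hsJ', hsr'⟩ := hball hs'
    simp only [g, hsJ, hsJ', dif_pos] at he
    have : Δ (γ ⟨s, hsJ⟩) (γ ⟨s', hsJ'⟩) := by
      rw [← hkh s hsJ hsr, ← hkh s' hsJ' hsr']
      have := hk.rel (h.symm (γ ⟨s, hsJ⟩)).1 (h.symm (γ ⟨s', hsJ'⟩)).1 (h.symm (γ ⟨s, hsJ⟩)).2
      convert this using 2
      exact Prod.ext rfl he.symm
    exact congrArg Subtype.val (hinj (Quotient.sound this))
  have hgt : g t = q.2 := by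
    have : h.symm (γ t) = q := by
      rw [← hq]
      exact h.left_inv (by simp [h])
    simp [g, this]
  have him := image_mem_nhds_of_injOn hε hgc hgi
  rw [hgt] at him
  rw [← hq]
  refine PlaqueInj.locLeafConn (x := q.1) (t := q.2) hk ⟨_, him, ?_⟩
  rintro ⟨x, r⟩ ⟨x', r'⟩ ⟨s, hs, rfl⟩ ⟨s', hs', rfl⟩ hrel
  obtain ⟨hsJ, hsr⟩ := hball hs
  obtain ⟨hsJ', hsr'⟩ := hball hs'
  simp only [g, hsJ, hsJ', dif_pos] at hrel ⊢
  have h1 : Δ (γ ⟨s, hsJ⟩) (γ ⟨s', hsJ'⟩) := by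
    rw [← hkh s hsJ hsr, ← hkh s' hsJ' hsr']
    exact Δ.trans (hk.rel _ x _) (Δ.trans (Δ.symm hrel) (hk.rel x' _ _))
  have := hinj (Quotient.sound h1)
  rw [this]

end Charts

end FoliatedSurface
namespace FoliatedSurface

/-! ### Local products over the space of leaves, and the sides of a leaf. -/

section Boxes

variable {Z Y : Type*} [TopologicalSpace Z] [TopologicalSpace Y]

/-- `p` is locally a product near `z`: the point `z` has a neighbourhood that is parametrised by
pieces of the fibres of `p`. -/
def HasBox (p : Z → Y) (z : Z) : Prop :=
  ∃ Q ∈ 𝓝 (p z), ∃ κ : ℝ → Y → Z, ContinuousOn (fun q : ℝ × Y => κ q.1 q.2) (univ ×ˢ Q) ∧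
    (∀ x, ∀ y ∈ Q, p (κ x y) = y) ∧ (∀ y ∈ Q, Function.Injective fun x => κ x y) ∧
    κ 0 (p z) = z ∧
    ∀ ε > 0, ∀ Q' ∈ 𝓝 (p z), (fun q : ℝ × Y => κ q.1 q.2) '' (Ioo (-ε) ε ×ˢ Q') ∈ 𝓝 z

/-- A neighbourhood of `y` consists of `y` and of small pieces of paths `c i` that start at `y`. -/
structure Sides {ι : Type} (c : ι → ℝ → Y) (y : Y) : Prop where
  cont : ∀ i, ContinuousOn (c i) (Ioi 0)
  lim : ∀ i, Filter.Tendsto (c i) (𝓝[>] 0) (𝓝 y)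
  ne : ∀ i, ∀ t > 0, c i t ≠ y
  nhds : ∀ δ > 0, insert y (⋃ i, c i '' Ioo 0 δ) ∈ 𝓝 y

variable {Δ : Setoid Z}

-- Plaques near height `t₀` lie on different leaves, so the height descends to a function `ht` on a
-- neighbourhood `Q` in the space of leaves. It is continuous because the projection is open, and
-- composing the chart with it gives the box.
open Classical in
theorem PlaqueInj.hasBox {T : Type} [TopologicalSpace T] {k : ℝ × T → Z} (hk : IsFolEmb Δ k)
    (hop : IsOpenMap (Quotient.mk Δ)) {x₀ : ℝ} {t₀ : T} (h : PlaqueInj Δ k t₀) :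
    HasBox (Quotient.mk Δ) (k (x₀, t₀)) := by
  obtain ⟨T₁, hT₁, hinj₁⟩ := h
  obtain ⟨T', hTT, hT'o, ht₀⟩ := mem_nhds_iff.1 hT₁
  have hinj : ∀ q r : ℝ × T, q.2 ∈ T' → r.2 ∈ T' → Δ (k r) (k q) → q.2 = r.2 :=
    fun q r hq hr => hinj₁ q r (hTT hq) (hTT hr)
  have hkc := hk.isOpenEmbedding.continuous
  have himg : ∀ V : Set T, IsOpen V → IsOpen (Quotient.mk Δ '' (k '' (univ ×ˢ V))) :=
    fun V hV => hop _ (hk.isOpenEmbedding.isOpenMap _ (isOpen_univ.prod hV))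
  let Q : Set (Quotient Δ) := Quotient.mk Δ '' (k '' (univ ×ˢ T'))
  let ht : Quotient Δ → T := fun y =>
    if hy : ∃ t ∈ T', Quotient.mk Δ (k (x₀, t)) = y then hy.choose else t₀
  have hht : ∀ x, ∀ t ∈ T', ht (Quotient.mk Δ (k (x, t))) = t := by
    intro x t htT
    have hy : ∃ s ∈ T', Quotient.mk Δ (k (x₀, s)) = Quotient.mk Δ (k (x, t)) :=
      ⟨t, htT, Quotient.sound (hk.rel _ _ _)⟩
    simp only [ht, dif_pos hy]
    exact hinj (x₀, _) (x, t) hy.choose_spec.1 htT (Δ.symm (Quotient.exact hy.choose_spec.2))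
  have hQ : ∀ y ∈ Q, ht y ∈ T' ∧ ∀ x, Quotient.mk Δ (k (x, ht y)) = y := by
    rintro _ ⟨_, ⟨⟨x, t⟩, ⟨-, htT⟩, rfl⟩, rfl⟩
    rw [hht x t htT]
    exact ⟨htT, fun x' => Quotient.sound (hk.rel _ _ _)⟩
  have hcont : ContinuousOn ht Q := by
    intro y hy
    refine ContinuousAt.continuousWithinAt fun V hV => ?_
    obtain ⟨V', hVV, hV'o, hyV⟩ := mem_nhds_iff.1 hV
    rw [Filter.mem_map]
    refine Filter.mem_of_superset ((himg _ (hV'o.inter hT'o)).mem_nhds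
      ⟨_, ⟨(x₀, ht y), ⟨mem_univ _, hyV, (hQ y hy).1⟩, rfl⟩, (hQ y hy).2 _⟩) ?_
    rintro _ ⟨_, ⟨⟨x, t⟩, ⟨-, htV, htT⟩, rfl⟩, rfl⟩
    rw [mem_preimage, hht x t htT]
    exact hVV htV
  have h0 : ht (Quotient.mk Δ (k (x₀, t₀))) = t₀ := hht _ _ ht₀
  refine ⟨Q, (himg _ hT'o).mem_nhds ⟨_, ⟨(x₀, t₀), ⟨mem_univ _, ht₀⟩, rfl⟩, rfl⟩,
    fun x y => k (x₀ + x, ht y), ?_, fun x y hy => (hQ y hy).2 _, ?_, ?_, ?_⟩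
  · refine hkc.comp_continuousOn (ContinuousOn.prodMk (by fun_prop) ?_)
    exact hcont.comp continuousOn_snd fun q hq => hq.2
  · intro y _ x x' he
    have := congrArg Prod.fst (hk.isOpenEmbedding.injective he)
    simpa using this
  · simp only [h0, add_zero]
  · intro ε hε Q' hQ'
    have h1 : ∀ᶠ q : ℝ × T in 𝓝 (x₀, t₀), |q.1 - x₀| < ε ∧ q.2 ∈ T' ∧ Quotient.mk Δ (k q) ∈ Q' := by
      refine Filter.Eventually.and ?_ (Filter.Eventually.and ?_ ?_)
      · have : ContinuousAt (fun q : ℝ × T => |q.1 - x₀|) (x₀, t₀) := by fun_prop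
        exact this.eventually_lt continuousAt_const (by simpa using hε)
      · exact continuousAt_snd.eventually (hT'o.mem_nhds ht₀)
      · exact (continuous_quotient_mk'.comp hkc).continuousAt.eventually hQ'
    have h2 := hk.isOpenEmbedding.isOpenMap.image_mem_nhds h1
    refine Filter.mem_of_superset h2 ?_
    rintro _ ⟨⟨x, t⟩, ⟨hx, htT, hq⟩, rfl⟩
    refine ⟨(x - x₀, Quotient.mk Δ (k (x, t))), ⟨abs_lt.1 hx, hq⟩, ?_⟩
    simp only [hht x t htT]
    simp

theorem LocLeafConn.hasBox (hΔ : IsFoliatedSurface Δ) (hop : IsOpenMap (Quotient.mk Δ)) {z : Z}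
    (h : LocLeafConn Δ z) : HasBox (Quotient.mk Δ) z := by
  rcases exists_folEmb hΔ z with ⟨k, q, hk, rfl, -⟩ | ⟨k, x, hk, rfl, -⟩
  · exact (h.plaqueInj (x := q.1) (t := q.2) hk).hasBox hk hop
  · exact (h.plaqueInj hk).hasBox hk hop

/-- The space of leaves is a one-dimensional manifold near a leaf of the interior. -/
theorem LocLeafConn.exists_arc (hΔ : IsFoliatedSurface Δ) (hop : IsOpenMap (Quotient.mk Δ))
    {z : Z} (h : LocLeafConn Δ z) (hz : z ∈ surfInt Z) :
    ∃ j : ℝ → Quotient Δ, IsOpenEmbedding j ∧ j 0 = Quotient.mk Δ z := by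
  rcases exists_folEmb hΔ z with ⟨k, ⟨x, t⟩, hk, rfl, -⟩ | ⟨k, x, hk, rfl, hb⟩
  swap
  · exact absurd hz hb
  obtain ⟨T', hT', hinj⟩ := h.plaqueInj hk
  obtain ⟨r, hr, hball⟩ := Metric.mem_nhds_iff.1 hT'
  -- This squeezes the whole line into the set of heights at which different plaques lie on
  -- different leaves.
  let b := OpenPartialHomeomorph.univBall t r
  have hb : IsOpenEmbedding b :=
    b.isOpenEmbedding (OpenPartialHomeomorph.univBall_source t r)
  have hbT : ∀ s, b s ∈ T' := fun s => hball (by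
    rw [← OpenPartialHomeomorph.univBall_target t hr]
    exact b.map_source (by simp [b]))
  refine ⟨fun s => Quotient.mk Δ (k (x, b s)), ?_, by simp [b]⟩
  refine IsOpenEmbedding.of_continuous_injective_isOpenMap ?_ ?_ ?_
  · exact continuous_quotient_mk'.comp (hk.isOpenEmbedding.continuous.comp
      (continuous_const.prodMk hb.continuous))
  · intro s s' he
    exact hb.injective (hinj (x, b s) (x, b s') (hbT s) (hbT s') (Δ.symm (Quotient.exact he)))
  · intro V hV
    have h1 := hop _ (hk.isOpenEmbedding.isOpenMap _ (isOpen_univ.prod (hb.isOpenMap _ hV)))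
    convert h1 using 1
    ext y
    constructor
    · rintro ⟨s, hs, rfl⟩
      exact ⟨_, ⟨(x, b s), ⟨mem_univ _, s, hs, rfl⟩, rfl⟩, rfl⟩
    · rintro ⟨_, ⟨⟨x', _⟩, ⟨-, s, hs, rfl⟩, rfl⟩, rfl⟩
      exact ⟨s, hs, Quotient.sound (hk.rel _ _ _)⟩

/-- A transversal through a point of the boundary. -/
theorem exists_transversal (hΔ : IsFoliatedSurface Δ) (hop : IsOpenMap (Quotient.mk Δ))
    (hint : ∀ z ∈ surfInt Z, LocLeafConn Δ z) {z : Z} (hz : z ∈ surfBd Z) :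
    ∃ c : ℝ → Z, Continuous c ∧ c 0 = z ∧ (∀ t > 0, c t ∈ surfInt Z) ∧
      (∀ δ > 0, (fun t => Quotient.mk Δ (c t)) '' Ico 0 δ ∈ 𝓝 (Quotient.mk Δ z)) ∧
      (∀ t > 0, ∃ ε > 0, InjOn (fun t => Quotient.mk Δ (c t)) (Icc (t - ε) (t + ε))) ∧
      ∀ δ > 0, InjOn (fun t => Quotient.mk Δ (c t)) (Ico 0 δ) → LocLeafConn Δ z := by
  rcases exists_folEmb hΔ z with ⟨k, q, hk, rfl, hi⟩ | ⟨k, x, hk, rfl, -⟩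
  · exact absurd hi hz
  -- Truncation at 0 makes the transversal a map on the whole line; only parameters `t ≥ 0` carry
  -- information.
  let σ : ℝ → Ici (0 : ℝ) := fun t => ⟨max t 0, mem_Ici.2 (le_max_right t 0)⟩
  have hσ : Continuous σ := by fun_prop
  have hσ0 : σ 0 = zeroIci := Subtype.ext (max_self 0)
  have hσ' : ∀ s : Ici (0 : ℝ), σ s = s := fun s => Subtype.ext (max_eq_left s.2)
  have hpos : ∀ t > 0, k (x, σ t) ∈ surfInt Z := fun t ht =>
    surfInt_of_chart hk (lt_max_of_lt_left ht)
  refine ⟨fun t => k (x, σ t), hk.isOpenEmbedding.continuous.comp (by fun_prop), by simp only [hσ0],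
    hpos, fun δ hδ => ?_, fun t ht => ?_, fun δ hδ hinj => ?_⟩
  · have hV : IsOpen {s : Ici (0 : ℝ) | (s : ℝ) < δ} :=
      isOpen_lt continuous_subtype_val continuous_const
    have h1 := hop _ (hk.isOpenEmbedding.isOpenMap _ (isOpen_univ.prod hV))
    refine Filter.mem_of_superset (h1.mem_nhds ⟨_, ⟨(x, zeroIci), ⟨mem_univ _, hδ⟩, rfl⟩, rfl⟩) ?_
    rintro _ ⟨_, ⟨⟨x', s⟩, ⟨-, hs⟩, rfl⟩, rfl⟩
    refine ⟨s, ⟨s.2, hs⟩, Quotient.sound ?_⟩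
    simp only [hσ']
    exact hk.rel _ _ _
  · obtain ⟨T', hT', hT⟩ := (hint _ (hpos t ht)).plaqueInj hk
    have h1 : ∀ᶠ s in 𝓝 t, σ s ∈ T' ∧ 0 < s := by
      exact (hσ.continuousAt.eventually hT').and (lt_mem_nhds ht)
    obtain ⟨ε, hε, hball⟩ := Metric.nhds_basis_closedBall.mem_iff.1 h1
    rw [Real.closedBall_eq_Icc] at hball
    refine ⟨ε, hε, fun s hs s' hs' he => ?_⟩
    have := congrArg Subtype.val (hT (x, σ s) (x, σ s') (hball hs).1 (hball hs').1
      (Δ.symm (Quotient.exact he)))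
    simpa [σ, max_eq_left (hball hs).2.le, max_eq_left (hball hs').2.le] using this
  · refine PlaqueInj.locLeafConn hk ⟨{s | (s : ℝ) < δ},
      (isOpen_lt continuous_subtype_val continuous_const).mem_nhds hδ, ?_⟩
    rintro ⟨a, s⟩ ⟨b, s'⟩ hs hs' hrel
    refine Subtype.ext (hinj ⟨s.2, hs⟩ ⟨s'.2, hs'⟩ (Quotient.sound ?_))
    simp only [hσ']
    exact Δ.trans (hk.rel _ a _) (Δ.trans (Δ.symm hrel) (hk.rel b _ _))

/-- An interior leaf has two sides and a boundary leaf has one. This count later becomes the number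
of boundary intervals that lie over a leaf of the cut. -/
theorem sides_of_arc {j : ℝ → Y} (hj : IsOpenEmbedding j) :
    Sides (fun i : Bool => fun t => if i then j t else j (-t)) (j 0) where
  cont i := by
    cases i
    · exact (hj.continuous.comp continuous_neg).continuousOn
    · exact hj.continuous.continuousOn
  lim i := by
    refine Filter.Tendsto.mono_left ?_ nhdsWithin_le_nhds
    cases i
    · have : Continuous fun t => j (-t) := hj.continuous.comp continuous_neg
      simpa using this.tendsto 0
    · exact hj.continuous.tendsto 0
  ne i t ht := by
    cases i
    · exact fun h => by simpa [ht.ne'] using hj.injective h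
    · exact fun h => ht.ne' (hj.injective h)
  nhds δ hδ := by
    refine Filter.mem_of_superset (hj.isOpenMap.image_mem_nhds
      (Ioo_mem_nhds (neg_lt_zero.2 hδ) hδ)) ?_
    rintro _ ⟨t, ht, rfl⟩
    rcases lt_trichotomy t 0 with h | rfl | h
    · exact Or.inr (mem_iUnion.2 ⟨false, -t, ⟨neg_pos.2 h, by linarith [ht.1]⟩, by simp⟩)
    · exact Or.inl rfl
    · exact Or.inr (mem_iUnion.2 ⟨true, t, ⟨h, ht.2⟩, by simp⟩)

theorem sides_of_transversal {z : Z} (hsat : ∀ w, Δ w z → w ∈ surfBd Z) {c : ℝ → Z}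
    (hc : Continuous c) (h0 : c 0 = z) (hpos : ∀ t > 0, c t ∈ surfInt Z)
    (hn : ∀ δ > 0, (fun t => Quotient.mk Δ (c t)) '' Ico 0 δ ∈ 𝓝 (Quotient.mk Δ z)) :
    Sides (fun _ : Unit => fun t => Quotient.mk Δ (c t)) (Quotient.mk Δ z) where
  cont _ := (continuous_quotient_mk'.comp hc).continuousOn
  lim _ := by
    refine Filter.Tendsto.mono_left ?_ nhdsWithin_le_nhds
    have : Continuous fun t => Quotient.mk Δ (c t) := continuous_quotient_mk'.comp hc
    simpa [h0] using this.tendsto 0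
  ne _ t ht h := hsat _ (Quotient.exact h) (hpos t ht)
  nhds δ hδ := by
    refine Filter.mem_of_superset (hn δ hδ) ?_
    rintro _ ⟨t, ht, rfl⟩
    rcases ht.1.eq_or_lt with rfl | h
    · exact Or.inl (by simp [h0])
    · exact Or.inr (mem_iUnion.2 ⟨(), t, ⟨h, ht.2⟩, rfl⟩)

/-- A leaf with a closed tube is separated from all other leaves. -/
theorem HasTube.disjoint_nhds {K K₀ : Set ℝ} {z w : Z} (hop : IsOpenMap (Quotient.mk Δ))
    (h : HasTube Δ (leafOf Δ z) K K₀) (hzw : Quotient.mk Δ z ≠ Quotient.mk Δ w) :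
    Disjoint (𝓝 (Quotient.mk Δ z)) (𝓝 (Quotient.mk Δ w)) := by
  obtain ⟨U, hU, hsat, e, -, he, hω⟩ := h
  have hUz : U ∈ 𝓝 z := mem_nhdsSet_iff_forall.1 hU z (Δ.refl z)
  -- If `w` lies in the closed tube, `ε` is half the absolute value of its height; otherwise any
  -- positive number will do.
  obtain ⟨ε, hε, hw⟩ : ∃ ε > 0, ∀ hw : w ∈ closure U, ε < |((e ⟨w, hw⟩).2 : ℝ)| := by
    by_cases hw : w ∈ closure U
    · have : ((e ⟨w, hw⟩).2 : ℝ) ≠ 0 := fun h0 =>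
        hzw (Quotient.sound (Δ.symm ((hω ⟨w, hw⟩).2 h0)))
      exact ⟨_, half_pos (abs_pos.2 this), fun _ => half_lt_self (abs_pos.2 this)⟩
    · exact ⟨1, one_pos, fun h => absurd h hw⟩
  have hcont : Continuous fun x : closure U => |((e x).2 : ℝ)| := by fun_prop
  let N₁ : Set Z := {x | ∃ hx : x ∈ closure U, x ∈ interior U ∧ |((e ⟨x, hx⟩).2 : ℝ)| < ε}
  -- This set is closed in `Z` because the tube coordinate is a homeomorphism on the closed set
  -- `closure U`; a tube on `U` alone would not suffice.
  let F : Set Z := {x | ∃ hx : x ∈ closure U, |((e ⟨x, hx⟩).2 : ℝ)| ≤ ε}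
  have hF : IsClosed F := by
    have h1 : IsClosed {x : closure U | |((e x).2 : ℝ)| ≤ ε} := isClosed_le hcont continuous_const
    have h2 := isClosed_closure.isClosedEmbedding_subtypeVal.isClosedMap _ h1
    convert h2 using 1
    ext x
    simp [F]
  have hN₁ : N₁ ∈ 𝓝 z := by
    have hzc : z ∈ closure U := subset_closure (mem_of_mem_nhds hUz)
    have h1 : ∀ᶠ x : closure U in 𝓝 ⟨z, hzc⟩, |((e x).2 : ℝ)| < ε := by
      refine hcont.continuousAt.eventually_lt continuousAt_const ?_
      rw [(hω ⟨z, hzc⟩).1 (Δ.refl z), abs_zero]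
      exact hε
    rw [nhds_subtype_eq_comap, Filter.eventually_comap] at h1
    filter_upwards [h1, interior_mem_nhds.2 hUz] with x hx hxU
    exact ⟨subset_closure (interior_subset hxU), hxU, hx ⟨x, _⟩ rfl⟩
  rw [Filter.disjoint_iff]
  refine ⟨_, hop.image_mem_nhds hN₁, _, hop.image_mem_nhds (hF.isOpen_compl.mem_nhds ?_), ?_⟩
  · rintro ⟨hx, hle⟩
    exact absurd (hw hx) (not_lt.2 hle)
  · rw [disjoint_left]
    rintro _ ⟨x, ⟨hx, hxU, hxε⟩, rfl⟩ ⟨y, hy, hyx⟩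
    have hyU : y ∈ closure U :=
      subset_closure (hsat x (interior_subset hxU) (Quotient.exact hyx))
    refine hy ⟨hyU, ?_⟩
    have := (he ⟨y, hyU⟩ ⟨x, hx⟩).1 (Quotient.exact hyx)
    rw [this]
    exact hxε.le

end Boxes

end FoliatedSurface
namespace FoliatedSurface

/-! ### Open orders on the fibres over a subset. -/

section OrderOn

variable {N B : Type*} [TopologicalSpace N]

/-- `R` is a strict linear order on the part in `D` of each fibre of `t`, and it is an open
relation. -/
structure FibOrderOn (t : N → B) (D : Set N) (R : N → N → Prop) : Prop where
  left_mem : ∀ {x y}, R x y → x ∈ D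
  right_mem : ∀ {x y}, R x y → y ∈ D
  fib : ∀ {x y}, R x y → t x = t y
  total : ∀ {x y}, x ∈ D → y ∈ D → t x = t y → x ≠ y → R x y ∨ R y x
  irrefl : ∀ x, ¬ R x x
  trans : ∀ {x y z}, R x y → R y z → R x z
  isOpen : ∀ {x y}, R x y → ∀ᶠ q : N × N in 𝓝 (x, y), t q.1 = t q.2 → R q.1 q.2

namespace FibOrderOn

variable {t : N → B} {D : Set N} {R : N → N → Prop}

theorem asymm (h : FibOrderOn t D R) {x y : N} (hxy : R x y) : ¬ R y x :=
  fun hyx => h.irrefl x (h.trans hxy hyx)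

theorem eventually_lt (h : FibOrderOn t D R) {X : Type*} {l : Filter X}
    {u v : X → N} {x y : N} (hu : Filter.Tendsto u l (𝓝 x)) (hv : Filter.Tendsto v l (𝓝 y))
    (hR : R x y) : ∀ᶠ a in l, t (u a) = t (v a) → R (u a) (v a) :=
  (hu.prodMk_nhds hv).eventually (h.isOpen hR)

theorem flip (h : FibOrderOn t D R) : FibOrderOn t D (fun x y => R y x) where
  left_mem := h.right_mem
  right_mem := h.left_mem
  fib hR := (h.fib hR).symm
  total hx hy ht hne := (h.total hx hy ht hne).symm
  irrefl := h.irrefl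
  trans h1 h2 := h.trans h2 h1
  isOpen {x y} hR := by
    have := h.eventually_lt (l := 𝓝 (x, y)) (u := Prod.snd) (v := Prod.fst) continuousAt_snd
      continuousAt_fst hR
    filter_upwards [this] with q hq e using hq e.symm

theorem restrict [TopologicalSpace B] (h : FibOrderOn t D R) :
    FibOrder (fun x : D => t x) (fun x y : D => R x y) where
  fib := h.fib
  total ht hne := h.total (Subtype.prop _) (Subtype.prop _) ht (fun e => hne (Subtype.ext e))
  irrefl x := h.irrefl x
  trans := h.trans
  isOpen {x y} hR := by
    exact h.eventually_lt (l := 𝓝 (x, y)) (u := fun q => (q.1 : N)) (v := fun q => (q.2 : N))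
      (continuous_subtype_val.comp continuous_fst).continuousAt
      (continuous_subtype_val.comp continuous_snd).continuousAt hR

end FibOrderOn

end OrderOn

/-! ### Orienting the leaves over a family. -/

section LeafCoord

variable {Z Y : Type*} [TopologicalSpace Z] [TopologicalSpace Y]

/-- A choice of a homeomorphism onto the line for each fibre of `p`. -/
structure LeafCoord (p : Z → Y) where
  e : Z → ℝ
  par : Y → ℝ → Z
  par_cont : ∀ y, Continuous (par y)
  p_par : ∀ y x, p (par y x) = y
  e_par : ∀ y x, e (par y x) = x
  par_e : ∀ z, par (p z) (e z) = z
  e_cont : ∀ y, ContinuousOn e (p ⁻¹' {y})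

/-- The choices on different fibres are unrelated: `e` is continuous along fibres only and may
reverse direction from one fibre to the next. -/
theorem exists_leafCoord {p : Z → Y} (h : ∀ y, Nonempty (p ⁻¹' {y} ≃ₜ ℝ)) :
    Nonempty (LeafCoord p) := by
  let H : ∀ y, p ⁻¹' {y} ≃ₜ ℝ := fun y => (h y).some
  have key : ∀ y z (hz : z ∈ p ⁻¹' {y}), H (p z) ⟨z, rfl⟩ = H y ⟨z, hz⟩ := by
    rintro y z rfl; rfl
  refine ⟨⟨fun z => H (p z) ⟨z, rfl⟩, fun y x => (H y).symm x, fun y => ?_, fun y x => ?_,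
    fun y x => ?_, fun z => ?_, fun y => ?_⟩⟩
  · exact continuous_subtype_val.comp (H y).symm.continuous
  · exact ((H y).symm x).2
  · rw [key y _ ((H y).symm x).2]; simp
  · simp
  · rw [continuousOn_iff_continuous_domRestrict]
    have : (p ⁻¹' {y}).domRestrict (fun z => H (p z) ⟨z, rfl⟩) = H y := by
      ext ⟨z, hz⟩
      exact key y z hz
    rw [this]
    exact (H y).continuous

variable {p : Z → Y}

theorem LeafCoord.injOn (c : LeafCoord p) {z w : Z} (h : p z = p w) (he : c.e z = c.e w) :
    z = w := by
  rw [← c.par_e z, ← c.par_e w, h, he]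

theorem HasBox.exists_nhds {z : Z} (h : HasBox p z) {O : Set Z} (hO : O ∈ 𝓝 z) :
    ∃ O₁ ∈ 𝓝 z, O₁ ⊆ O ∧ ∀ y, IsPreconnected (O₁ ∩ p ⁻¹' {y}) := by
  obtain ⟨Q, hQ, κ, hκ, hp, -, h0, hn⟩ := h
  have h1 : ∀ᶠ q : ℝ × Y in 𝓝 (0, p z), κ q.1 q.2 ∈ O := by
    have h2 : ContinuousAt (fun q : ℝ × Y => κ q.1 q.2) (0, p z) :=
      hκ.continuousAt (prod_mem_nhds Filter.univ_mem hQ)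
    exact h2.eventually (show O ∈ 𝓝 (κ 0 (p z)) by rwa [h0])
  rw [nhds_prod_eq, Filter.eventually_prod_iff] at h1
  obtain ⟨pa, hpa, pb, hpb, hab⟩ := h1
  obtain ⟨ε, hε, hball⟩ := Metric.mem_nhds_iff.1 hpa
  rw [Real.ball_eq_Ioo, zero_sub, zero_add] at hball
  refine ⟨_, hn ε hε (Q ∩ {y | pb y}) (Filter.inter_mem hQ hpb), ?_, fun y => ?_⟩
  · rintro _ ⟨q, ⟨hq1, -, hq2⟩, rfl⟩
    exact hab (hball hq1) hq2
  · by_cases hy : y ∈ Q ∩ {y | pb y}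
    · have : (fun q : ℝ × Y => κ q.1 q.2) '' (Ioo (-ε) ε ×ˢ (Q ∩ {y | pb y})) ∩ p ⁻¹' {y} =
          (fun x => κ x y) '' Ioo (-ε) ε := by
        ext w
        constructor
        · rintro ⟨⟨⟨x, y'⟩, ⟨hx, hy'⟩, rfl⟩, hw⟩
          have : p (κ x y') = y := hw
          rw [hp x y' hy'.1] at this
          exact ⟨x, hx, by rw [this]⟩
        · rintro ⟨x, hx, rfl⟩
          exact ⟨⟨(x, y), ⟨hx, hy⟩, rfl⟩, hp x y hy.1⟩
      rw [this]
      refine isPreconnected_Ioo.image _ (hκ.comp (f := fun x : ℝ => (x, y)) (by fun_prop) ?_)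
      exact fun x _ => ⟨mem_univ _, hy.1⟩
    · convert isPreconnected_empty
      rw [eq_empty_iff_forall_notMem]
      rintro _ ⟨⟨⟨x, y'⟩, ⟨hx, hy'⟩, rfl⟩, hw⟩
      have : p (κ x y') = y := hw
      rw [hp x y' hy'.1] at this
      exact hy (this ▸ hy')

/-- Take disjoint neighbourhoods that meet each fibre in a connected set. A change of sign of `e w'
- e w` on one fibre would, by the intermediate value theorem, produce a point common to both. The
points `x` and `x'` may lie on different leaves; this is essential for limit leaves that are not
separated. -/
theorem LeafCoord.exists_const_sign [T2Space Z] (c : LeafCoord p) {x x' : Z} (hx : HasBox p x)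
    (hx' : HasBox p x') (hne : x ≠ x') :
    ∃ O ∈ 𝓝 x, ∃ O' ∈ 𝓝 x', ∀ w ∈ O, ∀ v ∈ O, ∀ w' ∈ O', ∀ v' ∈ O', p w = p w' → p v = p w →
      p v' = p w → c.e w < c.e w' → c.e v < c.e v' := by
  obtain ⟨U, U', hU, hU', hxU, hxU', hd⟩ := t2_separation hne
  obtain ⟨O, hO, hOU, hOc⟩ := hx.exists_nhds (hU.mem_nhds hxU)
  obtain ⟨O', hO', hOU', hOc'⟩ := hx'.exists_nhds (hU'.mem_nhds hxU')
  refine ⟨O, hO, O', hO', fun w hw v hv w' hw' v' hv' e1 e2 e3 hlt => ?_⟩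
  by_contra! hle
  have hpre := (hOc (p w)).prod (hOc' (p w))
  have hcont : ContinuousOn (fun q : Z × Z => c.e q.2 - c.e q.1)
      ((O ∩ p ⁻¹' {p w}) ×ˢ (O' ∩ p ⁻¹' {p w})) := by
    refine ContinuousOn.sub ?_ ?_
    · exact (c.e_cont (p w)).comp continuousOn_snd fun q hq => hq.2.2
    · exact (c.e_cont (p w)).comp continuousOn_fst fun q hq => hq.1.2
  obtain ⟨q, hq, h0⟩ := hpre.intermediate_value (a := (v, v')) (b := (w, w'))
    ⟨⟨hv, e2⟩, ⟨hv', e3⟩⟩ ⟨⟨hw, rfl⟩, ⟨hw', e1.symm⟩⟩ hcont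
    (show (0 : ℝ) ∈ Icc _ _ from ⟨by simpa using hle, by simpa using hlt.le⟩)
  have hqe : q.1 = q.2 :=
    c.injOn (hq.1.2.trans hq.2.2.symm) (sub_eq_zero.1 h0).symm
  exact disjoint_left.1 hd (hOU hq.1.1) (hqe ▸ hOU' hq.2.1)

/-- The order on the fibres over `A` that puts `b₀` before `b₁`. -/
def LeafCoord.order (c : LeafCoord p) (A : Set Y) (b₀ b₁ : Y → Z) (x x' : Z) : Prop :=
  p x = p x' ∧ p x ∈ A ∧ 0 < (c.e x' - c.e x) * (c.e (b₁ (p x)) - c.e (b₀ (p x)))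

theorem isPreconnected_lt : IsPreconnected {q : ℝ × ℝ | q.1 < q.2} := by
  have : Convex ℝ {q : ℝ × ℝ | q.1 < q.2} := by
    intro a ha b hb s t hs ht hst
    simp only [mem_ofPred_eq, Prod.fst_add, Prod.snd_add, Prod.smul_fst, Prod.smul_snd,
      smul_eq_mul] at *
    rcases hs.eq_or_lt with rfl | hs
    · have : t = 1 := by linarith
      subst this; simpa using hb
    · nlinarith [mul_lt_mul_of_pos_left ha hs, mul_le_mul_of_nonneg_left hb.le ht]
  exact this.isPreconnected

theorem LeafCoord.isPreconnected_lt (c : LeafCoord p) (y : Y) :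
    IsPreconnected {q : Z × Z | p q.1 = y ∧ p q.2 = y ∧ c.e q.1 < c.e q.2} := by
  have h := FoliatedSurface.isPreconnected_lt.image (fun q : ℝ × ℝ => (c.par y q.1, c.par y q.2))
    (((c.par_cont y).comp continuous_fst).prodMk
      ((c.par_cont y).comp continuous_snd)).continuousOn
  convert h using 1
  ext ⟨z, w⟩
  constructor
  · rintro ⟨rfl, h2, h3⟩
    refine ⟨(c.e z, c.e w), h3, Prod.ext (c.par_e z) ?_⟩
    have h2 : p w = p z := h2
    show c.par (p z) (c.e w) = w
    rw [← h2]
    exact c.par_e w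
  · rintro ⟨q, hq, he⟩
    obtain ⟨rfl, rfl⟩ := Prod.mk.inj he
    exact ⟨c.p_par _ _, c.p_par _ _, by simpa [c.e_par] using hq⟩

/-- Two sections that never meet orient all fibres coherently, whatever the direction of `e`.
Openness of the order holds at the pair of section points by their continuity, and it propagates
from there because the ordered pairs of one fibre form a connected set. -/
theorem LeafCoord.fibOrderOn_order [T2Space Z] (c : LeafCoord p) (hp : Continuous p)
    (hop : IsOpenMap p) {A : Set Y} (hA : IsOpen A) (hbox : ∀ z, p z ∈ A → HasBox p z)
    {b₀ b₁ : Y → Z} (h₀ : ContinuousOn b₀ A) (h₁ : ContinuousOn b₁ A)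
    (hb₀ : ∀ y ∈ A, p (b₀ y) = y) (hb₁ : ∀ y ∈ A, p (b₁ y) = y) (hne : ∀ y ∈ A, b₀ y ≠ b₁ y) :
    FibOrderOn p (p ⁻¹' A) (c.order A b₀ b₁) := by
  have hs : ∀ y ∈ A, c.e (b₁ y) - c.e (b₀ y) ≠ 0 := fun y hy h0 =>
    hne y hy (c.injOn ((hb₀ y hy).trans (hb₁ y hy).symm) (sub_eq_zero.1 h0).symm)
  refine ⟨fun h => h.2.1, fun {x y} h => by rw [mem_preimage, ← h.1]; exact h.2.1, fun h => h.1,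
    ?_, fun x h => ?_, ?_, ?_⟩
  · intro x y hx _ ht hxy
    have h1 : c.e y - c.e x ≠ 0 := fun h0 => hxy (c.injOn ht (sub_eq_zero.1 h0).symm)
    rcases lt_or_gt_of_ne (mul_ne_zero h1 (hs _ hx)) with h | h
    · refine Or.inr ⟨ht.symm, by rw [← ht]; exact hx, ?_⟩
      rw [← ht]; linarith
    · exact Or.inl ⟨ht, hx, h⟩
  · have := h.2.2
    simp at this
  · intro x y z hxy hyz
    refine ⟨hxy.1.trans hyz.1, hxy.2.1, ?_⟩
    have h1 := hxy.2.2
    have h2 := hyz.2.2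
    rw [← hxy.1] at h2
    linarith
  · -- sets on which the relation is constant
    have transfer : ∀ {O O' : Set Z} {w w' v v' : Z}, (∀ w ∈ O, ∀ v ∈ O, ∀ w' ∈ O', ∀ v' ∈ O',
        p w = p w' → p v = p w → p v' = p w → c.e w < c.e w' → c.e v < c.e v') →
        (∀ w ∈ O', ∀ v ∈ O', ∀ w' ∈ O, ∀ v' ∈ O,
        p w = p w' → p v = p w → p v' = p w → c.e w < c.e w' → c.e v < c.e v') →
        w ∈ O → v ∈ O → w' ∈ O' → v' ∈ O' → p v = p w → p v = p v' →
        c.order A b₀ b₁ w w' → c.order A b₀ b₁ v v' := by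
      intro O O' w w' v v' hO hO' hw hv hw' hv' e1 e2 h
      refine ⟨e2, by rw [e1]; exact h.2.1, ?_⟩
      have h3 := h.2.2
      rw [e1]
      have e3 : p v' = p w := e2.symm.trans e1
      rcases pos_and_pos_or_neg_and_neg_of_mul_pos h3 with ⟨ha, hb⟩ | ⟨ha, hb⟩
      · exact mul_pos (sub_pos.2 (hO w hw v hv w' hw' v' hv' h.1 e1 e3 (sub_pos.1 ha))) hb
      · exact mul_pos_of_neg_of_neg (sub_neg.2 (hO' w' hw' v' hv' w hw v hv h.1.symm
          (e3.trans h.1) (e1.trans h.1) (sub_neg.1 ha))) hb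
    have boxes : ∀ {x x'}, p x ∈ A → p x = p x' → x ≠ x' → ∃ O ∈ 𝓝 x, ∃ O' ∈ 𝓝 x',
        ∀ w ∈ O, ∀ w' ∈ O', ∀ v ∈ O, ∀ v' ∈ O', p v = p w → p v = p v' →
          c.order A b₀ b₁ w w' → c.order A b₀ b₁ v v' := by
      intro x x' hx e hxx
      have hx' : p x' ∈ A := e ▸ hx
      obtain ⟨O, hO, O', hO', h⟩ := c.exists_const_sign (hbox x hx) (hbox x' hx') hxx
      obtain ⟨V', hV', V, hV, h'⟩ := c.exists_const_sign (hbox x' hx') (hbox x hx) hxx.symm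
      refine ⟨O ∩ V, Filter.inter_mem hO hV, O' ∩ V', Filter.inter_mem hO' hV', ?_⟩
      intro w hw w' hw' v hv v' hv' e1 e2
      exact transfer (O := O ∩ V) (O' := O' ∩ V')
        (fun w hw v hv w' hw' v' hv' => h w hw.1 v hv.1 w' hw'.1 v' hv'.1)
        (fun w hw v hv w' hw' v' hv' => h' w hw.2 v hv.2 w' hw'.2 v' hv'.2) hw hv hw' hv' e1 e2
    let G : Z × Z → Prop := fun q =>
      ∀ᶠ u : Z × Z in 𝓝 q, p u.1 = p u.2 → c.order A b₀ b₁ u.1 u.2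
    intro x₀ x₀' hR₀
    set y := p x₀ with hy
    have hyA : y ∈ A := hR₀.2.1
    set σ := c.e (b₁ y) - c.e (b₀ y) with hσ
    let D : Set (Z × Z) := {q | p q.1 = y ∧ p q.2 = y ∧ 0 < (c.e q.2 - c.e q.1) * σ}
    have hDR : ∀ q ∈ D, c.order A b₀ b₁ q.1 q.2 := fun q hq =>
      ⟨hq.1.trans hq.2.1.symm, by rw [hq.1]; exact hyA, by rw [hq.1]; exact hq.2.2⟩
    have hDc : IsPreconnected D := by
      rcases lt_or_gt_of_ne (hs y hyA) with h | h
      · have := (c.isPreconnected_lt y).image Prod.swap continuous_swap.continuousOn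
        rw [image_swap_eq_preimage_swap] at this
        convert this using 1
        ext ⟨a, b⟩
        have e : 0 < (c.e b - c.e a) * σ ↔ c.e b < c.e a :=
          ⟨fun h' => sub_neg.1 (neg_of_mul_pos_left h' h.le),
            fun h' => mul_pos_of_neg_of_neg (sub_neg.2 h') h⟩
        exact ⟨fun q => ⟨q.2.1, q.1, e.1 q.2.2⟩, fun q => ⟨q.2.1, q.1, e.2 q.2.2⟩⟩
      · convert c.isPreconnected_lt y using 1
        ext ⟨a, b⟩
        simp only [D, mem_ofPred_eq]
        rw [mul_pos_iff_of_pos_right h, sub_pos]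
    have hne' : ∀ q ∈ D, q.1 ≠ q.2 := fun q hq h => by
      have := hq.2.2
      rw [h] at this; simp at this
    have main : ∀ q ∈ D, ∀ᶠ q' in 𝓝[D] q, (G q ↔ G q') := by
      intro q hq
      obtain ⟨O, hO, O', hO', hOO⟩ := boxes (by rw [hq.1]; exact hyA) (hq.1.trans hq.2.1.symm)
        (hne' q hq)
      -- Openness at one pair in the product of the two boxes passes to every other: since `p` is
      -- open, each nearby fibre contains a correctly ordered pair in the boxes, and inside the
      -- boxes the sign is constant.
      have step : ∀ q₁ ∈ D, ∀ q₂ ∈ D, O ∈ 𝓝 q₁.1 → O' ∈ 𝓝 q₁.2 → O ∈ 𝓝 q₂.1 → O' ∈ 𝓝 q₂.2 →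
          G q₁ → G q₂ := by
        intro q₁ hq₁ q₂ hq₂ a1 a1' a2 a2' hG
        have hG' : {u : Z × Z | p u.1 = p u.2 → c.order A b₀ b₁ u.1 u.2} ∈ 𝓝 q₁.1 ×ˢ 𝓝 q₁.2 := by
          rw [← nhds_prod_eq]; exact hG
        obtain ⟨V, hV, V', hV', hVV⟩ := Filter.mem_prod_iff.1 hG'
        have b1 : p '' (V ∩ O) ∈ 𝓝 y := hq₁.1 ▸ hop.image_mem_nhds (Filter.inter_mem hV a1)
        have b2 : p '' (V' ∩ O') ∈ 𝓝 y := hq₁.2.1 ▸ hop.image_mem_nhds (Filter.inter_mem hV' a1')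
        have c1 : ∀ᶠ u : Z × Z in 𝓝 q₂, p u.1 ∈ p '' (V ∩ O) ∩ p '' (V' ∩ O') :=
          (hp.comp continuous_fst).continuousAt.eventually
            (show _ ∈ 𝓝 (p q₂.1) from hq₂.1.symm ▸ Filter.inter_mem b1 b2)
        filter_upwards [c1, continuousAt_fst.eventually a2, continuousAt_snd.eventually a2'] with
          u ⟨⟨v, hv, ev⟩, ⟨v', hv', ev'⟩⟩ hu hu' e
        exact hOO v hv.2 v' hv'.2 _ hu _ hu' ev.symm e
          (hVV (mk_mem_prod hv.1 hv'.1) (ev.trans ev'.symm))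
      have d1 : ∀ᶠ q' in 𝓝 q, O ∈ 𝓝 q'.1 ∧ O' ∈ 𝓝 q'.2 :=
        (continuousAt_fst.eventually (eventually_mem_nhds_iff.2 hO)).and
          (continuousAt_snd.eventually (eventually_mem_nhds_iff.2 hO'))
      filter_upwards [nhdsWithin_le_nhds d1, self_mem_nhdsWithin] with q' hq' hq'D
      exact ⟨step q hq q' hq'D hO hO' hq'.1 hq'.2, step q' hq'D q hq hq'.1 hq'.2 hO hO'⟩
    have hbD : (b₀ y, b₁ y) ∈ D := ⟨hb₀ y hyA, hb₁ y hyA, mul_self_pos.2 (hs y hyA)⟩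
    have hbG : G (b₀ y, b₁ y) := by
      obtain ⟨O, hO, O', hO', hOO⟩ := boxes (by rw [hb₀ y hyA]; exact hyA)
        ((hb₀ y hyA).trans (hb₁ y hyA).symm) (hne y hyA)
      have h0 : p (b₀ y) = y := hb₀ y hyA
      have e1 : ∀ᶠ y' in 𝓝 y, b₀ y' ∈ O ∧ b₁ y' ∈ O' ∧ y' ∈ A :=
        ((h₀.continuousAt (hA.mem_nhds hyA)).eventually hO).and
          (((h₁.continuousAt (hA.mem_nhds hyA)).eventually hO').and (hA.mem_nhds hyA))
      have e2 : ∀ᶠ u : Z × Z in 𝓝 (b₀ y, b₁ y), b₀ (p u.1) ∈ O ∧ b₁ (p u.1) ∈ O' ∧ p u.1 ∈ A :=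
        (hp.comp continuous_fst).continuousAt.eventually (p := fun y' =>
          b₀ y' ∈ O ∧ b₁ y' ∈ O' ∧ y' ∈ A) (by rw [← h0] at e1; exact e1)
      filter_upwards [e2, continuousAt_fst.eventually hO, continuousAt_snd.eventually hO'] with
        u ⟨hu0, hu1, huA⟩ hu hu' e
      refine hOO _ hu0 _ hu1 _ hu _ hu' (hb₀ _ huA).symm e ⟨?_, ?_, ?_⟩
      · rw [hb₀ _ huA, hb₁ _ huA]
      · rwa [hb₀ _ huA]
      · rw [hb₀ _ huA]
        exact mul_self_pos.2 (hs _ huA)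
    have hfin := hDc.induction₂ (fun q q' => (G q ↔ G q')) main
      (fun _ _ _ _ _ _ h1 h2 => h1.trans h2) (fun _ _ _ _ h => h.symm) hbD
      (show (x₀, x₀') ∈ D from ⟨rfl, hR₀.1.symm, hR₀.2.2⟩)
    exact hfin.1 hbG

/-- On a single fibre an order is that of the coordinate or its reverse. -/
theorem LeafCoord.dichotomy (c : LeafCoord p) {A : Set Y} {R : Z → Z → Prop}
    (hR : FibOrderOn p (p ⁻¹' A) R) {y : Y} (hy : y ∈ A) :
    (∀ x x', p x = y → p x' = y → (R x x' ↔ c.e x < c.e x')) ∨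
      (∀ x x', p x = y → p x' = y → (R x x' ↔ c.e x' < c.e x)) := by
  have hm : ∀ x, c.par y x ∈ p ⁻¹' A := fun x => by rw [mem_preimage, c.p_par]; exact hy
  have tot : ∀ a b, a ≠ b → R (c.par y a) (c.par y b) ∨ R (c.par y b) (c.par y a) :=
    fun a b hab => hR.total (hm a) (hm b) (by rw [c.p_par, c.p_par])
      (fun h => hab (by rw [← c.e_par y a, h, c.e_par]))
  have ev : ∀ q : ℝ × ℝ, R (c.par y q.1) (c.par y q.2) →
      ∀ᶠ q' : ℝ × ℝ in 𝓝 q, R (c.par y q'.1) (c.par y q'.2) := fun q h => by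
    have := hR.eventually_lt (l := 𝓝 q) (((c.par_cont y).comp continuous_fst).continuousAt)
      (((c.par_cont y).comp continuous_snd).continuousAt) h
    filter_upwards [this] with q' hq' using hq' (by simp [c.p_par])
  have key : ∀ q ∈ {q : ℝ × ℝ | q.1 < q.2}, ∀ q' ∈ {q : ℝ × ℝ | q.1 < q.2},
      (R (c.par y q.1) (c.par y q.2) ↔ R (c.par y q'.1) (c.par y q'.2)) := by
    intro q hq q' hq'
    refine FoliatedSurface.isPreconnected_lt.induction₂
      (fun q q' => (R (c.par y q.1) (c.par y q.2) ↔ R (c.par y q'.1) (c.par y q'.2)))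
      (fun q hq => ?_) (fun _ _ _ _ _ _ h1 h2 => h1.trans h2) (fun _ _ _ _ h => h.symm) hq hq'
    rcases tot q.1 q.2 (ne_of_lt hq) with h | h
    · filter_upwards [nhdsWithin_le_nhds (ev q h)] with q' hq' using iff_of_true h hq'
    · have := (continuous_swap.tendsto q).eventually (ev q.swap h)
      filter_upwards [nhdsWithin_le_nhds this] with q' hq'
      exact iff_of_false (hR.asymm h) (hR.asymm hq')
  have conv : ∀ x, p x = y → c.par y (c.e x) = x := fun x hx => hx ▸ c.par_e x
  by_cases h01 : R (c.par y 0) (c.par y 1)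
  · have pos : ∀ a b, a < b → R (c.par y a) (c.par y b) := fun a b hab =>
      (key (0, 1) (by simp) (a, b) hab).1 h01
    refine Or.inl fun x x' hx hx' => ?_
    rw [← conv x hx, ← conv x' hx', c.e_par, c.e_par]
    refine ⟨fun h => ?_, pos _ _⟩
    by_contra! hle
    rcases hle.eq_or_lt with h' | h'
    · exact hR.irrefl _ (h' ▸ h)
    · exact hR.asymm h (pos _ _ h')
  · have neg : ∀ a b, a < b → R (c.par y b) (c.par y a) := fun a b hab =>
      (tot a b hab.ne).resolve_left fun h => h01 ((key (a, b) hab (0, 1) (by simp)).1 h)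
    refine Or.inr fun x x' hx hx' => ?_
    rw [← conv x hx, ← conv x' hx', c.e_par, c.e_par]
    refine ⟨fun h => ?_, neg _ _⟩
    by_contra! hle
    rcases hle.eq_or_lt with h' | h'
    · exact hR.irrefl _ (h' ▸ h)
    · exact hR.asymm h (neg _ _ h')

/-- Two orders over a connected set agree or are opposite. -/
theorem LeafCoord.agree_or_opposite (c : LeafCoord p) (hop : IsOpenMap p) {A A' I : Set Y}
    {R R' : Z → Z → Prop} (hR : FibOrderOn p (p ⁻¹' A) R) (hR' : FibOrderOn p (p ⁻¹' A') R')
    (hI : IsPreconnected I) (hIA : I ⊆ A) (hIA' : I ⊆ A') :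
    (∀ x x', p x ∈ I → p x = p x' → (R x x' ↔ R' x x')) ∨
      (∀ x x', p x ∈ I → p x = p x' → (R x x' ↔ R' x' x)) := by
  -- A pair that both relations order in the same way persists to nearby fibres, as `p` is open, and
  -- by the dichotomy one pair decides the whole fibre.
  have pos : ∀ {R' : Z → Z → Prop}, FibOrderOn p (p ⁻¹' A') R' → ∀ y ∈ I,
      (∀ x x', p x = y → p x' = y → (R x x' ↔ R' x x')) →
      ∀ᶠ y' in 𝓝[I] y, ∀ x x', p x = y' → p x' = y' → (R x x' ↔ R' x x') := by
    intro R' hR' y hy hag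
    obtain ⟨x, x', hx, hx', hxx⟩ : ∃ x x', p x = y ∧ p x' = y ∧ R x x' := by
      rcases c.dichotomy hR (hIA hy) with h | h
      · exact ⟨c.par y 0, c.par y 1, c.p_par _ _, c.p_par _ _,
          (h _ _ (c.p_par _ _) (c.p_par _ _)).2 (by simp [c.e_par])⟩
      · exact ⟨c.par y 1, c.par y 0, c.p_par _ _, c.p_par _ _,
          (h _ _ (c.p_par _ _) (c.p_par _ _)).2 (by simp [c.e_par])⟩
    have h1 := (hR.isOpen hxx).and (hR'.isOpen ((hag x x' hx hx').1 hxx))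
    rw [nhds_prod_eq, Filter.eventually_prod_iff] at h1
    obtain ⟨pa, hpa, pb, hpb, hab⟩ := h1
    have n1 : p '' {z | pa z} ∈ 𝓝 y := hx ▸ hop.image_mem_nhds hpa
    have n2 : p '' {z | pb z} ∈ 𝓝 y := hx' ▸ hop.image_mem_nhds hpb
    filter_upwards [nhdsWithin_le_nhds n1, nhdsWithin_le_nhds n2, self_mem_nhdsWithin] with
      y' ⟨w, hw, ew⟩ ⟨w', hw', ew'⟩ hy'I v v' hv hv'
    have h2 := hab hw hw'
    have a1 := h2.1 (ew.trans ew'.symm)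
    have a2 := h2.2 (ew.trans ew'.symm)
    rcases c.dichotomy hR (hIA hy'I) with h | h <;> rcases c.dichotomy hR' (hIA' hy'I) with h' | h'
    · rw [h v v' hv hv', h' v v' hv hv']
    · exact absurd ((h w w' ew ew').1 a1) (not_lt.2 ((h' w w' ew ew').1 a2).le)
    · exact absurd ((h' w w' ew ew').1 a2) (not_lt.2 ((h w w' ew ew').1 a1).le)
    · rw [h v v' hv hv', h' v v' hv hv']
  have dich : ∀ y ∈ I, (∀ x x', p x = y → p x' = y → (R x x' ↔ R' x x')) ∨
      (∀ x x', p x = y → p x' = y → (R x x' ↔ R' x' x)) := by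
    intro y hy
    rcases c.dichotomy hR (hIA hy) with h | h <;> rcases c.dichotomy hR' (hIA' hy) with h' | h'
    · exact Or.inl fun x x' hx hx' => by rw [h x x' hx hx', h' x x' hx hx']
    · exact Or.inr fun x x' hx hx' => by rw [h x x' hx hx', h' x' x hx' hx]
    · exact Or.inr fun x x' hx hx' => by rw [h x x' hx hx', h' x' x hx' hx]
    · exact Or.inl fun x x' hx hx' => by rw [h x x' hx hx', h' x x' hx hx']
  let P : Y → Prop := fun y => ∀ x x', p x = y → p x' = y → (R x x' ↔ R' x x')
  have hnot : ∀ y ∈ I, (∀ x x', p x = y → p x' = y → (R x x' ↔ R' x' x)) → ¬ P y := by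
    intro y hy hopp hP
    have hne : c.par y 0 ≠ c.par y 1 := fun h => zero_ne_one (α := ℝ) (by
      rw [← c.e_par y 0, h, c.e_par])
    have m : ∀ x, c.par y x ∈ p ⁻¹' A := fun x => by rw [mem_preimage, c.p_par]; exact hIA hy
    have e := c.p_par y
    rcases hR.total (m 0) (m 1) (by rw [e, e]) hne with h | h
    · exact hR'.asymm ((hP _ _ (e _) (e _)).1 h) ((hopp _ _ (e _) (e _)).1 h)
    · exact hR'.asymm ((hP _ _ (e _) (e _)).1 h) ((hopp _ _ (e _) (e _)).1 h)
  have loc : ∀ y ∈ I, ∀ᶠ y' in 𝓝[I] y, (P y ↔ P y') := by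
    intro y hy
    rcases dich y hy with h | h
    · filter_upwards [pos hR' y hy h] with y' hy' using iff_of_true h hy'
    · filter_upwards [pos hR'.flip y hy h, self_mem_nhdsWithin] with y' hy' hy'I
      exact iff_of_false (hnot y hy h) (hnot y' hy'I hy')
  have conn : ∀ y ∈ I, ∀ y' ∈ I, (P y ↔ P y') := fun y hy y' hy' =>
    hI.induction₂ (fun y y' => (P y ↔ P y')) loc (fun _ _ _ _ _ _ h1 h2 => h1.trans h2)
      (fun _ _ _ _ h => h.symm) hy hy'
  by_cases hex : ∃ y ∈ I, P y
  · obtain ⟨y, hy, hP⟩ := hex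
    exact Or.inl fun x x' hx e => (conn y hy _ hx).1 hP x x' rfl e.symm
  · push Not at hex
    exact Or.inr fun x x' hx e => ((dich _ hx).resolve_left (hex _ hx)) x x' rfl e.symm

end LeafCoord

end FoliatedSurface
namespace FoliatedSurface

/-! ### Oriented arcs in the space of leaves. -/

section Arcs

variable {Z Y : Type*} [TopologicalSpace Z] [TopologicalSpace Y]

/-- The part `M` of the space of leaves is a one-dimensional manifold, its points are separated
from all others, and `p` is locally a product over it. -/
structure IsLeafSpace (p : Z → Y) (M : Set Y) : Prop where
  cont : Continuous p
  isOpenMap : IsOpenMap p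
  isOpen : IsOpen M
  arc : ∀ y ∈ M, ∃ j : ℝ → Y, IsOpenEmbedding j ∧ j 0 = y
  sep : ∀ y ∈ M, ∀ y', y ≠ y' → Disjoint (𝓝 y) (𝓝 y')
  box : ∀ z, p z ∈ M → HasBox p z

variable {p : Z → Y} {M : Set Y}

/-- This replaces the Hausdorff property, which `Y` lacks in general: the points of `M` can be
separated from every point, even from those outside `M`. -/
theorem isClosed_of_isCompact_of_sep (hsep : ∀ y ∈ M, ∀ y', y ≠ y' → Disjoint (𝓝 y) (𝓝 y'))
    {K : Set Y} (hK : IsCompact K) (hKM : K ⊆ M) : IsClosed K := by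
  rw [← isOpen_compl_iff, isOpen_iff_mem_nhds]
  intro y hy
  have : Disjoint (𝓝ˢ K) (𝓝 y) := hK.disjoint_nhdsSet_left.2 fun x hx =>
    hsep x (hKM hx) y fun h => hy (h ▸ hx)
  obtain ⟨s, hs, t, ht, hst⟩ := Filter.disjoint_iff.1 this
  exact Filter.mem_of_superset ht fun w hw hwK =>
    disjoint_left.1 hst (subset_of_mem_nhdsSet hs hwK) hw

theorem exists_shrink {j : ℝ → Y} (hj : IsOpenEmbedding j) {V : Set Y} (hV : V ∈ 𝓝 (j 0)) :
    ∃ j' : ℝ → Y, IsOpenEmbedding j' ∧ j' 0 = j 0 ∧ range j' ⊆ V := by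
  obtain ⟨ε, hε, hball⟩ := Metric.mem_nhds_iff.1 (hj.continuous.continuousAt.eventually hV)
  let b := OpenPartialHomeomorph.univBall (0 : ℝ) ε
  have hb : IsOpenEmbedding b :=
    b.isOpenEmbedding (OpenPartialHomeomorph.univBall_source 0 ε)
  refine ⟨j ∘ b, hj.comp hb, by simp [b], ?_⟩
  rintro _ ⟨s, rfl⟩
  refine hball ?_
  rw [← OpenPartialHomeomorph.univBall_target 0 hε]
  exact b.map_source (by simp [b])

/-- Over a short arc, the sections of a box at parameters 0 and 1 never meet, so they orient the
leaves. -/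
theorem IsLeafSpace.exists_goodArc [T2Space Z] (h : IsLeafSpace p M) (c : LeafCoord p) {y : Y}
    (hy : y ∈ M) {V : Set Y} (hV : V ∈ 𝓝 y) :
    ∃ j : ℝ → Y, IsOpenEmbedding j ∧ j 0 = y ∧ range j ⊆ M ∩ V ∧
      ∃ R, FibOrderOn p (p ⁻¹' range j) R := by
  obtain ⟨j₀, hj₀, rfl⟩ := h.arc y hy
  obtain ⟨Q, hQ, κ, hκ, hfib, hinj, -, -⟩ := h.box (c.par (j₀ 0) 0) (by rwa [c.p_par])
  rw [c.p_par] at hQ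
  obtain ⟨j, hj, hj0, hr⟩ := exists_shrink hj₀
    (Filter.inter_mem (Filter.inter_mem (h.isOpen.mem_nhds hy) hV) hQ)
  refine ⟨j, hj, hj0, fun _ hx => (hr hx).1, c.order (range j) (κ 0) (κ 1), ?_⟩
  have hsec : ∀ x, ContinuousOn (κ x) (range j) := fun x =>
    hκ.comp (f := fun y : Y => (x, y)) (by fun_prop) fun y hy => ⟨mem_univ _, (hr hy).2⟩
  exact c.fibOrderOn_order h.cont h.isOpenMap hj.isOpen_range
    (fun z hz => h.box z (hr hz).1.1) (hsec 0) (hsec 1) (fun y hy => hfib 0 y (hr hy).2)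
    (fun y hy => hfib 1 y (hr hy).2) fun y hy he => zero_ne_one (α := ℝ) (hinj y (hr hy).2 he)

/-- With a constant map in place of `p`, `FibOrderOn` means a linear order whose strict relation is
open. Arcs are described by such orders and not by parametrisations. -/
theorem fibOrderOn_range {j : ℝ → Y} (hj : IsOpenEmbedding j) :
    FibOrderOn (fun _ : Y => ()) (range j) (fun a b => ∃ s t, s < t ∧ j s = a ∧ j t = b) where
  left_mem := by rintro _ _ ⟨s, t, -, rfl, rfl⟩; exact ⟨s, rfl⟩
  right_mem := by rintro _ _ ⟨s, t, -, rfl, rfl⟩; exact ⟨t, rfl⟩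
  fib _ := rfl
  total := by
    rintro _ _ ⟨s, rfl⟩ ⟨t, rfl⟩ - hne
    rcases lt_or_gt_of_ne (fun h => hne (congrArg j h) : s ≠ t) with h | h
    · exact Or.inl ⟨s, t, h, rfl, rfl⟩
    · exact Or.inr ⟨t, s, h, rfl, rfl⟩
  irrefl := by
    rintro _ ⟨s, t, h, rfl, e⟩
    exact h.ne (hj.injective e).symm
  trans := by
    rintro _ _ _ ⟨s, t, h, rfl, rfl⟩ ⟨s', t', h', e, rfl⟩
    exact ⟨s, t', h.trans (hj.injective e ▸ h'), rfl, rfl⟩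
  isOpen := by
    rintro _ _ ⟨s, t, h, rfl, rfl⟩
    have h1 := (hj.isOpenMap.prodMap hj.isOpenMap).image_mem_nhds
      ((isOpen_lt continuous_fst continuous_snd).mem_nhds (show (s, t) ∈ {q : ℝ × ℝ | q.1 < q.2}
        from h))
    filter_upwards [h1]
    rintro _ ⟨q, hq, rfl⟩ -
    exact ⟨q.1, q.2, hq, rfl, rfl⟩

/-- An open arc in `M`, with a linear order and an order on the fibres over it. -/
structure OArc (p : Z → Y) (M : Set Y) where
  A : Set Y
  r : Y → Y → Prop
  R : Z → Z → Prop
  isOpen : IsOpen A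
  sub : A ⊆ M
  conn : IsPreconnected A
  nonempty : A.Nonempty
  ord : FibOrderOn (fun _ : Y => ()) A r
  fibOrd : FibOrderOn p (p ⁻¹' A) R

namespace OArc

/-- Prolongation keeps both orders. With orders in place of parametrisations a chain has its union
as an upper bound, and nothing has to be rescaled. -/
instance : Preorder (OArc p M) where
  le a b := a.A ⊆ b.A ∧ (∀ x ∈ a.A, ∀ y ∈ a.A, (a.r x y ↔ b.r x y)) ∧
    ∀ x y, p x ∈ a.A → p y ∈ a.A → (a.R x y ↔ b.R x y)
  le_refl a := ⟨subset_rfl, fun _ _ _ _ => Iff.rfl, fun _ _ _ _ => Iff.rfl⟩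
  le_trans a b c h1 h2 := ⟨h1.1.trans h2.1,
    fun x hx y hy => (h1.2.1 x hx y hy).trans (h2.2.1 x (h1.1 hx) y (h1.1 hy)),
    fun x y hx hy => (h1.2.2 x y hx hy).trans (h2.2.2 x y (h1.1 hx) (h1.1 hy))⟩

/-- The same arc with the opposite linear order. -/
def flip (a : OArc p M) : OArc p M :=
  { a with r := fun x y => a.r y x, ord := a.ord.flip }

theorem flip_le_flip {a b : OArc p M} (h : a ≤ b) : a.flip ≤ b.flip :=
  ⟨h.1, fun x hx y hy => h.2.1 y hy x hx, h.2.2⟩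

theorem fibOrderOn_iUnion {N B ι : Type*} [TopologicalSpace N] {t : N → B} {D : ι → Set N}
    {R : ι → N → N → Prop} (h : ∀ i, FibOrderOn t (D i) (R i))
    (hdir : ∀ i j, ∃ k, (D i ⊆ D k ∧ ∀ x y, R i x y → R k x y) ∧
      D j ⊆ D k ∧ ∀ x y, R j x y → R k x y) :
    FibOrderOn t (⋃ i, D i) (fun x y => ∃ i, R i x y) where
  left_mem := by rintro x y ⟨i, hi⟩; exact mem_iUnion.2 ⟨i, (h i).left_mem hi⟩
  right_mem := by rintro x y ⟨i, hi⟩; exact mem_iUnion.2 ⟨i, (h i).right_mem hi⟩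
  fib := by rintro x y ⟨i, hi⟩; exact (h i).fib hi
  total := by
    intro x y hx hy ht hne
    obtain ⟨i, hi⟩ := mem_iUnion.1 hx
    obtain ⟨j, hj⟩ := mem_iUnion.1 hy
    obtain ⟨k, hik, hjk⟩ := hdir i j
    exact ((h k).total (hik.1 hi) (hjk.1 hj) ht hne).imp (fun h => ⟨k, h⟩) fun h => ⟨k, h⟩
  irrefl := by rintro x ⟨i, hi⟩; exact (h i).irrefl x hi
  trans := by
    rintro x y z ⟨i, hi⟩ ⟨j, hj⟩
    obtain ⟨k, hik, hjk⟩ := hdir i j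
    exact ⟨k, (h k).trans (hik.2 _ _ hi) (hjk.2 _ _ hj)⟩
  isOpen := by
    rintro x y ⟨i, hi⟩
    filter_upwards [(h i).isOpen hi] with q hq e using ⟨i, hq e⟩

theorem exists_max (a : OArc p M) : ∃ m, a ≤ m ∧ IsMax m := by
  refine zorn_le_nonempty_Ici₀ a (fun c hca hc y hy => ?_) a le_rfl
  obtain ⟨x₀, hx₀⟩ := a.nonempty
  have hdir : ∀ i j : c, ∃ k : c, i.1 ≤ k.1 ∧ j.1 ≤ k.1 := fun i j => by
    rcases hc.total i.2 j.2 with h | h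
    · exact ⟨j, h, le_rfl⟩
    · exact ⟨i, le_rfl, h⟩
  have hr : ∀ {i k : OArc p M}, i ≤ k → ∀ x y, i.r x y → k.r x y := fun h x y hxy =>
    (h.2.1 x (OArc.ord _ |>.left_mem hxy) y (OArc.ord _ |>.right_mem hxy)).1 hxy
  have hR : ∀ {i k : OArc p M}, i ≤ k → ∀ x y, i.R x y → k.R x y := fun h x y hxy =>
    (h.2.2 x y (OArc.fibOrd _ |>.left_mem hxy) (OArc.fibOrd _ |>.right_mem hxy)).1 hxy
  let U : OArc p M :=
    { A := ⋃ i : c, i.1.A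
      r := fun x y => ∃ i : c, i.1.r x y
      R := fun x y => ∃ i : c, i.1.R x y
      isOpen := isOpen_iUnion fun i => i.1.isOpen
      sub := iUnion_subset fun i => i.1.sub
      conn := isPreconnected_iUnion ⟨x₀, mem_iInter.2 fun i => (hca i.2).1 hx₀⟩ fun i => i.1.conn
      nonempty := ⟨x₀, mem_iUnion.2 ⟨⟨y, hy⟩, (hca hy).1 hx₀⟩⟩
      ord := fibOrderOn_iUnion (fun i : c => i.1.ord) fun i j => by
        obtain ⟨k, hi, hj⟩ := hdir i j
        exact ⟨k, ⟨hi.1, hr hi⟩, hj.1, hr hj⟩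
      fibOrd := by
        rw [preimage_iUnion]
        refine fibOrderOn_iUnion (fun i : c => i.1.fibOrd) fun i j => ?_
        obtain ⟨k, hi, hj⟩ := hdir i j
        exact ⟨k, ⟨preimage_mono hi.1, hR hi⟩, preimage_mono hj.1, hR hj⟩ }
  refine ⟨U, fun z hz => ⟨fun x hx => mem_iUnion.2 ⟨⟨z, hz⟩, hx⟩, fun x hx y hy => ?_,
    fun x y hx hy => ?_⟩⟩
  · refine ⟨fun h => ⟨⟨z, hz⟩, h⟩, ?_⟩
    rintro ⟨i, hi⟩
    obtain ⟨k, hik, hzk⟩ := hdir i ⟨z, hz⟩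
    exact (hzk.2.1 x hx y hy).2 (hr hik _ _ hi)
  · refine ⟨fun h => ⟨⟨z, hz⟩, h⟩, ?_⟩
    rintro ⟨i, hi⟩
    obtain ⟨k, hik, hzk⟩ := hdir i ⟨z, hz⟩
    exact (hzk.2.2 x y hx hy).2 (hR hik _ _ hi)

variable (a : OArc p M)

/-- The two rays cut off by `b` are open and disjoint. -/
theorem one_side {S : Set Y} (hS : IsPreconnected S) (hSA : S ⊆ a.A) {b : Y} (hb : b ∈ a.A)
    (hbS : b ∉ S) : (∀ w ∈ S, a.r b w) ∨ (∀ w ∈ S, a.r w b) := by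
  have o1 : IsOpen {w | a.r b w} := isOpen_iff_mem_nhds.2 fun w hw =>
    (a.ord.eventually_lt (tendsto_const_nhds (x := b)) Filter.tendsto_id hw).mono
      fun w' h => h rfl
  have o2 : IsOpen {w | a.r w b} := isOpen_iff_mem_nhds.2 fun w hw =>
    (a.ord.eventually_lt Filter.tendsto_id (tendsto_const_nhds (x := b)) hw).mono
      fun w' h => h rfl
  exact hS.subset_or_subset o1 o2 (disjoint_left.2 fun w h1 h2 => a.ord.asymm h1 h2)
    fun w hw => a.ord.total hb (hSA hw) rfl fun h => hbS (h ▸ hw)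

/-- The path `d` runs into the arc and leaves it at the upper end as the parameter tends to `0`. -/
def TailTop (d : ℝ → Y) : Prop := ∀ b ∈ a.A, ∃ η > 0, ∀ t ∈ Ioo 0 η, a.r b (d t)

/-- Separate `b` from `x`: the end of the path stays away from a neighbourhood of `b`, and being
connected it lies on one side of `b`. The side does not change when `b` moves in a small arc, so by
connectedness of `a.A` it is the same for all `b`. -/
theorem tail_dichotomy (h : IsLeafSpace p M) {d : ℝ → Y} {x : Y} (hd : ContinuousOn d (Ioi 0))
    (hlim : Filter.Tendsto d (𝓝[>] 0) (𝓝 x)) (hx : x ∉ a.A) {δ : ℝ} (hδ : 0 < δ)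
    (hdA : ∀ t ∈ Ioo 0 δ, d t ∈ a.A) : a.TailTop d ∨ a.flip.TailTop d := by
  have key : ∀ b ∈ a.A, ∃ V, IsOpen V ∧ b ∈ V ∧ ((∃ η > 0, ∀ b' ∈ V, ∀ t ∈ Ioo 0 η, a.r b' (d t)) ∨
      (∃ η > 0, ∀ b' ∈ V, ∀ t ∈ Ioo 0 η, a.r (d t) b')) := by
    intro b hb
    have hbM := a.sub hb
    obtain ⟨V, hV, W, hW, hVW⟩ := Filter.disjoint_iff.1 (h.sep b hbM x fun e => hx (e ▸ hb))
    obtain ⟨j₀, hj₀, hj₀b⟩ := h.arc b hbM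
    obtain ⟨j, hj, hjb, hjV⟩ := exists_shrink hj₀ (V := V ∩ a.A)
      (hj₀b ▸ Filter.inter_mem hV (a.isOpen.mem_nhds hb))
    obtain ⟨η, hη, hηW⟩ := mem_nhdsGT_iff_exists_Ioo_subset.1 (hlim hW)
    have hη : 0 < η := hη
    have hm : 0 < min η δ := lt_min hη hδ
    have hI : ∀ t ∈ Ioo 0 (min η δ), d t ∈ a.A ∧ d t ∈ W := fun t ht =>
      ⟨hdA t ⟨ht.1, ht.2.trans_le (min_le_right _ _)⟩,
        hηW ⟨ht.1, ht.2.trans_le (min_le_left _ _)⟩⟩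
    have hIc : IsPreconnected (d '' Ioo 0 (min η δ)) :=
      isPreconnected_Ioo.image _ (hd.mono fun t ht => ht.1)
    have hIA : d '' Ioo 0 (min η δ) ⊆ a.A := by rintro _ ⟨t, ht, rfl⟩; exact (hI t ht).1
    have hVI : ∀ b' ∈ V, b' ∉ d '' Ioo 0 (min η δ) := by
      rintro _ hb' ⟨t, ht, rfl⟩
      exact disjoint_left.1 hVW hb' (hI t ht).2
    have hjc : IsPreconnected (range j) := isPreconnected_range hj.continuous
    have hjA : range j ⊆ a.A := hjV.trans inter_subset_right
    have hbj : b ∈ range j := ⟨0, hjb.trans hj₀b⟩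
    have hw : ∀ t ∈ Ioo 0 (min η δ), d t ∉ range j := fun t ht hm =>
      hVI _ (hjV hm).1 ⟨t, ht, rfl⟩
    refine ⟨range j, hj.isOpen_range, hbj, ?_⟩
    rcases a.one_side hIc hIA hb (hVI b (hjV hbj).1) with hs | hs
    · refine Or.inl ⟨_, hm, fun b' hb' t ht => ?_⟩
      rcases a.one_side hjc hjA (hI t ht).1 (hw t ht) with h' | h'
      · exact absurd (h' b hbj) (a.ord.asymm (hs _ ⟨t, ht, rfl⟩))
      · exact h' _ hb'
    · refine Or.inr ⟨_, hm, fun b' hb' t ht => ?_⟩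
      rcases a.one_side hjc hjA (hI t ht).1 (hw t ht) with h' | h'
      · exact h' _ hb'
      · exact absurd (h' b hbj) (a.ord.asymm (hs _ ⟨t, ht, rfl⟩))
  have o1 : IsOpen {b | ∃ η > 0, ∀ t ∈ Ioo 0 η, a.r b (d t)} := by
    refine isOpen_iff_mem_nhds.2 fun b hb => ?_
    obtain ⟨η, hη, hb⟩ := hb
    have hbA : b ∈ a.A := a.ord.left_mem (hb (η / 2) ⟨by linarith, by linarith⟩)
    obtain ⟨V, hVo, hbV, ⟨η', hη', h'⟩ | ⟨η', hη', h'⟩⟩ := key b hbA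
    · exact Filter.mem_of_superset (hVo.mem_nhds hbV) fun b' hb' => ⟨η', hη', h' b' hb'⟩
    · have hm : 0 < min η η' / 2 := half_pos (lt_min hη hη')
      have := min_le_left η η'
      have := min_le_right η η'
      exact absurd (h' b hbV (min η η' / 2) ⟨hm, by linarith⟩)
        (a.ord.asymm (hb _ ⟨hm, by linarith⟩))
  have o2 : IsOpen {b | ∃ η > 0, ∀ t ∈ Ioo 0 η, a.r (d t) b} := by
    refine isOpen_iff_mem_nhds.2 fun b hb => ?_
    obtain ⟨η, hη, hb⟩ := hb
    have hbA : b ∈ a.A := a.ord.right_mem (hb (η / 2) ⟨by linarith, by linarith⟩)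
    obtain ⟨V, hVo, hbV, ⟨η', hη', h'⟩ | ⟨η', hη', h'⟩⟩ := key b hbA
    · have hm : 0 < min η η' / 2 := half_pos (lt_min hη hη')
      have := min_le_left η η'
      have := min_le_right η η'
      exact absurd (h' b hbV (min η η' / 2) ⟨hm, by linarith⟩)
        (a.ord.asymm (hb _ ⟨hm, by linarith⟩))
    · exact Filter.mem_of_superset (hVo.mem_nhds hbV) fun b' hb' => ⟨η', hη', h' b' hb'⟩
  refine a.conn.subset_or_subset o1 o2 (disjoint_left.2 ?_) fun b hb => ?_
  · rintro b ⟨η, hη, h1⟩ ⟨η', hη', h2⟩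
    have hm : 0 < min η η' / 2 := half_pos (lt_min hη hη')
    have := min_le_left η η'
    have := min_le_right η η'
    exact a.ord.asymm (h1 _ ⟨hm, by linarith⟩) (h2 _ ⟨hm, by linarith⟩)
  · obtain ⟨V, hVo, hbV, ⟨η', hη', h'⟩ | ⟨η', hη', h'⟩⟩ := key b hb
    · exact Or.inl ⟨η', hη', h' b hbV⟩
    · exact Or.inr ⟨η', hη', h' b hbV⟩

/-- Choose a point of `d`, above it a point of `d'`, and above that another point of `d`. The image
of `d` is connected, so it contains the middle point. -/
theorem tails_meet {d d' : ℝ → Y} (hd : ContinuousOn d (Ioi 0)) {δ δ' : ℝ} (hδ : 0 < δ)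
    (hδ' : 0 < δ') (hdA : ∀ t ∈ Ioo 0 δ, d t ∈ a.A) (hdA' : ∀ t ∈ Ioo 0 δ', d' t ∈ a.A)
    (h : a.TailTop d) (h' : a.TailTop d') : ∃ t ∈ Ioo 0 δ, ∃ t' ∈ Ioo 0 δ', d t = d' t' := by
  have hw : δ / 2 ∈ Ioo 0 δ := ⟨by linarith, by linarith⟩
  obtain ⟨η₁, hη₁, h1⟩ := h' _ (hdA _ hw)
  have m1 : 0 < min η₁ δ' / 2 := half_pos (lt_min hη₁ hδ')
  have := min_le_left η₁ δ'
  have := min_le_right η₁ δ'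
  have hv : min η₁ δ' / 2 ∈ Ioo 0 δ' := ⟨m1, by linarith⟩
  obtain ⟨η₂, hη₂, h2⟩ := h _ (hdA' _ hv)
  have m2 : 0 < min η₂ δ / 2 := half_pos (lt_min hη₂ hδ)
  have := min_le_left η₂ δ
  have := min_le_right η₂ δ
  have hwv := h1 _ ⟨m1, by linarith⟩
  have hvu := h2 _ ⟨m2, by linarith⟩
  by_contra! hno
  have hnot : d' (min η₁ δ' / 2) ∉ d '' Ioo 0 δ := by
    rintro ⟨t, ht, e⟩
    exact hno t ht _ hv e
  have hsub : d '' Ioo 0 δ ⊆ a.A := by rintro _ ⟨t, ht, rfl⟩; exact hdA t ht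
  rcases a.one_side (isPreconnected_Ioo.image d (hd.mono fun t ht => ht.1)) hsub (hdA' _ hv) hnot
    with hs | hs
  · exact a.ord.asymm hwv (hs _ ⟨_, hw, rfl⟩)
  · exact a.ord.asymm hvu (hs _ ⟨_, ⟨m2, by linarith⟩, rfl⟩)

end OArc

end Arcs

end FoliatedSurface
namespace FoliatedSurface

/-! ### Maximal arcs and the components of the regular part. -/

section Arcs

variable {Z Y : Type*} [TopologicalSpace Z] [TopologicalSpace Y] {p : Z → Y} {M : Set Y}

namespace OArc

variable (a : OArc p M)

/-- An arc that runs up to a point `j 0` can be prolonged past it. -/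
theorem exists_extension (c : LeafCoord p) (hop : IsOpenMap p) {j : ℝ → Y}
    (hj : IsOpenEmbedding j) (hjM : range j ⊆ M) {Rj : Z → Z → Prop}
    (hRj : FibOrderOn p (p ⁻¹' range j) Rj) (hneg : ∀ t < 0, j t ∈ a.A)
    (hpos : ∀ t, 0 ≤ t → j t ∉ a.A) (htop : a.TailTop fun t => j (-t)) :
    ∃ b : OArc p M, a ≤ b ∧ j 0 ∈ b.A := by
  -- `j` is increasing on the negative half-line
  have mono : ∀ s t, s < t → t < 0 → a.r (j s) (j t) := by
    intro s t hst ht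
    have hs : j s ∉ j '' Ioo s 0 := by
      rintro ⟨u, hu, e⟩
      exact hu.1.ne' (hj.injective e)
    have hsub : j '' Ioo s 0 ⊆ a.A := by rintro _ ⟨u, hu, rfl⟩; exact hneg u hu.2
    rcases a.one_side (isPreconnected_Ioo.image j hj.continuous.continuousOn) hsub
      (hneg s (hst.trans ht)) hs with h | h
    · exact h _ ⟨t, ⟨hst, ht⟩, rfl⟩
    · obtain ⟨η, hη, h'⟩ := htop _ (hneg s (hst.trans ht))
      have hm : 0 < min η (-s) / 2 := half_pos (lt_min hη (by linarith))
      have := min_le_left η (-s)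
      have := min_le_right η (-s)
      exact absurd (h' _ ⟨hm, by linarith⟩)
        (a.ord.asymm (h _ ⟨_, ⟨by linarith, by linarith⟩, rfl⟩))
  have memA : ∀ t, j t ∈ a.A ↔ t < 0 := fun t =>
    ⟨fun h => by by_contra! ht; exact hpos t ht h, hneg t⟩
  -- the order on the fibres
  obtain ⟨R', hR', hag⟩ : ∃ R', FibOrderOn p (p ⁻¹' range j) R' ∧
      ∀ x x', p x ∈ j '' Iio 0 → p x = p x' → (a.R x x' ↔ R' x x') := by
    have hI : IsPreconnected (j '' Iio 0) :=
      isPreconnected_Iio.image j hj.continuous.continuousOn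
    have hIA : j '' Iio 0 ⊆ a.A := by rintro _ ⟨t, ht, rfl⟩; exact hneg t ht
    rcases c.agree_or_opposite hop a.fibOrd hRj hI hIA (image_subset_range _ _) with h | h
    · exact ⟨_, hRj, h⟩
    · exact ⟨_, hRj.flip, h⟩
  have hcap : ∀ y, y ∈ a.A → y ∈ range j → y ∈ j '' Iio 0 := by
    rintro _ h ⟨t, rfl⟩
    exact ⟨t, (memA t).1 h, rfl⟩
  have toR' : ∀ {x x'}, a.R x x' → p x ∈ range j → R' x x' := fun h hx =>
    (hag _ _ (hcap _ (a.fibOrd.left_mem h) hx) (a.fibOrd.fib h)).1 h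
  have toR : ∀ {x x'}, R' x x' → p x ∈ a.A → a.R x x' := fun h hx =>
    (hag _ _ (hcap _ hx (hR'.left_mem h)) (hR'.fib h)).2 h
  -- The new points `j t` with `t ≥ 0` follow all old points and are ordered by their parameter.
  -- Openness at a pair of an old and a new point uses that `j` leaves the arc at its upper end.
  let r' : Y → Y → Prop := fun x y => a.r x y ∨ (x ∈ a.A ∧ ∃ t, 0 ≤ t ∧ y = j t) ∨
    ∃ s t, 0 ≤ s ∧ s < t ∧ x = j s ∧ y = j t
  have hr' : ∀ x y, y ∈ a.A → r' x y → a.r x y := by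
    rintro x y hy (h | ⟨-, t, ht, rfl⟩ | ⟨s, t, hs, hst, rfl, rfl⟩)
    · exact h
    · exact absurd hy (hpos t ht)
    · exact absurd hy (hpos t (hs.trans hst.le))
  have case2 : ∀ x ∈ a.A, ∀ t, 0 ≤ t → ∀ᶠ q : Y × Y in 𝓝 (x, j t), r' q.1 q.2 := by
    intro x hx t ht
    obtain ⟨η, hη, h⟩ := htop x hx
    have hu : j (-(η / 2)) ∈ a.A := hneg _ (by linarith)
    have hxu : a.r x (j (-(η / 2))) := h _ ⟨by linarith, by linarith⟩
    have e1 : ∀ᶠ x' in 𝓝 x, a.r x' (j (-(η / 2))) :=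
      (a.ord.eventually_lt Filter.tendsto_id (tendsto_const_nhds (x := j (-(η / 2)))) hxu).mono
        fun x' h => h rfl
    have e2 : j '' Ioi (-(η / 2)) ∈ 𝓝 (j t) :=
      hj.isOpenMap.image_mem_nhds (Ioi_mem_nhds (by linarith))
    filter_upwards [continuousAt_fst.eventually e1, continuousAt_snd.eventually e2]
    rintro ⟨x', _⟩ hx' ⟨t', ht', rfl⟩
    rcases lt_or_ge t' 0 with h0 | h0
    · exact Or.inl (a.ord.trans hx' (mono _ _ ht' h0))
    · exact Or.inr (Or.inl ⟨a.ord.left_mem hx', t', h0, rfl⟩)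
  have hord : FibOrderOn (fun _ : Y => ()) (a.A ∪ range j) r' := by
    refine ⟨?_, ?_, fun _ => rfl, ?_, ?_, ?_, ?_⟩
    · rintro x y (h | ⟨h, -⟩ | ⟨s, t, hs, hst, rfl, rfl⟩)
      · exact Or.inl (a.ord.left_mem h)
      · exact Or.inl h
      · exact Or.inr ⟨s, rfl⟩
    · rintro x y (h | ⟨h, t, -, rfl⟩ | ⟨s, t, hs, hst, rfl, rfl⟩)
      · exact Or.inl (a.ord.right_mem h)
      · exact Or.inr ⟨t, rfl⟩
      · exact Or.inr ⟨t, rfl⟩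
    · intro x y hx hy _ hne
      have hcase : ∀ x, x ∈ a.A ∪ range j → x ∈ a.A ∨ ∃ t, 0 ≤ t ∧ x = j t := by
        rintro x (h | ⟨t, rfl⟩)
        · exact Or.inl h
        · rcases lt_or_ge t 0 with h | h
          · exact Or.inl (hneg t h)
          · exact Or.inr ⟨t, h, rfl⟩
      rcases hcase x hx with hx | ⟨s, hs, rfl⟩ <;> rcases hcase y hy with hy | ⟨t, ht, rfl⟩
      · exact (a.ord.total hx hy rfl hne).imp Or.inl Or.inl
      · exact Or.inl (Or.inr (Or.inl ⟨hx, t, ht, rfl⟩))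
      · exact Or.inr (Or.inr (Or.inl ⟨hy, s, hs, rfl⟩))
      · rcases lt_or_gt_of_ne (fun h => hne (congrArg j h) : s ≠ t) with h | h
        · exact Or.inl (Or.inr (Or.inr ⟨s, t, hs, h, rfl, rfl⟩))
        · exact Or.inr (Or.inr (Or.inr ⟨t, s, ht, h, rfl, rfl⟩))
    · rintro x (h | ⟨h, t, ht, rfl⟩ | ⟨s, t, hs, hst, rfl, e⟩)
      · exact a.ord.irrefl x h
      · exact hpos t ht h
      · exact hst.ne (hj.injective e)
    · rintro x y z h1 h2
      rcases h2 with h2 | ⟨h2, t, ht, rfl⟩ | ⟨s, t, hs, hst, rfl, rfl⟩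
      · exact Or.inl (a.ord.trans (hr' _ _ (a.ord.left_mem h2) h1) h2)
      · exact Or.inr (Or.inl ⟨a.ord.left_mem (hr' _ _ h2 h1), t, ht, rfl⟩)
      · rcases h1 with h1 | ⟨h1, t', ht', e⟩ | ⟨s', t', hs', hst', rfl, e⟩
        · exact absurd (a.ord.right_mem h1) (hpos s hs)
        · exact Or.inr (Or.inl ⟨h1, t, hs.trans hst.le, rfl⟩)
        · exact Or.inr (Or.inr ⟨s', t, hs', hst'.trans (hj.injective e ▸ hst), rfl, rfl⟩)
    · rintro x y (h | ⟨h, t, ht, rfl⟩ | ⟨s, t, hs, hst, rfl, rfl⟩)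
      · filter_upwards [a.ord.isOpen h] with q hq e using Or.inl (hq e)
      · filter_upwards [case2 x h t ht] with q hq _ using hq
      · obtain ⟨m, hm1, hm2⟩ := exists_between hst
        have e1 : j '' Iio m ∈ 𝓝 (j s) := hj.isOpenMap.image_mem_nhds (Iio_mem_nhds hm1)
        have e2 : j '' Ioi m ∈ 𝓝 (j t) := hj.isOpenMap.image_mem_nhds (Ioi_mem_nhds hm2)
        filter_upwards [continuousAt_fst.eventually e1, continuousAt_snd.eventually e2]
        rintro ⟨_, _⟩ ⟨s', hs', rfl⟩ ⟨t', ht', rfl⟩ -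
        have ht0 : 0 ≤ t' := (hs.trans hm1.le).trans (le_of_lt ht')
        rcases lt_or_ge s' 0 with h0 | h0
        · exact Or.inr (Or.inl ⟨hneg s' h0, t', ht0, rfl⟩)
        · exact Or.inr (Or.inr ⟨s', t', h0, lt_trans hs' ht', rfl, rfl⟩)
  have hfib : FibOrderOn p (p ⁻¹' (a.A ∪ range j)) (fun x x' => a.R x x' ∨ R' x x') := by
    refine ⟨?_, ?_, ?_, ?_, ?_, ?_, ?_⟩
    · rintro x y (h | h)
      · exact Or.inl (a.fibOrd.left_mem h)
      · exact Or.inr (hR'.left_mem h)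
    · rintro x y (h | h)
      · exact Or.inl (a.fibOrd.right_mem h)
      · exact Or.inr (hR'.right_mem h)
    · rintro x y (h | h)
      · exact a.fibOrd.fib h
      · exact hR'.fib h
    · rintro x y (hx | hx) - e hne
      · exact (a.fibOrd.total hx (by rw [mem_preimage, ← e]; exact hx) e hne).imp Or.inl Or.inl
      · exact (hR'.total hx (by rw [mem_preimage, ← e]; exact hx) e hne).imp Or.inr Or.inr
    · rintro x (h | h)
      · exact a.fibOrd.irrefl x h
      · exact hR'.irrefl x h
    · rintro x y z (h | h) (h' | h')
      · exact Or.inl (a.fibOrd.trans h h')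
      · exact Or.inl (a.fibOrd.trans h (toR h' (a.fibOrd.right_mem h)))
      · exact Or.inl (a.fibOrd.trans (toR h (hR'.fib h ▸ a.fibOrd.left_mem h')) h')
      · exact Or.inr (hR'.trans h h')
    · rintro x y (h | h)
      · filter_upwards [a.fibOrd.isOpen h] with q hq e using Or.inl (hq e)
      · filter_upwards [hR'.isOpen h] with q hq e using Or.inr (hq e)
  refine ⟨⟨a.A ∪ range j, r', _, a.isOpen.union hj.isOpen_range, union_subset a.sub hjM,
    IsPreconnected.union (j (-1)) (hneg _ (by norm_num)) ⟨_, rfl⟩ a.conn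
      (isPreconnected_range hj.continuous), a.nonempty.mono subset_union_left, hord, hfib⟩,
    ⟨subset_union_left, fun x hx y hy => ⟨Or.inl, hr' x y hy⟩, fun x y hx hy => ⟨Or.inl, ?_⟩⟩,
    Or.inr ⟨0, rfl⟩⟩
  rintro (h | h)
  · exact h
  · exact toR h hx

theorem isMax_flip {a : OArc p M} (h : IsMax a) : IsMax a.flip := fun b hb => by
  have h1 : a ≤ b.flip := flip_le_flip hb
  exact flip_le_flip (h h1)

/-- An arc through which a short path `j` runs on both sides of a missing point is contained in
the path. -/
theorem subset_of_notMem (h : IsLeafSpace p M) {j : ℝ → Y} (hj : IsOpenEmbedding j)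
    (hjM : range j ⊆ M) {s t : ℝ} (hs : j s ∉ a.A) (ht : j t ∉ a.A) {u : ℝ} (hu : u ∈ Ioo s t)
    (huA : j u ∈ a.A) : a.A ⊆ j '' Ioo s t := by
  have hcl : IsClosed (j '' Icc s t) := isClosed_of_isCompact_of_sep h.sep
    (isCompact_Icc.image hj.continuous) ((image_subset_range _ _).trans hjM)
  refine a.conn.subset_left_of_subset_union (hj.isOpenMap _ isOpen_Ioo) hcl.isOpen_compl
    ?_ ?_ ⟨j u, huA, u, hu, rfl⟩
  · rw [disjoint_compl_right_iff_subset]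
    exact image_mono Ioo_subset_Icc_self
  · intro y hy
    by_cases hyI : y ∈ j '' Icc s t
    · obtain ⟨v, hv, rfl⟩ := hyI
      refine Or.inl ⟨v, ⟨lt_of_le_of_ne hv.1 fun e => hs (e ▸ hy),
        lt_of_le_of_ne hv.2 fun e => ht (e ▸ hy)⟩, rfl⟩
    · exact Or.inr hyI

/-- Otherwise the arc misses points arbitrarily close to `j 0` on both sides. It meets each interval
between two such points, hence is contained in it, and this is impossible for a nonempty arc that
avoids `j 0` and lies in arbitrarily small intervals. -/
theorem exists_side (h : IsLeafSpace p M) {j : ℝ → Y} (hj : IsOpenEmbedding j)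
    (hjM : range j ⊆ M) (hx : j 0 ∉ a.A) (hcl : j 0 ∈ closure a.A) :
    ∃ δ > 0, (∀ t ∈ Ioo 0 δ, j t ∈ a.A) ∨ ∀ t ∈ Ioo 0 δ, j (-t) ∈ a.A := by
  by_contra! hno
  have pts : ∀ δ > 0, ∃ s ∈ Ioo 0 δ, ∃ t ∈ Ioo 0 δ, j (-s) ∉ a.A ∧ j t ∉ a.A := fun δ hδ => by
    obtain ⟨⟨t, ht, h1⟩, s, hs, h2⟩ := hno δ hδ
    exact ⟨s, hs, t, ht, h2, h1⟩
  have key : ∀ s > 0, ∀ t > 0, j (-s) ∉ a.A → j t ∉ a.A → a.A ⊆ j '' Ioo (-s) t := by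
    intro s hs t ht h1 h2
    obtain ⟨_, ⟨u, hu, rfl⟩, huA⟩ := mem_closure_iff_nhds.1 hcl _
      (hj.isOpenMap.image_mem_nhds (Ioo_mem_nhds (neg_lt_zero.2 hs) ht))
    exact a.subset_of_notMem h hj hjM h1 h2 hu huA
  obtain ⟨y, hy⟩ := a.nonempty
  obtain ⟨s, hs, t, ht, h1, h2⟩ := pts 1 one_pos
  obtain ⟨u, hu, rfl⟩ := key s hs.1 t ht.1 h1 h2 hy
  have hu0 : u ≠ 0 := fun e => hx (e ▸ hy)
  obtain ⟨s', hs', t', ht', h1', h2'⟩ := pts |u| (abs_pos.2 hu0)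
  obtain ⟨v, hv, e⟩ := key s' hs'.1 t' ht'.1 h1' h2' hy
  obtain rfl := hj.injective e
  have : |v| < |v| := abs_lt.2 ⟨by linarith [hv.1, hs'.2], by linarith [hv.2, ht'.2]⟩
  exact lt_irrefl _ this

/-- Otherwise some point of the arc lies between two missing points at positive parameters. Then the
whole arc has positive parameters, contrary to the points on the negative side. -/
theorem other_side (h : IsLeafSpace p M) {j : ℝ → Y} (hj : IsOpenEmbedding j)
    (hjM : range j ⊆ M) {δ : ℝ} (hδ : 0 < δ) (hneg : ∀ t ∈ Ioo 0 δ, j (-t) ∈ a.A) :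
    ∃ ε > 0, (∀ t ∈ Ioo 0 ε, j t ∈ a.A) ∨ ∀ t ∈ Ioo 0 ε, j t ∉ a.A := by
  by_contra! hno
  obtain ⟨⟨s, hs, hsA⟩, -⟩ := hno 1 one_pos
  obtain ⟨-, u, hu, huA⟩ := hno s hs.1
  obtain ⟨⟨s', hs', hsA'⟩, -⟩ := hno u hu.1
  have hsub := a.subset_of_notMem h hj hjM hsA' hsA ⟨hs'.2, hu.2⟩ huA
  obtain ⟨v, hv, e⟩ := hsub (hneg (δ / 2) ⟨by linarith, by linarith⟩)
  have := hj.injective e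
  linarith [hv.1, hs'.1]

theorem isOpenEmbedding_neg {j : ℝ → Y} (hj : IsOpenEmbedding j) :
    IsOpenEmbedding fun t => j (-t) :=
  hj.comp (Homeomorph.neg ℝ).isOpenEmbedding

theorem range_neg {j : ℝ → Y} : (range fun t => j (-t)) = range j :=
  (Homeomorph.neg ℝ).surjective.range_comp j

/-- At a boundary point of a maximal arc both sides belong to the arc. -/
theorem both_sides [T2Space Z] (h : IsLeafSpace p M) (c : LeafCoord p) (hm : IsMax a)
    {j : ℝ → Y} (hj : IsOpenEmbedding j) (hjM : range j ⊆ M) {Rj : Z → Z → Prop}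
    (hRj : FibOrderOn p (p ⁻¹' range j) Rj) (hx : j 0 ∉ a.A) {δ : ℝ} (hδ : 0 < δ)
    (hneg : ∀ t ∈ Ioo 0 δ, j (-t) ∈ a.A) : ∃ ε > 0, ∀ t ∈ Ioo 0 ε, j t ∈ a.A := by
  obtain ⟨ε, hε, h1 | h1⟩ := a.other_side h hj hjM hδ hneg
  · exact ⟨ε, hε, h1⟩
  exfalso
  have hm0 : 0 < min ε δ := lt_min hε hδ
  -- A reparametrisation of a small interval by the whole line that keeps the sign; the ball
  -- parametrisation is reversed if it happens to be decreasing.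
  obtain ⟨b, hb, hb0, hbI, hbmono⟩ : ∃ b : ℝ → ℝ, IsOpenEmbedding b ∧ b 0 = 0 ∧
      (∀ t, b t ∈ Ioo (-(min ε δ)) (min ε δ)) ∧ ∀ t, (t < 0 → b t < 0) ∧ (0 < t → 0 < b t) := by
    let b := OpenPartialHomeomorph.univBall (0 : ℝ) (min ε δ)
    have hb : IsOpenEmbedding b :=
      b.isOpenEmbedding (OpenPartialHomeomorph.univBall_source 0 _)
    have hb0 : b 0 = 0 := by simp [b]
    have hbI : ∀ t, b t ∈ Ioo (-(min ε δ)) (min ε δ) := fun t => by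
      have : b t ∈ b.target := b.map_source (by simp [b])
      rw [OpenPartialHomeomorph.univBall_target 0 hm0, Real.ball_eq_Ioo] at this
      simpa using this
    rcases hb.continuous.strictMono_of_inj hb.injective with hmono | hanti
    · exact ⟨b, hb, hb0, hbI, fun t => ⟨fun ht => hb0 ▸ hmono ht, fun ht => hb0 ▸ hmono ht⟩⟩
    · refine ⟨fun t => b (-t), isOpenEmbedding_neg hb, by simpa using hb0, fun t => hbI _,
        fun t => ⟨fun ht => hb0 ▸ hanti (by linarith), fun ht => hb0 ▸ hanti (by linarith)⟩⟩
  have hj' := hj.comp hb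
  have hsub : range (j ∘ b) ⊆ range j := range_comp_subset_range _ _
  have hRj' : FibOrderOn p (p ⁻¹' range (j ∘ b)) (fun x y => Rj x y ∧ p x ∈ range (j ∘ b)) :=
    ⟨fun h => h.2, fun h => by rw [mem_preimage, ← hRj.fib h.1]; exact h.2, fun h => hRj.fib h.1,
      fun {x y} hx hy e hne => (hRj.total (hsub hx) (hsub hy) e hne).imp (fun h => ⟨h, hx⟩)
        fun h => ⟨h, hy⟩, fun x h => hRj.irrefl x h.1, fun h h' => ⟨hRj.trans h.1 h'.1, h.2⟩,
      fun {x y} hxy => by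
        have o : ∀ᶠ q : Z × Z in 𝓝 (x, y), p q.1 ∈ range (j ∘ b) :=
          (h.cont.comp continuous_fst).continuousAt.eventually (hj'.isOpen_range.mem_nhds hxy.2)
        filter_upwards [hRj.isOpen hxy.1, o] with q h1 h2 e using ⟨h1 e, h2⟩⟩
  have hneg' : ∀ t < 0, (j ∘ b) t ∈ a.A := fun t ht => by
    have := hneg (-(b t)) ⟨neg_pos.2 ((hbmono t).1 ht), by
      have := (hbI t).1
      have := min_le_right ε δ
      linarith⟩
    simpa using this
  have hpos' : ∀ t, 0 ≤ t → (j ∘ b) t ∉ a.A := fun t ht => by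
    rcases ht.eq_or_lt with rfl | ht
    · simpa [hb0] using hx
    · exact h1 _ ⟨(hbmono t).2 ht, (hbI t).2.trans_le (min_le_left _ _)⟩
  have hj0 : (j ∘ b) 0 ∉ a.A := hpos' 0 le_rfl
  have hlim : Filter.Tendsto (fun t => (j ∘ b) (-t)) (𝓝[>] 0) (𝓝 ((j ∘ b) 0)) := by
    refine Filter.Tendsto.mono_left ?_ nhdsWithin_le_nhds
    simpa using (isOpenEmbedding_neg hj').continuous.tendsto 0
  -- The negative side of `j` leaves the arc at one of its ends. After flipping the order if
  -- necessary this is the upper end, where the arc could be prolonged past `j 0`.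
  rcases a.tail_dichotomy h (d := fun t => (j ∘ b) (-t))
    (isOpenEmbedding_neg hj').continuous.continuousOn hlim hj0 one_pos
    (fun t ht => hneg' _ (neg_lt_zero.2 ht.1)) with ht | ht
  · obtain ⟨b', hb', hmem⟩ := a.exists_extension c h.isOpenMap hj' (hsub.trans hjM) hRj' hneg'
      hpos' ht
    exact hj0 ((hm hb').1 hmem)
  · obtain ⟨b', hb', hmem⟩ := a.flip.exists_extension c h.isOpenMap hj' (hsub.trans hjM) hRj'
      hneg' hpos' ht
    exact hj0 ((isMax_flip hm hb').1 hmem)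

/-- A maximal arc is clopen, possibly after adding one point. -/
theorem exists_component [T2Space Z] (h : IsLeafSpace p M) (c : LeafCoord p) (hm : IsMax a) :
    ∃ E : Set Y, IsOpen E ∧ E ⊆ M ∧ (∀ x ∈ M, x ∈ closure E → x ∈ E) ∧ IsPreconnected E ∧
      a.A ⊆ E ∧ ∃ x, E ⊆ insert x a.A := by
  by_cases hcl : ∀ x ∈ M, x ∈ closure a.A → x ∈ a.A
  · obtain ⟨x, hx⟩ := a.nonempty
    exact ⟨a.A, a.isOpen, a.sub, hcl, a.conn, subset_rfl, x, subset_insert _ _⟩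
  push Not at hcl
  obtain ⟨x, hxM, hxcl, hxA⟩ := hcl
  have sides : ∀ y ∈ M, y ∈ closure a.A → y ∉ a.A → ∃ j : ℝ → Y, IsOpenEmbedding j ∧ j 0 = y ∧
      ∃ δ > 0, (∀ t ∈ Ioo 0 δ, j t ∈ a.A) ∧ ∀ t ∈ Ioo 0 δ, j (-t) ∈ a.A := by
    intro y hyM hycl hyA
    obtain ⟨j, hj, rfl, hjM, Rj, hRj⟩ := h.exists_goodArc c hyM Filter.univ_mem
    have hjM : range j ⊆ M := hjM.trans inter_subset_left
    obtain ⟨δ, hδ, h1 | h1⟩ := a.exists_side h hj hjM hyA hycl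
    · obtain ⟨ε, hε, h2⟩ := a.both_sides h c hm (j := fun t => j (-t)) (isOpenEmbedding_neg hj)
        (range_neg.trans_subset hjM) (Rj := Rj) (by rw [range_neg]; exact hRj) (by simpa using hyA)
        hδ (by simpa using h1)
      exact ⟨j, hj, rfl, _, lt_min hδ hε, fun t ht => h1 t ⟨ht.1, ht.2.trans_le (min_le_left _ _)⟩,
        fun t ht => h2 t ⟨ht.1, ht.2.trans_le (min_le_right _ _)⟩⟩
    · obtain ⟨ε, hε, h2⟩ := a.both_sides h c hm hj hjM hRj hyA hδ h1
      exact ⟨j, hj, rfl, _, lt_min hδ hε,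
        fun t ht => h2 t ⟨ht.1, ht.2.trans_le (min_le_right _ _)⟩,
        fun t ht => h1 t ⟨ht.1, ht.2.trans_le (min_le_left _ _)⟩⟩
  obtain ⟨j, hj, rfl, δ, hδ, hp, hn⟩ := sides x hxM hxcl hxA
  have lim : ∀ {i : ℝ → Y}, IsOpenEmbedding i → Filter.Tendsto i (𝓝[>] 0) (𝓝 (i 0)) :=
    fun hi => (hi.continuous.tendsto 0).mono_left nhdsWithin_le_nhds
  have hj' := isOpenEmbedding_neg hj
  have meet : ∀ {d d' : ℝ → Y} {δ δ' : ℝ}, ContinuousOn d (Ioi 0) → 0 < δ → 0 < δ' →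
      (∀ t ∈ Ioo 0 δ, d t ∈ a.A) → (∀ t ∈ Ioo 0 δ', d' t ∈ a.A) →
      ((a.TailTop d ∧ a.TailTop d') ∨ (a.flip.TailTop d ∧ a.flip.TailTop d')) →
      ∃ t ∈ Ioo 0 δ, ∃ t' ∈ Ioo 0 δ', d t = d' t' := by
    rintro d d' δ δ' hd h1 h2 h3 h4 (⟨h5, h6⟩ | ⟨h5, h6⟩)
    · exact a.tails_meet hd h1 h2 h3 h4 h5 h6
    · exact a.flip.tails_meet hd h1 h2 h3 h4 h5 h6
  -- At a common end the two sides of `j 0` would meet, against injectivity of `j`. So they occupy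
  -- both ends, and the arc closes up to a circle through `j 0`.
  have noboth : ¬ ((a.TailTop j ∧ a.TailTop fun t => j (-t)) ∨
      (a.flip.TailTop j ∧ a.flip.TailTop fun t => j (-t))) := fun hb => by
    obtain ⟨t, ht, t', ht', e⟩ := meet hj.continuous.continuousOn hδ hδ hp hn hb
    have := hj.injective e
    linarith [ht.1, ht'.1]
  have d1 := a.tail_dichotomy h hj.continuous.continuousOn (lim hj) hxA hδ hp
  have d2 := a.tail_dichotomy h hj'.continuous.continuousOn (lim hj') (by simpa using hxA) hδ hn
  refine ⟨insert (j 0) a.A, ?_, insert_subset hxM a.sub, ?_, ?_, subset_insert _ _, _, subset_rfl⟩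
  · have : insert (j 0) a.A = a.A ∪ j '' Ioo (-δ) δ := by
      refine Subset.antisymm (insert_subset (Or.inr ⟨0, ⟨by linarith, hδ⟩, rfl⟩) subset_union_left)
        (union_subset (subset_insert _ _) ?_)
      rintro _ ⟨t, ht, rfl⟩
      rcases lt_trichotomy t 0 with h0 | rfl | h0
      · have := hn (-t) ⟨by linarith, by linarith [ht.1]⟩
        exact Or.inr (by simpa using this)
      · exact Or.inl rfl
      · exact Or.inr (hp t ⟨h0, ht.2⟩)
    rw [this]
    exact a.isOpen.union (hj.isOpenMap _ isOpen_Ioo)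
  · intro y hyM hycl
    by_contra hy
    have hyx : j 0 ≠ y := fun e => hy (Or.inl e.symm)
    have hyA : y ∉ a.A := fun e => hy (Or.inr e)
    have hycl' : y ∈ closure a.A := by
      have hsub : closure (insert (j 0) a.A) ⊆ closure {j 0} ∪ closure a.A := by
        rw [← closure_union]; exact closure_mono (by rw [singleton_union])
      rcases hsub hycl with h1 | h1
      · exact absurd h1 (by
          have hc : IsClosed {j 0} := isClosed_of_isCompact_of_sep h.sep isCompact_singleton
            (singleton_subset_iff.2 hxM)
          rw [hc.closure_eq]
          exact fun e => hyx (mem_singleton_iff.1 e).symm)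
      · exact h1
    obtain ⟨i, hi, rfl, ε, hε, hpi, -⟩ := sides y hyM hycl' hyA
    obtain ⟨V, hV, W, hW, hVW⟩ := Filter.disjoint_iff.1 (h.sep _ hxM _ hyx)
    obtain ⟨η, hη, hηW⟩ := mem_nhdsGT_iff_exists_Ioo_subset.1 (lim hi hW)
    have d3 := a.tail_dichotomy h hi.continuous.continuousOn (lim hi) hyA hε hpi
    -- A further limit point in `M` would have a side at an end that is already taken by a side of
    -- `j 0`. These sides meet arbitrarily close to the two limit points, which contradicts their
    -- separation.
    have fin : ∀ {k : ℝ → Y}, IsOpenEmbedding k → k 0 = j 0 → (∀ t ∈ Ioo 0 δ, k t ∈ a.A) →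
        ((a.TailTop k ∧ a.TailTop i) ∨ (a.flip.TailTop k ∧ a.flip.TailTop i)) → False := by
      intro k hk hk0 hkA hb
      obtain ⟨ξ, hξ, hξV⟩ := mem_nhdsGT_iff_exists_Ioo_subset.1 (lim hk (hk0.symm ▸ hV))
      have hη : 0 < η := hη
      have hξ : 0 < ξ := hξ
      obtain ⟨t, ht, t', ht', e⟩ := meet hk.continuous.continuousOn (lt_min hδ hξ) (lt_min hε hη)
        (fun t ht => hkA t ⟨ht.1, ht.2.trans_le (min_le_left _ _)⟩)
        (fun t ht => hpi t ⟨ht.1, ht.2.trans_le (min_le_left _ _)⟩) hb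
      have m1 : k t ∈ V := hξV ⟨ht.1, ht.2.trans_le (min_le_right _ _)⟩
      have m2 : i t' ∈ W := hηW ⟨ht'.1, ht'.2.trans_le (min_le_right _ _)⟩
      exact disjoint_left.1 hVW m1 (e ▸ m2)
    have f1 := fin hj rfl hp
    have f2 := fin hj' (by simp) hn
    rcases d3 with d3 | d3
    · rcases d1 with d1 | d1
      · exact f1 (Or.inl ⟨d1, d3⟩)
      · rcases d2 with d2 | d2
        · exact f2 (Or.inl ⟨d2, d3⟩)
        · exact noboth (Or.inr ⟨d1, d2⟩)
    · rcases d1 with d1 | d1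
      · rcases d2 with d2 | d2
        · exact noboth (Or.inl ⟨d1, d2⟩)
        · exact f2 (Or.inr ⟨d2, d3⟩)
      · exact f1 (Or.inr ⟨d1, d3⟩)
  · exact a.conn.subset_closure (subset_insert _ _) (insert_subset hxcl subset_closure)

end OArc

end Arcs

end FoliatedSurface
namespace FoliatedSurface

/-! ### Decomposition of the regular part into arcs, and the cut. -/

section ArcSystem

variable {Z Y : Type*} [TopologicalSpace Z] [TopologicalSpace Y] {p : Z → Y} {M : Set Y}

/-- This is the straightening theorem over a one-point base: the arc is a single ordered connected
fibre. -/
theorem OArc.exists_param [T2Space Z] [SecondCountableTopology Y] (h : IsLeafSpace p M)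
    (a : OArc p M) :
    ∃ g : OpenPartialHomeomorph ℝ Y, g.source = Ioo (-1) 1 ∧ g.target = a.A := by
  have hR := a.ord.restrict (B := Unit)
  have hbox : ∀ z : a.A, HasFibBox (fun _ : a.A => ()) (fun x y : a.A => a.r x y) z := by
    intro z
    obtain ⟨j₀, hj₀, hj₀z⟩ := h.arc z (a.sub z.2)
    obtain ⟨j, hj, hjz, hjA⟩ := exists_shrink hj₀ (hj₀z ▸ a.isOpen.mem_nhds z.2)
    have hmem : ∀ x, j x ∈ a.A := fun x => hjA ⟨x, rfl⟩
    have tot : ∀ s t, s ≠ t → a.r (j s) (j t) ∨ a.r (j t) (j s) := fun s t hst =>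
      a.ord.total (hmem s) (hmem t) rfl fun e => hst (hj.injective e)
    have ev : ∀ q : ℝ × ℝ, a.r (j q.1) (j q.2) → ∀ᶠ q' : ℝ × ℝ in 𝓝 q, a.r (j q'.1) (j q'.2) :=
      fun q hq => (a.ord.eventually_lt (hj.continuous.comp continuous_fst).continuousAt
        (hj.continuous.comp continuous_snd).continuousAt hq).mono fun q' hq' => hq' rfl
    have key : ∀ q ∈ {q : ℝ × ℝ | q.1 < q.2}, ∀ q' ∈ {q : ℝ × ℝ | q.1 < q.2},
        (a.r (j q.1) (j q.2) ↔ a.r (j q'.1) (j q'.2)) := by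
      intro q hq q' hq'
      refine isPreconnected_lt.induction₂ (fun q q' => (a.r (j q.1) (j q.2) ↔ a.r (j q'.1) (j q'.2)))
        (fun q hq => ?_) (fun _ _ _ _ _ _ h1 h2 => h1.trans h2) (fun _ _ _ _ h => h.symm) hq hq'
      rcases tot q.1 q.2 (ne_of_lt hq) with h | h
      · filter_upwards [nhdsWithin_le_nhds (ev q h)] with q' hq' using iff_of_true h hq'
      · have := (continuous_swap.tendsto q).eventually (ev q.swap h)
        filter_upwards [nhdsWithin_le_nhds this] with q' hq'
        exact iff_of_false (a.ord.asymm h) (a.ord.asymm hq')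
    have hz : j 0 = z := hjz.trans hj₀z
    by_cases h01 : a.r (j 0) (j 1)
    · refine ⟨univ, Filter.univ_mem, fun x _ => ⟨j x, hmem x⟩, ?_, fun _ _ _ => rfl,
        fun _ _ x x' hx => (key (0, 1) (by simp) (x, x') hx).1 h01, Subtype.ext hz⟩
      exact ((hj.continuous.comp continuous_fst).subtype_mk _).continuousOn
    · refine ⟨univ, Filter.univ_mem, fun x _ => ⟨j (-x), hmem _⟩, ?_, fun _ _ _ => rfl,
        fun _ _ x x' hx => ?_, Subtype.ext (by simpa using hz)⟩
      · exact ((hj.continuous.comp (continuous_neg.comp continuous_fst)).subtype_mk _).continuousOn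
      · exact (tot (-x) (-x') (by linarith [hx] : -x' < -x).ne').resolve_right
          fun hh => h01 ((key (-x', -x) (neg_lt_neg hx) (0, 1) (by simp)).1 hh)
  obtain ⟨f, hf, hfI, hmono, hsurj, hopen⟩ := exists_straightening continuous_const hR hbox
  have hinj : Function.Injective f := by
    intro x y e
    by_contra hne
    rcases hR.total rfl hne with h | h
    · exact (hmono _ _ h).ne e
    · exact (hmono _ _ h).ne e.symm
  have hfo : IsOpenMap f := by
    have := (isOpenMap_fst (X := ℝ) (Y := Unit)).comp hopen
    exact this
  have hemb : IsOpenEmbedding f := .of_continuous_injective_isOpenMap hf hinj hfo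
  let A : TopologicalSpace.Opens Y := ⟨a.A, a.isOpen⟩
  have hne : Nonempty A := a.nonempty.to_subtype
  have hne' : Nonempty a.A := hne
  have hrange : range f = Ioo 0 1 := by
    refine Subset.antisymm (by rintro _ ⟨z, rfl⟩; exact hfI z) ?_
    have hpre : IsPreconnected (univ : Set a.A) :=
      (isPreconnected_iff_preconnectedSpace.1 a.conn).isPreconnected_univ
    have := hsurj hne'.some (by simpa using hpre)
    exact this.trans (image_subset_range _ _)
  let F : OpenPartialHomeomorph A ℝ := IsOpenEmbedding.toOpenPartialHomeomorph f hemb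
  -- The map `x ↦ (x + 1) / 2` carries `(-1, 1)` onto `(0, 1)`.
  let H : ℝ ≃ₜ ℝ := (Homeomorph.addRight (1 : ℝ)).trans (Homeomorph.mulRight₀ (2⁻¹ : ℝ) (by norm_num))
  refine ⟨H.toOpenPartialHomeomorph.trans (F.symm.trans
    (A.openPartialHomeomorphSubtypeCoe hne)), ?_, ?_⟩
  · have : F.target = Ioo 0 1 := by
      rw [← hrange]; exact IsOpenEmbedding.toOpenPartialHomeomorph_target f hemb
    ext x
    simp only [OpenPartialHomeomorph.trans_source, OpenPartialHomeomorph.symm_source, this]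
    simp [H]
    constructor
    · rintro ⟨h1, h2⟩; constructor <;> linarith
    · rintro ⟨h1, h2⟩; constructor <;> linarith
  · have : F.source = univ := IsOpenEmbedding.toOpenPartialHomeomorph_source f hemb
    ext x
    simp only [OpenPartialHomeomorph.trans_target, OpenPartialHomeomorph.symm_target, this]
    simp [A]

/-- The part `M` of the space of leaves is a disjoint union of open sets `E k`, each of which is
an open arc up to at most one point. -/
structure ArcSystem (p : Z → Y) (M : Set Y) (K : Type*) where
  E : K → Set Y
  isOpen_E : ∀ k, IsOpen (E k)
  sub : ∀ k, E k ⊆ M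
  disj : ∀ k l, k ≠ l → Disjoint (E k) (E l)
  cover : M ⊆ ⋃ k, E k
  g : K → OpenPartialHomeomorph ℝ Y
  source : ∀ k, (g k).source = Ioo (-1) 1
  target_sub : ∀ k, (g k).target ⊆ E k
  extra : K → Y
  sub_insert : ∀ k, E k ⊆ insert (extra k) (g k).target
  R : K → Z → Z → Prop
  ord : ∀ k, FibOrderOn p (p ⁻¹' (g k).target) (R k)

/-- The sets grown from maximal arcs are connected, open, and closed in `M`, so two of them coincide
or are disjoint. Second countability leaves countably many. -/
theorem exists_arcSystem [T2Space Z] [SecondCountableTopology Y] (h : IsLeafSpace p M)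
    (c : LeafCoord p) : ∃ K : Set (Set Y), K.Countable ∧ Nonempty (ArcSystem p M K) := by
  have loc : ∀ y : M, ∃ (E : Set Y) (g : OpenPartialHomeomorph ℝ Y) (x : Y) (R : Z → Z → Prop),
      y.1 ∈ E ∧ IsOpen E ∧ E ⊆ M ∧ (∀ x ∈ M, x ∈ closure E → x ∈ E) ∧ IsPreconnected E ∧
      g.source = Ioo (-1) 1 ∧ g.target ⊆ E ∧ E ⊆ insert x g.target ∧
      FibOrderOn p (p ⁻¹' g.target) R := by
    rintro ⟨y, hy⟩
    obtain ⟨j, hj, rfl, hjM, R, hR⟩ := h.exists_goodArc c hy Filter.univ_mem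
    let a : OArc p M := ⟨range j, _, R, hj.isOpen_range, hjM.trans inter_subset_left,
      isPreconnected_range hj.continuous, ⟨j 0, 0, rfl⟩, fibOrderOn_range hj, hR⟩
    obtain ⟨m, ham, hm⟩ := a.exists_max
    obtain ⟨g, hg1, hg2⟩ := m.exists_param h
    obtain ⟨E, hE1, hE2, hE3, hE4, hE5, x, hE6⟩ := m.exists_component h c hm
    exact ⟨E, g, x, m.R, hE5 (ham.1 ⟨0, rfl⟩), hE1, hE2, hE3, hE4, hg1, hg2.trans_subset hE5,
      hg2 ▸ hE6, hg2 ▸ m.fibOrd⟩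
  choose E g x R hyE hEo hEM hEc hEp hgs hgt hgx hgR using loc
  have heq : ∀ y z, (E y ∩ E z).Nonempty → E y ⊆ E z := by
    rintro y z ⟨w, hwy, hwz⟩
    refine (hEp y).subset_left_of_subset_union (hEo z) (isClosed_closure (s := E z)).isOpen_compl
      (disjoint_compl_right_iff_subset.2 subset_closure) (fun v hv => ?_) ⟨w, hwy, hwz⟩
    by_cases hvz : v ∈ closure (E z)
    · exact Or.inl (hEc z v (hEM y hv) hvz)
    · exact Or.inr hvz
  have hsurj : ∀ k : range E, ∃ y, E y = k := fun k => k.2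
  choose y hy using hsurj
  have hdisj : ∀ k l : range E, k ≠ l → Disjoint (E (y k)) (E (y l)) := by
    intro k l hkl
    by_contra hd
    rw [not_disjoint_iff_nonempty_inter] at hd
    refine hkl (Subtype.ext ?_)
    rw [← hy k, ← hy l]
    exact Subset.antisymm (heq _ _ hd) (heq _ _ (inter_comm _ _ ▸ hd))
  refine ⟨range E, ?_, ⟨{
    E := fun k => E (y k)
    isOpen_E := fun k => hEo _
    sub := fun k => hEM _
    disj := hdisj
    cover := fun z hz => mem_iUnion.2 ⟨⟨E ⟨z, hz⟩, _, rfl⟩, by rw [hy]; exact hyE ⟨z, hz⟩⟩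
    g := fun k => g (y k)
    source := fun k => hgs _
    target_sub := fun k => hgt _
    extra := fun k => x (y k)
    sub_insert := fun k => hgx _
    R := fun k => R (y k)
    ord := fun k => hgR _ }⟩⟩
  have hpd : (univ : Set (range E)).PairwiseDisjoint fun k => E (y k) :=
    fun k _ l _ hkl => hdisj k l hkl
  have := hpd.countable_of_isOpen (fun k _ => hEo _) fun k _ => ⟨_, hyE (y k)⟩
  exact countable_coe_iff.1 (countable_univ_iff.1 this)

/-- A set of leaves that is closed and discrete. -/
def IsThin (C : Set Y) : Prop := ∀ y, ∀ᶠ y' in 𝓝 y, y' ∈ C → y' = y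

namespace ArcSystem

variable {K : Type*} (S : ArcSystem p M K)

/-- The cut: the complement of `M`, the exceptional points, and the middle of each arc. -/
def cut : Set Y := {y | y ∉ M ∨ ∃ k, y ∈ S.E k ∧ (y ∉ (S.g k).target ∨ y = S.g k 0)}

theorem preconnected_subset {ι : Type*} {V : ι → Set Y} (hV : ∀ i, IsOpen (V i))
    (hd : ∀ i j, i ≠ j → Disjoint (V i) (V j)) {s : Set Y} (hs : IsPreconnected s)
    (hne : s.Nonempty) (hsub : s ⊆ ⋃ i, V i) : ∃ i, s ⊆ V i := by
  obtain ⟨x, hx⟩ := hne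
  obtain ⟨i, hi⟩ := mem_iUnion.1 (hsub hx)
  refine ⟨i, hs.subset_left_of_subset_union (hV i) (isOpen_iUnion fun j : {j // j ≠ i} => hV j)
    (disjoint_iUnion_right.2 fun j => hd _ _ j.2.symm) (fun y hy => ?_) ⟨x, hx, hi⟩⟩
  obtain ⟨j, hj⟩ := mem_iUnion.1 (hsub hy)
  by_cases hji : j = i
  · exact Or.inl (hji ▸ hj)
  · exact Or.inr (mem_iUnion.2 ⟨⟨j, hji⟩, hj⟩)

/-- A path that ends at a point runs, near its end, in one member of a disjoint open cover of
the complement of a thin set. -/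
theorem path_subset {C : Set Y} (hC : IsThin C) {ι : Type*} {V : ι → Set Y}
    (hV : ∀ i, IsOpen (V i)) (hd : ∀ i j, i ≠ j → Disjoint (V i) (V j)) (hcov : Cᶜ ⊆ ⋃ i, V i)
    {d : ℝ → Y} {y : Y} (hdc : ContinuousOn d (Ioi 0)) (hlim : Filter.Tendsto d (𝓝[>] 0) (𝓝 y))
    (hne : ∀ t > 0, d t ≠ y) : ∃ δ > 0, ∃ i, d '' Ioo 0 δ ⊆ V i := by
  obtain ⟨δ, hδ, h⟩ := mem_nhdsGT_iff_exists_Ioo_subset.1 (hlim.eventually (hC y))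
  have hδ : 0 < δ := hδ
  refine ⟨δ, hδ, preconnected_subset hV hd
    (isPreconnected_Ioo.image d (hdc.mono fun t ht => ht.1))
    ⟨d (δ / 2), δ / 2, ⟨by linarith, by linarith⟩, rfl⟩ ?_⟩
  rintro _ ⟨t, ht, rfl⟩
  exact hcov fun hmem => hne t ht.1 (h ht hmem)

theorem cut_inter_E_finite (k : K) : (S.cut ∩ S.E k).Finite := by
  refine (Set.toFinite {S.extra k, S.g k 0}).subset ?_
  rintro y ⟨hM | ⟨l, hl, hy⟩, hk⟩
  · exact absurd (S.sub k hk) hM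
  · obtain rfl : l = k := by
      by_contra hne
      exact disjoint_left.1 (S.disj _ _ hne) hl hk
    rcases hy with hy | hy
    · exact Or.inl ((S.sub_insert _ hk).resolve_right hy)
    · exact Or.inr hy

/-- Near a point outside `M` each of its finitely many sides runs in a single set `E k`, and each of
these contains at most two points of the cut. -/
theorem isThin_cut [T1Space Y] (hM : IsThin Mᶜ)
    (hs : ∀ y ∉ M, ∃ (ι : Type) (_ : Finite ι) (c : ι → ℝ → Y), Sides c y) : IsThin S.cut := by
  have fin : ∀ {F : Set Y} (y : Y), F.Finite → ∀ᶠ y' in 𝓝 y, y' ∈ F → y' = y := by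
    intro F y hF
    have : (F \ {y})ᶜ ∈ 𝓝 y := (hF.subset sdiff_subset).isClosed.isOpen_compl.mem_nhds (by simp)
    filter_upwards [this] with y' hy' h
    by_contra hne
    exact hy' ⟨h, hne⟩
  intro y
  by_cases hy : y ∈ M
  · obtain ⟨k, hk⟩ := mem_iUnion.1 (S.cover hy)
    filter_upwards [fin y (S.cut_inter_E_finite k), (S.isOpen_E k).mem_nhds hk] with y' h1 h2 h3
    exact h1 ⟨h3, h2⟩
  · obtain ⟨ι, _, c, hc⟩ := hs y hy
    have hp : ∀ i, ∃ δ > 0, ∃ k, c i '' Ioo 0 δ ⊆ S.E k := fun i =>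
      path_subset hM S.isOpen_E S.disj (by rw [compl_compl]; exact S.cover) (hc.cont i) (hc.lim i)
        (hc.ne i)
    choose δ hδ k hk using hp
    have hne : ∃ ε > 0, ∀ i, ε ≤ δ i := by
      cases isEmpty_or_nonempty ι
      · exact ⟨1, one_pos, fun i => isEmptyElim i⟩
      · obtain ⟨i, hi⟩ := Finite.exists_min δ
        exact ⟨δ i, hδ i, hi⟩
    obtain ⟨ε, hε, hεδ⟩ := hne
    filter_upwards [hc.nhds ε hε,
      fin y (Set.finite_iUnion fun i => S.cut_inter_E_finite (k i))] with y' h1 h2 h3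
    rcases h1 with h1 | h1
    · exact h1
    · obtain ⟨i, t, ht, rfl⟩ := mem_iUnion.1 h1
      exact h2 (mem_iUnion.2 ⟨i, h3, hk i ⟨t, ⟨ht.1, ht.2.trans_le (hεδ i)⟩, rfl⟩⟩)

/-- The parametrisation of an arc, possibly reversed. -/
noncomputable def half (l : K × Bool) : OpenPartialHomeomorph ℝ Y :=
  if l.2 then S.g l.1 else (Homeomorph.neg ℝ).toOpenPartialHomeomorph.trans (S.g l.1)

theorem half_source (l : K × Bool) : (S.half l).source = Ioo (-1) 1 := by
  obtain ⟨k, _ | _⟩ := l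
  · ext x
    simp [half, S.source, and_comm, neg_lt]
  · simp [half, S.source]

theorem half_target (l : K × Bool) : (S.half l).target = (S.g l.1).target := by
  obtain ⟨k, _ | _⟩ := l <;> simp [half]

theorem half_true (k : K) (x : ℝ) : S.half (k, true) x = S.g k x := by simp [half]

theorem half_false (k : K) (x : ℝ) : S.half (k, false) x = S.g k (-x) := by simp [half]

/-- The half-arcs. -/
def B (l : K × Bool) : Set Y := S.half l '' Ioo 0 1

theorem half_zero (l : K × Bool) : S.half l 0 = S.g l.1 0 := by
  obtain ⟨k, _ | _⟩ := l <;> simp [half]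

theorem Ioo_subset_source (l : K × Bool) : Ioo (0 : ℝ) 1 ⊆ (S.half l).source := by
  rw [half_source]
  exact Ioo_subset_Ioo_left (by norm_num)

theorem isOpen_B (l : K × Bool) : IsOpen (S.B l) :=
  (S.half l).isOpen_image_of_subset_source isOpen_Ioo (S.Ioo_subset_source l)

theorem B_sub_target (l : K × Bool) : S.B l ⊆ (S.g l.1).target := by
  rw [← S.half_target l]
  rintro _ ⟨x, hx, rfl⟩
  exact (S.half l).map_source (S.Ioo_subset_source l hx)

theorem disj_B (l m : K × Bool) (h : l ≠ m) : Disjoint (S.B l) (S.B m) := by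
  rw [disjoint_left]
  intro y hl hm
  by_cases hk : l.1 = m.1
  · have inj : ∀ x ∈ Ioo (-1 : ℝ) 1, ∀ x' ∈ Ioo (-1 : ℝ) 1, S.g l.1 x = S.g l.1 x' → x = x' := by
      rw [← S.source l.1]
      exact fun x hx x' hx' e => (S.g l.1).injOn hx hx' e
    obtain ⟨k, b⟩ := l
    obtain ⟨k', b'⟩ := m
    obtain rfl : k = k' := hk
    obtain ⟨x, hx, rfl⟩ := hl
    obtain ⟨x', hx', e⟩ := hm
    have hx1 := hx.1
    have hx2 := hx.2
    have hx1' := hx'.1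
    have hx2' := hx'.2
    cases b <;> cases b' <;> simp only [half_true, half_false] at e
    · exact h rfl
    · have := inj _ ⟨by linarith, by linarith⟩ _ ⟨by linarith, by linarith⟩ e
      linarith
    · have := inj _ ⟨by linarith, by linarith⟩ _ ⟨by linarith, by linarith⟩ e
      linarith
    · exact h rfl
  · exact disjoint_left.1 (S.disj _ _ hk) (S.target_sub _ (S.B_sub_target l hl))
      (S.target_sub _ (S.B_sub_target m hm))

theorem cut_compl : S.cutᶜ = ⋃ l, S.B l := by
  ext y
  constructor
  · intro hy
    have hyM : y ∈ M := by by_contra h; exact hy (Or.inl h)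
    obtain ⟨k, hk⟩ := mem_iUnion.1 (S.cover hyM)
    have hyt : y ∈ (S.g k).target := by by_contra h; exact hy (Or.inr ⟨k, hk, Or.inl h⟩)
    have hxs := (S.g k).map_target hyt
    have e := (S.g k).right_inv hyt
    rw [S.source] at hxs
    rcases lt_trichotomy ((S.g k).symm y) 0 with h | h | h
    · refine mem_iUnion.2 ⟨(k, false), -((S.g k).symm y), ⟨by linarith, by linarith [hxs.1]⟩, ?_⟩
      rw [half_false, neg_neg, e]
    · exact absurd (Or.inr ⟨k, hk, Or.inr (by rw [← h, e])⟩) hy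
    · exact mem_iUnion.2 ⟨(k, true), (S.g k).symm y, ⟨h, hxs.2⟩, by rw [half_true, e]⟩
  · intro hy
    obtain ⟨⟨k, b⟩, hl⟩ := mem_iUnion.1 hy
    have hyt := S.B_sub_target _ hl
    rintro (hM | ⟨k', hk', h⟩)
    · exact hM (S.sub k (S.target_sub k hyt))
    · obtain rfl : k' = k := by
        by_contra hne
        exact disjoint_left.1 (S.disj _ _ hne) hk' (S.target_sub k hyt)
      rcases h with h | rfl
      · exact h hyt
      · obtain ⟨x, hx, e⟩ := hl
        rw [← S.half_zero (k', b)] at e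
        have h0 : (0 : ℝ) ∈ (S.half (k', b)).source := by
          rw [half_source]; constructor <;> norm_num
        have := (S.half (k', b)).injOn (S.Ioo_subset_source _ hx) h0 e
        exact hx.1.ne' this

end ArcSystem

end ArcSystem

end FoliatedSurface
namespace FoliatedSurface

/-! ### Limit leaves of a half-arc, and the order on them. -/

section HalfArc

variable {Z Y : Type*} [TopologicalSpace Z] [TopologicalSpace Y] {p : Z → Y}

/-- The arc `a` carries an order `R` of the fibres, and at each limit point outside the arc
its open half `a '' Ioo 0 1` contains the end of a path to this point. -/
structure HalfArc (p : Z → Y) (a : OpenPartialHomeomorph ℝ Y) (R : Z → Z → Prop) : Prop where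
  source : a.source = Ioo (-1) 1
  sep : ∀ y ∈ a.target, ∀ y', y ≠ y' → Disjoint (𝓝 y) (𝓝 y')
  ord : FibOrderOn p (p ⁻¹' a.target) R
  tail : ∀ y ∈ closure (a '' Ioo 0 1), y ∉ a.target → ∃ d : ℝ → Y, ContinuousOn d (Ioi 0) ∧
    Filter.Tendsto d (𝓝[>] 0) (𝓝 y) ∧ ∃ δ > 0, d '' Ioo 0 δ ⊆ a '' Ioo 0 1

open Classical in
/-- The parameter of a point in the closure of a half-arc. -/
noncomputable def height (a : OpenPartialHomeomorph ℝ Y) (y : Y) : ℝ :=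
  if y ∈ a.target then a.symm y else 1

theorem height_of_mem {a : OpenPartialHomeomorph ℝ Y} {y : Y} (h : y ∈ a.target) :
    height a y = a.symm y := if_pos h

theorem height_of_notMem {a : OpenPartialHomeomorph ℝ Y} {y : Y} (h : y ∉ a.target) :
    height a y = 1 := if_neg h

namespace HalfArc

variable {a : OpenPartialHomeomorph ℝ Y} {R : Z → Z → Prop}

theorem Ioo_source (h : HalfArc p a R) : Ioo (0 : ℝ) 1 ⊆ a.source := by
  rw [h.source]; exact Ioo_subset_Ioo_left (by norm_num)

theorem Ico_source (h : HalfArc p a R) : Ico (0 : ℝ) 1 ⊆ a.source := by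
  rw [h.source]; exact fun x hx => ⟨by linarith [hx.1], hx.2⟩

theorem height_apply (h : HalfArc p a R) {s : ℝ} (hs : s ∈ Ico (0 : ℝ) 1) : height a (a s) = s := by
  rw [height_of_mem (a.map_source (h.Ico_source hs)), a.left_inv (h.Ico_source hs)]

/-- The other half of the arc is open and disjoint from this one, so negative parameters do not
occur. The half-arc thus has the lower end `a 0`, and every limit outside the arc belongs to the
upper end. This is why arcs are cut in the middle. -/
theorem closure_inter (h : HalfArc p a R) {y : Y} (hy : y ∈ closure (a '' Ioo 0 1))
    (hyt : y ∈ a.target) : height a y ∈ Ico (0 : ℝ) 1 ∧ a (height a y) = y := by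
  rw [height_of_mem hyt]
  refine ⟨?_, a.right_inv hyt⟩
  have hs := a.map_target hyt
  rw [h.source] at hs
  refine ⟨?_, hs.2⟩
  by_contra! hneg
  have hsub : Ioo (-1 : ℝ) 0 ⊆ a.source := by
    rw [h.source]; exact Ioo_subset_Ioo_right (by norm_num)
  have hop : IsOpen (a '' Ioo (-1) 0) := a.isOpen_image_of_subset_source isOpen_Ioo hsub
  obtain ⟨w, ⟨x, hx, rfl⟩, x', hx', e⟩ :=
    mem_closure_iff.1 hy _ hop ⟨_, ⟨hs.1, hneg⟩, a.right_inv hyt⟩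
  have := a.injOn (h.Ioo_source hx') (hsub hx) e
  linarith [hx.2, hx'.1]

theorem height_mem (h : HalfArc p a R) {y : Y} (hy : y ∈ closure (a '' Ioo 0 1)) :
    height a y ∈ Icc (0 : ℝ) 1 := by
  by_cases hyt : y ∈ a.target
  · exact Ico_subset_Icc_self (h.closure_inter hy hyt).1
  · rw [height_of_notMem hyt]; simp

theorem height_of_mem_half (h : HalfArc p a R) {y : Y} (hy : y ∈ a '' Ioo 0 1) :
    height a y ∈ Ioo (0 : ℝ) 1 ∧ a (height a y) = y := by
  obtain ⟨s, hs, rfl⟩ := hy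
  rw [h.height_apply (Ioo_subset_Ico_self hs)]
  exact ⟨hs, rfl⟩

theorem mem_half_iff (h : HalfArc p a R) {y : Y} (hy : y ∈ closure (a '' Ioo 0 1)) :
    y ∈ a '' Ioo 0 1 ↔ height a y ∈ Ioo (0 : ℝ) 1 := by
  refine ⟨fun hy' => (h.height_of_mem_half hy').1, fun hh => ?_⟩
  by_cases hyt : y ∈ a.target
  · exact ⟨_, hh, (h.closure_inter hy hyt).2⟩
  · rw [height_of_notMem hyt] at hh
    exact absurd hh.2 (lt_irrefl _)

/-- A compact piece of the arc is closed in the whole space of leaves, so its complement is a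
neighbourhood of `y`. -/
theorem eventually_lt_height (h : HalfArc p a R) {y : Y} (hyt : y ∉ a.target) {s : ℝ}
    (hs : s < 1) : ∀ᶠ y' in 𝓝 y, y' ∈ closure (a '' Ioo 0 1) → s < height a y' := by
  have hsub : Icc 0 (max s 0) ⊆ a.source := fun x hx =>
    h.Ico_source ⟨hx.1, hx.2.trans_lt (max_lt hs one_pos)⟩
  have hK : IsCompact (a '' Icc 0 (max s 0)) :=
    isCompact_Icc.image_of_continuousOn (a.continuousOn.mono hsub)
  have hKt : a '' Icc 0 (max s 0) ⊆ a.target := by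
    rintro _ ⟨x, hx, rfl⟩
    exact a.map_source (hsub hx)
  have hcl : IsClosed (a '' Icc 0 (max s 0)) := isClosed_of_isCompact_of_sep h.sep hK hKt
  filter_upwards [hcl.isOpen_compl.mem_nhds fun hmem => hyt (hKt hmem)] with y' hy' hcy
  by_cases hyt' : y' ∈ a.target
  · obtain ⟨h1, h2⟩ := h.closure_inter hcy hyt'
    by_contra! hle
    exact hy' ⟨_, ⟨h1.1, hle.trans (le_max_left _ _)⟩, h2⟩
  · rwa [height_of_notMem hyt']

theorem continuousOn_height (h : HalfArc p a R) :
    ContinuousOn (height a) (closure (a '' Ioo 0 1)) := by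
  intro y hy
  by_cases hyt : y ∈ a.target
  · refine ContinuousAt.continuousWithinAt ?_
    refine (a.continuousAt_symm hyt).congr ?_
    filter_upwards [a.open_target.mem_nhds hyt] with y' hy' using (height_of_mem hy').symm
  · unfold ContinuousWithinAt
    rw [height_of_notMem hyt]
    refine tendsto_order.2 ⟨fun s hs => ?_, fun s hs => ?_⟩
    · filter_upwards [nhdsWithin_le_nhds (h.eventually_lt_height hyt hs), self_mem_nhdsWithin] with
        y' h1 h2 using h1 h2
    · filter_upwards [self_mem_nhdsWithin] with y' h2 using (h.height_mem h2).2.trans_lt hs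

/-- A path in a half-arc that ends at a limit point outside the arc covers the end of the arc. -/
theorem exists_tail (h : HalfArc p a R) {y : Y} (hyt : y ∉ a.target) {d : ℝ → Y}
    (hd : ContinuousOn d (Ioi 0)) (hlim : Filter.Tendsto d (𝓝[>] 0) (𝓝 y)) {ε : ℝ} (hε : 0 < ε)
    (hdB : d '' Ioo 0 ε ⊆ a '' Ioo 0 1) : ∃ s₀ < 1, a '' Ioo s₀ 1 ⊆ d '' Ioo 0 ε := by
  have hB : ∀ t ∈ Ioo 0 ε, d t ∈ a '' Ioo 0 1 := fun t ht => hdB ⟨t, ht, rfl⟩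
  have hS : IsPreconnected ((fun t => height a (d t)) '' Ioo 0 ε) :=
    isPreconnected_Ioo.image _ (h.continuousOn_height.comp (hd.mono fun t ht => ht.1)
      fun t ht => subset_closure (hB t ht))
  have hgt : ∀ s < 1, ∃ t ∈ Ioo 0 ε, s < height a (d t) := by
    intro s hs
    have h1 := hlim.eventually (h.eventually_lt_height hyt hs)
    obtain ⟨t, ht1, ht2⟩ := (h1.and (Ioo_mem_nhdsGT hε)).exists
    exact ⟨t, ht2, ht1 (subset_closure (hB t ht2))⟩
  have h0 : ε / 2 ∈ Ioo 0 ε := ⟨by linarith, by linarith⟩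
  refine ⟨height a (d (ε / 2)), (h.height_of_mem_half (hB _ h0)).1.2, ?_⟩
  rintro _ ⟨s, hs, rfl⟩
  obtain ⟨t, ht, hst⟩ := hgt s hs.2
  obtain ⟨t', ht', rfl⟩ := hS.ordConnected.out ⟨_, h0, rfl⟩ ⟨t, ht, rfl⟩ ⟨hs.1.le, hst.le⟩
  exact ⟨t', ht', (h.height_of_mem_half (hB t' ht')).2.symm⟩

/-- Limits are not unique: the half-arc converges to every limit point outside the arc, since a path
to that point covers the end of the half-arc. -/
theorem tendsto_one (h : HalfArc p a R) {y : Y} (hy : y ∈ closure (a '' Ioo 0 1))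
    (hyt : y ∉ a.target) : Filter.Tendsto a (𝓝[<] 1) (𝓝 y) := by
  obtain ⟨d, hd, hlim, δ, hδ, hdB⟩ := h.tail y hy hyt
  intro V hV
  obtain ⟨δ₁, hδ₁, hV₁⟩ := mem_nhdsGT_iff_exists_Ioo_subset.1 (hlim hV)
  have hδ₁ : 0 < δ₁ := hδ₁
  obtain ⟨s₀, hs₀, hsub⟩ := h.exists_tail hyt hd hlim (lt_min hδ hδ₁)
    ((image_mono (Ioo_subset_Ioo_right (min_le_left _ _))).trans hdB)
  rw [Filter.mem_map]
  refine Filter.mem_of_superset (Ioo_mem_nhdsLT hs₀) fun s hs => ?_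
  obtain ⟨t, ht, e⟩ := hsub ⟨s, hs, rfl⟩
  rw [mem_preimage, ← e]
  exact hV₁ ⟨ht.1, ht.2.trans_le (min_le_right _ _)⟩

theorem tendsto_height (h : HalfArc p a R) {y : Y} (hy : y ∈ closure (a '' Ioo 0 1)) :
    Filter.Tendsto a (𝓝[Ioo 0 1] (height a y)) (𝓝 y) := by
  by_cases hyt : y ∈ a.target
  · obtain ⟨h1, h2⟩ := h.closure_inter hy hyt
    have := (a.continuousAt (h.Ico_source h1)).tendsto
    rw [h2] at this
    exact this.mono_left nhdsWithin_le_nhds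
  · rw [height_of_notMem hyt]
    exact (h.tendsto_one hy hyt).mono_left (nhdsWithin_mono _ fun x hx => hx.2)

theorem nhdsWithin_neBot (h : HalfArc p a R) {y : Y} (hy : y ∈ closure (a '' Ioo 0 1)) :
    (𝓝[Ioo 0 1] (height a y)).NeBot := by
  rw [← mem_closure_iff_nhdsWithin_neBot, closure_Ioo zero_ne_one]
  exact h.height_mem hy

theorem tendsto_height_comp (h : HalfArc p a R) (hp : Continuous p) {x : Z}
    (hx : p x ∈ closure (a '' Ioo 0 1)) : Filter.Tendsto (fun w => height a (p w))
      (𝓝 x ⊓ Filter.principal (p ⁻¹' (a '' Ioo 0 1))) (𝓝[Ioo 0 1] (height a (p x))) := by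
  refine tendsto_nhdsWithin_of_tendsto_nhds_of_eventually_within _ ?_ ?_
  · have h1 := (h.continuousOn_height _ hx).tendsto
    refine h1.comp (Filter.Tendsto.inf hp.continuousAt ?_)
    exact Filter.tendsto_principal_principal.2 fun w hw => subset_closure hw
  · exact Filter.mem_inf_of_right fun w hw => (h.height_of_mem_half hw).1

/-- The extension of the order to the fibres over the closure of the half-arc. -/
def rel (_ : HalfArc p a R) (x x' : Z) : Prop :=
  height a (p x) = height a (p x') ∧
    ∀ᶠ q : Z × Z in 𝓝 (x, x'), p q.1 ∈ a '' Ioo 0 1 → p q.1 = p q.2 → R q.1 q.2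

theorem eventually_mem_image (h : HalfArc p a R) (hop : IsOpenMap p) {x : Z}
    (hx : p x ∈ closure (a '' Ioo 0 1)) {O : Set Z} (hO : O ∈ 𝓝 x) :
    ∀ᶠ s in 𝓝[Ioo 0 1] (height a (p x)), ∃ w ∈ O, p w = a s :=
  (h.tendsto_height hx).eventually (hop.image_mem_nhds hO)

theorem not_rel_self (h : HalfArc p a R) (hop : IsOpenMap p) {x : Z}
    (hx : p x ∈ closure (a '' Ioo 0 1)) : ¬ h.rel x x := by
  rintro ⟨-, hr⟩
  rw [nhds_prod_eq, Filter.eventually_prod_iff] at hr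
  obtain ⟨pa, hpa, pb, hpb, hab⟩ := hr
  have := h.nhdsWithin_neBot hx
  obtain ⟨s, ⟨w, hw, e⟩, hs⟩ :=
    ((h.eventually_mem_image hop hx (hpa.and hpb)).and self_mem_nhdsWithin).exists
  exact h.ord.irrefl w (hab hw.1 hw.2 ⟨s, hs, e.symm⟩ rfl)

/-- Since `p` is open, a fibre of the half-arc that passes near `x` and `z` also passes near `y`,
and there the order `R` is transitive. -/
theorem rel_trans (h : HalfArc p a R) (hp : Continuous p) (hop : IsOpenMap p) {x y z : Z}
    (hx : p x ∈ closure (a '' Ioo 0 1)) (hy : p y ∈ closure (a '' Ioo 0 1))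
    (hxy : h.rel x y) (hyz : h.rel y z) : h.rel x z := by
  refine ⟨hxy.1.trans hyz.1, ?_⟩
  have h1 := hxy.2
  have h2 := hyz.2
  rw [nhds_prod_eq, Filter.eventually_prod_iff] at h1 h2
  obtain ⟨pa, hpa, pb, hpb, hab⟩ := h1
  obtain ⟨pc, hpc, pd, hpd, hcd⟩ := h2
  have h3 := h.eventually_mem_image hop hy (hpb.and hpc)
  rw [← hxy.1] at h3
  have h4 := (h.tendsto_height_comp hp hx).eventually h3
  rw [Filter.eventually_inf_principal] at h4
  filter_upwards [continuousAt_fst.eventually h4, continuousAt_fst.eventually hpa,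
    continuousAt_snd.eventually hpd] with q hq hqa hqd hqB e
  obtain ⟨v, hv, ev⟩ := hq hqB
  rw [(h.height_of_mem_half hqB).2] at ev
  have h5 : R q.1 v := hab hqa hv.1 hqB ev.symm
  have h6 : R v q.2 := hcd hv.2 hqd (show p v ∈ _ by rw [ev]; exact hqB) (ev.trans e)
  exact h.ord.trans h5 h6

/-- The points `x` and `x'` may lie on different limit leaves at height 1. Sections through them,
over the part of the half-arc near this height, stay in disjoint neighbourhoods and therefore orient
the fibres there. -/
theorem rel_total [T2Space Z] (h : HalfArc p a R) (hp : Continuous p) (hop : IsOpenMap p)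
    (c : LeafCoord p) (hbox : ∀ z, HasBox p z) {x x' : Z} (hx : p x ∈ closure (a '' Ioo 0 1))
    (hx' : p x' ∈ closure (a '' Ioo 0 1)) (ht : height a (p x) = height a (p x')) (hne : x ≠ x') :
    h.rel x x' ∨ h.rel x' x := by
  obtain ⟨O, hO, O', hO', hOO⟩ := c.exists_const_sign (hbox x) (hbox x') hne
  obtain ⟨V', hV', V, hV, hVV⟩ := c.exists_const_sign (hbox x') (hbox x) hne.symm
  obtain ⟨U, U', hU, hU', hxU, hxU', hd⟩ := t2_separation hne
  obtain ⟨Q, hQ, κ, hκ, hpκ, -, hκ0, -⟩ := hbox x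
  obtain ⟨Q', hQ', κ', hκ', hpκ', -, hκ0', -⟩ := hbox x'
  have sect : ∀ {x : Z} {Q : Set Y} {κ : ℝ → Y → Z} {W : Set Z}, Q ∈ 𝓝 (p x) →
      ContinuousOn (fun q : ℝ × Y => κ q.1 q.2) (univ ×ˢ Q) → κ 0 (p x) = x → W ∈ 𝓝 x →
      ∀ᶠ y in 𝓝 (p x), y ∈ Q ∧ κ 0 y ∈ W := by
    intro x Q κ W hQ hκ h0 hW
    have h2 : ContinuousAt (fun q : ℝ × Y => κ q.1 q.2) (0, p x) :=
      hκ.continuousAt (prod_mem_nhds Filter.univ_mem hQ)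
    have h3 : ContinuousAt (fun y => κ 0 y) (p x) :=
      ContinuousAt.comp (f := fun y : Y => ((0 : ℝ), y)) h2 (by fun_prop)
    exact Filter.Eventually.and hQ (h3.eventually (show W ∈ 𝓝 (κ 0 (p x)) by rwa [h0]))
  have s1 := (h.tendsto_height hx).eventually (sect hQ hκ hκ0
    (Filter.inter_mem (Filter.inter_mem hO hV) (hU.mem_nhds hxU)))
  have s2 := (h.tendsto_height hx').eventually (sect hQ' hκ' hκ0'
    (Filter.inter_mem (Filter.inter_mem hO' hV') (hU'.mem_nhds hxU')))
  rw [← ht] at s2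
  obtain ⟨ε, hε, hball⟩ := Metric.mem_nhdsWithin_iff.1 (s1.and s2)
  rw [Real.ball_eq_Ioo] at hball
  set J := Ioo (height a (p x) - ε) (height a (p x) + ε) ∩ Ioo 0 1 with hJ
  have hJs : J ⊆ a.source := fun s hs => h.Ioo_source hs.2
  have hAo : IsOpen (a '' J) := a.isOpen_image_of_subset_source (isOpen_Ioo.inter isOpen_Ioo) hJs
  have hAc : IsPreconnected (a '' J) :=
    (ordConnected_Ioo.inter ordConnected_Ioo).isPreconnected.image _ (a.continuousOn.mono hJs)
  have hAt : a '' J ⊆ a.target := by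
    rintro _ ⟨s, hs, rfl⟩; exact a.map_source (hJs hs)
  have hA : ∀ y ∈ a '' J, (y ∈ Q ∧ κ 0 y ∈ O ∩ V ∩ U) ∧ (y ∈ Q' ∧ κ' 0 y ∈ O' ∩ V' ∩ U') := by
    rintro _ ⟨s, hs, rfl⟩; exact hball hs
  have cont : ∀ {Q : Set Y} {κ : ℝ → Y → Z},
      ContinuousOn (fun q : ℝ × Y => κ q.1 q.2) (univ ×ˢ Q) → ContinuousOn (fun y => κ 0 y) Q :=
    fun {Q κ} hκ => hκ.comp (f := fun y : Y => ((0 : ℝ), y)) (by fun_prop)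
      fun y hy => ⟨mem_univ _, hy⟩
  have hb₀ : ∀ y ∈ a '' J, p (κ 0 y) = y := fun y hy => hpκ 0 y (hA y hy).1.1
  have hb₁ : ∀ y ∈ a '' J, p (κ' 0 y) = y := fun y hy => hpκ' 0 y (hA y hy).2.1
  have hord := c.fibOrderOn_order hp hop hAo (fun z _ => hbox z)
    ((cont hκ).mono fun y hy => (hA y hy).1.1) ((cont hκ').mono fun y hy => (hA y hy).2.1)
    hb₀ hb₁
    (fun y hy e => disjoint_left.1 hd (hA y hy).1.2.2 (e ▸ (hA y hy).2.2.2))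
  have near : ∀ᶠ q : Z × Z in 𝓝 (x, x'), p q.1 ∈ a '' Ioo 0 1 → p q.1 = p q.2 →
      p q.1 ∈ a '' J ∧ c.order (a '' J) (fun y => κ 0 y) (fun y => κ' 0 y) q.1 q.2 := by
    have h4 := (h.tendsto_height_comp hp hx).eventually (nhdsWithin_le_nhds
      (Ioo_mem_nhds (sub_lt_self _ hε) (lt_add_of_pos_right _ hε)))
    rw [Filter.eventually_inf_principal] at h4
    filter_upwards [continuousAt_fst.eventually h4,
      continuousAt_fst.eventually (Filter.inter_mem hO hV),
      continuousAt_snd.eventually (Filter.inter_mem hO' hV')] with q hq hqO hqO' hqB e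
    have hqJ : p q.1 ∈ a '' J := ⟨height a (p q.1), ⟨hq hqB, (h.height_of_mem_half hqB).1⟩,
      (h.height_of_mem_half hqB).2⟩
    refine ⟨hqJ, e, hqJ, ?_⟩
    have e0 := hb₀ _ hqJ
    have e1 := hb₁ _ hqJ
    obtain ⟨⟨-, ⟨m0, m0'⟩, m0''⟩, -, ⟨m1, m1'⟩, m1''⟩ := hA _ hqJ
    have hb : c.e (κ' 0 (p q.1)) - c.e (κ 0 (p q.1)) ≠ 0 := fun h0 =>
      disjoint_left.1 hd m0'' (c.injOn (e1.trans e0.symm) (sub_eq_zero.1 h0) ▸ m1'')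
    rcases lt_or_gt_of_ne hb with hb | hb
    · refine mul_pos_of_neg_of_neg (sub_neg.2 ?_) hb
      exact hVV _ m1' _ hqO'.2 _ m0' _ hqO.2 (e1.trans e0.symm) (e.symm.trans e1.symm) e1.symm
        (sub_neg.1 hb)
    · refine mul_pos (sub_pos.2 ?_) hb
      exact hOO _ m0 _ hqO.1 _ m1 _ hqO'.1 (e0.trans e1.symm) e0.symm (e.symm.trans e0.symm)
        (sub_pos.1 hb)
  -- Over the connected piece of arc, the orientation from `x` to `x'` agrees with `R` or is
  -- opposite to it, and this decides which of the two points comes first.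
  rcases c.agree_or_opposite hop h.ord hord hAc hAt subset_rfl with hag | hag
  · refine Or.inl ⟨ht, ?_⟩
    filter_upwards [near] with q hq hqB e
    exact (hag _ _ (hq hqB e).1 e).2 (hq hqB e).2
  · refine Or.inr ⟨ht.symm, ?_⟩
    have := (continuous_swap.tendsto (x', x)).eventually near
    filter_upwards [this] with q hq hqB e
    have hq' := hq (show p q.2 ∈ _ from e ▸ hqB) e.symm
    exact (hag _ _ (e ▸ hq'.1) e).2 hq'.2

/-- The part of the surface over the closure of a half-arc is fibred over `[0, 1]`. -/
noncomputable def level (h : HalfArc p a R) (z : p ⁻¹' closure (a '' Ioo 0 1)) : Icc (0 : ℝ) 1 :=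
  ⟨height a (p z), h.height_mem z.2⟩

theorem continuous_level (h : HalfArc p a R) (hp : Continuous p) : Continuous h.level := by
  refine Continuous.subtype_mk ?_ _
  exact h.continuousOn_height.comp_continuous (hp.comp continuous_subtype_val) fun z => z.2

theorem fibOrder [T2Space Z] (h : HalfArc p a R) (hp : Continuous p) (hop : IsOpenMap p)
    (c : LeafCoord p) (hbox : ∀ z, HasBox p z) :
    FibOrder h.level (fun x x' => h.rel x x') where
  fib hR := Subtype.ext hR.1
  total {x y} ht hne := h.rel_total hp hop c hbox x.2 y.2 (congrArg Subtype.val ht)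
    fun e => hne (Subtype.ext e)
  irrefl x := h.not_rel_self hop x.2
  trans {x y z} h1 h2 := h.rel_trans hp hop x.2 y.2 h1 h2
  isOpen {x y} hR := by
    have h1 := eventually_eventually_nhds.2 hR.2
    have h2 : ContinuousAt (fun q : (p ⁻¹' closure (a '' Ioo 0 1)) × (p ⁻¹' closure (a '' Ioo 0 1)) =>
      ((q.1 : Z), (q.2 : Z))) (x, y) := by fun_prop
    filter_upwards [h2.eventually h1] with q hq e
    exact ⟨congrArg Subtype.val e, hq⟩

end HalfArc

end HalfArc

end FoliatedSurface
namespace FoliatedSurface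

/-! ### The strip over the closure of a half-arc. -/

section HalfArcStrip

variable {Z Y : Type*} [TopologicalSpace Z] [TopologicalSpace Y] {p : Z → Y}
  {a : OpenPartialHomeomorph ℝ Y} {R : Z → Z → Prop}

namespace HalfArc

-- The map `σ` is a local section of the height that passes through `p z`: it follows the arc and
-- takes the value `p z` at height 1. It is continuous since the arc converges to each of its limit
-- points. Composing the box at `z` with `σ` gives curves in the levels, and their direction is
-- constant by connectedness.
open Classical in
theorem hasFibBox [T2Space Z] (h : HalfArc p a R) (hp : Continuous p) (hop : IsOpenMap p)
    (c : LeafCoord p) (hbox : ∀ z, HasBox p z) (z : p ⁻¹' closure (a '' Ioo 0 1)) :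
    HasFibBox h.level (fun x x' => h.rel x x') z := by
  have hord := h.fibOrder hp hop c hbox
  obtain ⟨Q, hQ, κ, hκ, hpκ, hinj, hκ0, -⟩ := hbox z
  let σ : Icc (0 : ℝ) 1 → Y := fun s => if (s : ℝ) < 1 then a s else p z
  -- If `z` is not at the upper end, the height 1 is excluded, as `σ` has no meaningful value there.
  let D : Set (Icc (0 : ℝ) 1) := {s | (h.level z : ℝ) < 1 → (s : ℝ) < 1}
  have hD : D ∈ 𝓝 (h.level z) := by
    by_cases hz : (h.level z : ℝ) < 1
    · have : {s : Icc (0 : ℝ) 1 | (s : ℝ) < 1} ∈ 𝓝 (h.level z) :=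
        (isOpen_lt continuous_subtype_val continuous_const).mem_nhds hz
      exact Filter.mem_of_superset this fun s hs _ => hs
    · exact Filter.univ_mem' fun s hs => absurd hs hz
  have hσ1 : ∀ s : Icc (0 : ℝ) 1, (s : ℝ) < 1 → σ s = a s := fun s hs => if_pos hs
  have hzt : ∀ s ∈ D, ¬ (s : ℝ) < 1 → p z ∉ a.target := by
    intro s hs hs1 hpt
    exact hs1 (hs ((h.closure_inter z.2 hpt).1.2))
  have hσD : ∀ s ∈ D, σ s ∈ closure (a '' Ioo 0 1) ∧ height a (σ s) = s := by
    intro s hs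
    by_cases hs1 : (s : ℝ) < 1
    · have hsI : (s : ℝ) ∈ Ico (0 : ℝ) 1 := ⟨s.2.1, hs1⟩
      rw [hσ1 s hs1]
      refine ⟨?_, h.height_apply hsI⟩
      have : (s : ℝ) ∈ closure (Ioo (0 : ℝ) 1) := by rw [closure_Ioo zero_ne_one]; exact s.2
      exact (a.continuousAt (h.Ico_source hsI)).continuousWithinAt.mem_closure_image this
    · have : σ s = p z := if_neg hs1
      rw [this]
      refine ⟨z.2, ?_⟩
      rw [height_of_notMem (hzt s hs hs1)]
      exact le_antisymm (not_lt.1 hs1) s.2.2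
  have hσc : ∀ s ∈ D, ContinuousAt σ s := by
    intro s hs
    by_cases hs1 : (s : ℝ) < 1
    · have hsI : (s : ℝ) ∈ Ico (0 : ℝ) 1 := ⟨s.2.1, hs1⟩
      have h1 : ContinuousAt (fun s : Icc (0 : ℝ) 1 => a s) s :=
        (a.continuousAt (h.Ico_source hsI)).comp continuous_subtype_val.continuousAt
      refine h1.congr ?_
      have : {s : Icc (0 : ℝ) 1 | (s : ℝ) < 1} ∈ 𝓝 s :=
        (isOpen_lt continuous_subtype_val continuous_const).mem_nhds hs1
      filter_upwards [this] with s' hs' using (hσ1 s' hs').symm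
    · have hlim := h.tendsto_one z.2 (hzt s hs hs1)
      have hsv : (s : ℝ) = 1 := le_antisymm s.2.2 (not_lt.1 hs1)
      intro V hV
      rw [show σ s = p z from if_neg hs1] at hV
      obtain ⟨l, hl, hlV⟩ := mem_nhdsLT_iff_exists_Ioo_subset.1 (hlim hV)
      have : {s : Icc (0 : ℝ) 1 | l < s} ∈ 𝓝 s :=
        (isOpen_lt continuous_const continuous_subtype_val).mem_nhds (by rw [mem_ofPred_eq, hsv]; exact hl)
      rw [Filter.mem_map]
      filter_upwards [this] with s' hs'
      by_cases hs1' : (s' : ℝ) < 1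
      · rw [mem_preimage, hσ1 s' hs1']
        exact hlV ⟨hs', hs1'⟩
      · rw [mem_preimage, show σ s' = p z from if_neg hs1']
        exact mem_of_mem_nhds hV
  have hzD : h.level z ∈ D := fun hh => hh
  have hσz : σ (h.level z) = p z := by
    by_cases hz : (h.level z : ℝ) < 1
    · rw [hσ1 _ hz]
      have hpt : p z ∈ a.target := by
        by_contra hpt
        exact hz.ne (height_of_notMem hpt)
      exact (h.closure_inter z.2 hpt).2
    · exact if_neg hz
  have hσQ : ∀ᶠ s in 𝓝 (h.level z), σ s ∈ Q :=
    (hσc _ hzD).eventually (show Q ∈ 𝓝 (σ (h.level z)) by rwa [hσz])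
  obtain ⟨ε, hε, hball⟩ := Metric.mem_nhds_iff.1 (Filter.inter_mem hD hσQ)
  set W := Metric.ball (h.level z) ε with hW
  have hWc : IsPreconnected W := by
    rw [← IsInducing.subtypeVal.isPreconnected_image]
    have : Subtype.val '' W = Metric.ball (h.level z : ℝ) ε ∩ Icc 0 1 := by
      ext x
      constructor
      · rintro ⟨s, hs, rfl⟩
        exact ⟨hs, s.2⟩
      · rintro ⟨hx, hx'⟩
        exact ⟨⟨x, hx'⟩, hx, rfl⟩
    rw [this, Real.ball_eq_Ioo]
    exact (ordConnected_Ioo.inter ordConnected_Icc).isPreconnected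
  -- The default value `z` never occurs for heights in `W`.
  let κ' : ℝ → Icc (0 : ℝ) 1 → p ⁻¹' closure (a '' Ioo 0 1) := fun x s =>
    if hm : p (κ x (σ s)) ∈ closure (a '' Ioo 0 1) then ⟨κ x (σ s), hm⟩ else z
  have hκ'v : ∀ x, ∀ s ∈ W, (κ' x s : Z) = κ x (σ s) := by
    intro x s hs
    have hm : p (κ x (σ s)) ∈ closure (a '' Ioo 0 1) := by
      rw [hpκ x _ (hball hs).2]; exact (hσD s (hball hs).1).1
    simp only [κ', dif_pos hm]
  have hκ'c : ContinuousOn (fun q : ℝ × Icc (0 : ℝ) 1 => κ' q.1 q.2) (univ ×ˢ W) := by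
    rw [IsInducing.subtypeVal.continuousOn_iff]
    have h1 : ContinuousOn (fun q : ℝ × Icc (0 : ℝ) 1 => κ q.1 (σ q.2)) (univ ×ˢ W) := by
      refine hκ.comp (f := fun q : ℝ × Icc (0 : ℝ) 1 => (q.1, σ q.2)) ?_
        fun q hq => ⟨mem_univ _, (hball hq.2).2⟩
      refine continuousOn_fst.prodMk ?_
      exact ContinuousOn.comp (t := W)
        (fun s hs => (hσc s (hball hs).1).continuousWithinAt) continuousOn_snd fun q hq => hq.2
    exact h1.congr fun q hq => hκ'v q.1 q.2 hq.2
  have hlev : ∀ x, ∀ s ∈ W, h.level (κ' x s) = s := by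
    intro x s hs
    refine Subtype.ext ?_
    show height a (p (κ' x s)) = s
    rw [hκ'v x s hs, hpκ x _ (hball hs).2, (hσD s (hball hs).1).2]
  have hzW : h.level z ∈ W := Metric.mem_ball_self hε
  have h0 : κ' 0 (h.level z) = z := Subtype.ext (by rw [hκ'v 0 _ hzW, hσz, hκ0])
  have tot : ∀ s ∈ W, ∀ x x', x ≠ x' → h.rel (κ' x s) (κ' x' s) ∨ h.rel (κ' x' s) (κ' x s) := by
    intro s hs x x' hne
    refine hord.total (by rw [hlev x s hs, hlev x' s hs]) fun e => hne ?_
    have := congrArg Subtype.val e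
    rw [hκ'v x s hs, hκ'v x' s hs] at this
    exact hinj _ (hball hs).2 this
  let E : Set ((ℝ × ℝ) × Icc (0 : ℝ) 1) := {q : ℝ × ℝ | q.1 < q.2} ×ˢ W
  have hWo : IsOpen W := Metric.isOpen_ball
  have ev : ∀ q : (ℝ × ℝ) × Icc (0 : ℝ) 1, q.2 ∈ W → h.rel (κ' q.1.1 q.2) (κ' q.1.2 q.2) →
      ∀ᶠ q' in 𝓝 q, h.rel (κ' q'.1.1 q'.2) (κ' q'.1.2 q'.2) := by
    intro q hq hr
    have c1 : ContinuousAt (fun q : (ℝ × ℝ) × Icc (0 : ℝ) 1 => κ' q.1.1 q.2) q :=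
      ContinuousAt.comp (f := fun q : (ℝ × ℝ) × Icc (0 : ℝ) 1 => (q.1.1, q.2))
        (hκ'c.continuousAt (prod_mem_nhds Filter.univ_mem (hWo.mem_nhds hq))) (by fun_prop)
    have c2 : ContinuousAt (fun q : (ℝ × ℝ) × Icc (0 : ℝ) 1 => κ' q.1.2 q.2) q :=
      ContinuousAt.comp (f := fun q : (ℝ × ℝ) × Icc (0 : ℝ) 1 => (q.1.2, q.2))
        (hκ'c.continuousAt (prod_mem_nhds Filter.univ_mem (hWo.mem_nhds hq))) (by fun_prop)
    filter_upwards [hord.eventually_lt c1 c2 hr,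
      continuousAt_snd.eventually (hWo.mem_nhds hq)] with q' hq' hqW
    exact hq' (by rw [hlev _ _ hqW, hlev _ _ hqW])
  have key : ∀ q ∈ E, ∀ q' ∈ E, (h.rel (κ' q.1.1 q.2) (κ' q.1.2 q.2) ↔
      h.rel (κ' q'.1.1 q'.2) (κ' q'.1.2 q'.2)) := by
    intro q hq q' hq'
    refine (isPreconnected_lt.prod hWc).induction₂ (fun q q' : (ℝ × ℝ) × Icc (0 : ℝ) 1 =>
      (h.rel (κ' q.1.1 q.2) (κ' q.1.2 q.2) ↔ h.rel (κ' q'.1.1 q'.2) (κ' q'.1.2 q'.2)))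
      (fun q hq => ?_) (fun _ _ _ _ _ _ h1 h2 => h1.trans h2) (fun _ _ _ _ h => h.symm) hq hq'
    rcases tot q.2 hq.2 q.1.1 q.1.2 (ne_of_lt hq.1) with hr | hr
    · filter_upwards [nhdsWithin_le_nhds (ev q hq.2 hr)] with q' hq' using iff_of_true hr hq'
    · have hsw : ContinuousAt (fun q : (ℝ × ℝ) × Icc (0 : ℝ) 1 => (q.1.swap, q.2)) q := by fun_prop
      have := hsw.eventually (ev (q.1.swap, q.2) hq.2 hr)
      filter_upwards [nhdsWithin_le_nhds this] with q' hq'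
      exact iff_of_false (hord.asymm hr) (hord.asymm hq')
  have hWn : W ∈ 𝓝 (h.level z) := hWo.mem_nhds hzW
  by_cases h01 : h.rel (κ' 0 (h.level z)) (κ' 1 (h.level z))
  · exact ⟨W, hWn, κ', hκ'c, hlev, fun s hs x x' hx =>
      (key ((0, 1), h.level z) ⟨by simp, hzW⟩ ((x, x'), s) ⟨hx, hs⟩).1 h01, h0⟩
  · refine ⟨W, hWn, fun x s => κ' (-x) s, ?_, fun x s hs => hlev _ s hs, fun s hs x x' hx => ?_,
      by simpa using h0⟩
    · exact hκ'c.comp (f := fun q : ℝ × Icc (0 : ℝ) 1 => (-q.1, q.2)) (by fun_prop)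
        fun q hq => ⟨mem_univ _, hq.2⟩
    · exact (tot s hs (-x) (-x') (by linarith [hx] : -x' < -x).ne').resolve_right fun hh =>
        h01 ((key ((-x', -x), s) ⟨neg_lt_neg hx, hs⟩ ((0, 1), h.level z) ⟨by simp, hzW⟩).1 hh)

/-- The part of the surface over the closure of a half-arc is a strip. -/
theorem exists_strip [T2Space Z] [SecondCountableTopology Z] (h : HalfArc p a R)
    (hp : Continuous p) (hop : IsOpenMap p) (c : LeafCoord p) (hbox : ∀ z, HasBox p z) :
    ∃ (S : Strip) (Φ : p ⁻¹' closure (a '' Ioo 0 1) ≃ₜ S.carrier),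
      (∀ z, Φ z ∈ S.bd ↔ p z ∉ a '' Ioo 0 1) ∧
      ∀ z w : p ⁻¹' closure (a '' Ioo 0 1), p z ∈ a '' Ioo 0 1 → p w ∈ a '' Ioo 0 1 →
        ((Φ z).1.2 = (Φ w).1.2 ↔ p z = p w) := by
  have hord := h.fibOrder hp hop c hbox
  obtain ⟨f, hf, hfI, hmono, hsurj, hopen⟩ :=
    exists_straightening (h.continuous_level hp) hord (h.hasFibBox hp hop c hbox)
  -- A chart of the line onto the unit interval, which turns the straightened coordinate into one
  -- with values in `ℝ`.
  let ψ := OpenPartialHomeomorph.univBall (1 / 2 : ℝ) (1 / 2)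
  have hψs : ψ.source = univ := OpenPartialHomeomorph.univBall_source _ _
  have hψt : ψ.target = Ioo 0 1 := by
    rw [OpenPartialHomeomorph.univBall_target _ (by norm_num), Real.ball_eq_Ioo]
    norm_num
  have hψc : Continuous ψ := by
    rw [← continuousOn_univ, ← hψs]; exact ψ.continuousOn
  have hψf : ∀ z, ψ (ψ.symm (f z)) = f z := fun z => ψ.right_inv (by rw [hψt]; exact hfI z)
  let F : p ⁻¹' closure (a '' Ioo 0 1) → ℝ × Icc (0 : ℝ) 1 := fun z => (ψ.symm (f z), h.level z)
  have hFc : Continuous F := by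
    refine Continuous.prodMk ?_ (h.continuous_level hp)
    exact ψ.continuousOn_symm.comp_continuous hf fun z => by rw [hψt]; exact hfI z
  have hFi : Function.Injective F := by
    intro z w e
    have e1 : f z = f w := by rw [← hψf z, ← hψf w]; exact congrArg ψ (congrArg Prod.fst e)
    have e2 : h.level z = h.level w := congrArg Prod.snd e
    by_contra hne
    rcases hord.total e2 hne with hr | hr
    · exact (hmono _ _ hr).ne e1
    · exact (hmono _ _ hr).ne e1.symm
  have hFo : IsOpenMap F := by
    intro V hV
    have h1 := (hopen V hV).preimage (f := fun q : ℝ × Icc (0 : ℝ) 1 => (ψ q.1, q.2)) (by fun_prop)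
    convert h1 using 1
    ext q
    constructor
    · rintro ⟨z, hz, rfl⟩
      exact ⟨z, hz, Prod.ext (hψf z).symm rfl⟩
    · rintro ⟨z, hz, e⟩
      obtain ⟨e1, e2⟩ := Prod.mk.inj e
      refine ⟨z, hz, Prod.ext ?_ e2⟩
      show ψ.symm (f z) = q.1
      rw [e1, ψ.left_inv (by rw [hψs]; trivial)]
  have hFe : IsOpenEmbedding F := .of_continuous_injective_isOpenMap hFc hFi hFo
  let ι : ℝ × Icc (0 : ℝ) 1 → ℝ × ℝ := fun q => (q.1, q.2)
  have hι : IsEmbedding ι := IsEmbedding.id.prodMap IsEmbedding.subtypeVal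
  have hG : IsEmbedding (ι ∘ F) := hι.comp hFe.isEmbedding
  have hhalf : ∀ z, ((h.level z : ℝ) ∈ Ioo (0 : ℝ) 1 ↔ p z ∈ a '' Ioo 0 1) := fun z =>
    (h.mem_half_iff z.2).symm
  let S : Strip := {
    u := 0
    v := 1
    u_lt_v := one_pos
    carrier := range (ι ∘ F)
    le_carrier := by
      rintro ⟨x, s⟩ ⟨-, hs⟩
      have hmem : a s ∈ closure (a '' Ioo 0 1) := subset_closure ⟨s, hs, rfl⟩
      have hlev : ∀ z : p ⁻¹' closure (a '' Ioo 0 1), (h.level z : ℝ) = s ↔ p z = a s := by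
        intro z
        constructor
        · intro e
          have := (hhalf z).1 (e ▸ hs)
          rw [← (h.height_of_mem_half this).2]
          exact congrArg a e
        · intro e
          show height a (p z) = s
          rw [e, h.height_apply (Ioo_subset_Ico_self hs)]
      let z₀ : p ⁻¹' closure (a '' Ioo 0 1) := ⟨c.par (a s) 0, by
        rw [mem_preimage, c.p_par]; exact hmem⟩
      have hz₀ : (h.level z₀ : ℝ) = s := (hlev z₀).2 (c.p_par _ _)
      -- A level strictly between 0 and 1 is a single leaf, hence connected, so the straightening
      -- fills the whole line. Level 1 may be a union of several leaves; there only the openness of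
      -- the image is available, and no more is required of a strip.
      have hconn : IsPreconnected (h.level ⁻¹' {h.level z₀}) := by
        rw [← IsInducing.subtypeVal.isPreconnected_image]
        have : Subtype.val '' (h.level ⁻¹' {h.level z₀}) = range (c.par (a s)) := by
          ext w
          constructor
          · rintro ⟨z, hz, rfl⟩
            have : p z = a s := (hlev z).1 ((congrArg Subtype.val hz).trans hz₀)
            exact ⟨c.e z, this ▸ c.par_e z⟩
          · rintro ⟨t, rfl⟩
            have hm : p (c.par (a s) t) ∈ closure (a '' Ioo 0 1) := by rw [c.p_par]; exact hmem
            exact ⟨⟨_, hm⟩, Subtype.ext (((hlev ⟨_, hm⟩).2 (c.p_par _ _)).trans hz₀.symm), rfl⟩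
        rw [this]
        exact isPreconnected_range (c.par_cont _)
      have hx : ψ x ∈ Ioo (0 : ℝ) 1 := hψt ▸ ψ.map_source (by rw [hψs]; trivial)
      obtain ⟨z, hz, e⟩ := hsurj z₀ hconn hx
      refine ⟨z, Prod.ext ?_ ?_⟩
      · show ψ.symm (f z) = x
        rw [e, ψ.left_inv (by rw [hψs]; trivial)]
      · exact (congrArg Subtype.val hz).trans hz₀
    carrier_le := by
      rintro _ ⟨z, rfl⟩
      exact ⟨mem_univ _, (h.level z).2⟩
    carrier_open := by
      obtain ⟨O, hO, e⟩ := hι.isOpen_iff.1 hFe.isOpen_range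
      refine ⟨O, hO, ?_⟩
      ext q
      constructor
      · rintro ⟨z, rfl⟩
        exact ⟨e.symm.subset ⟨z, rfl⟩, mem_univ _, (h.level z).2⟩
      · rintro ⟨hq, -, hq2⟩
        obtain ⟨z, hz⟩ := e.subset (show (q.1, (⟨q.2, hq2⟩ : Icc (0 : ℝ) 1)) ∈ ι ⁻¹' O from hq)
        exact ⟨z, congrArg ι hz⟩ }
  refine ⟨S, hG.toHomeomorph, fun z => ?_, fun z w hz hw => ?_⟩
  · rw [← hhalf z]
    have h2 := (h.level z).2
    show (h.level z : ℝ) = 0 ∨ (h.level z : ℝ) = 1 ↔ _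
    constructor
    · rintro (e | e) ⟨h3, h4⟩ <;> rw [e] at h3 h4
      · exact lt_irrefl _ h3
      · exact lt_irrefl _ h4
    · intro hn
      by_contra! hne
      exact hn ⟨lt_of_le_of_ne h2.1 hne.1.symm, lt_of_le_of_ne h2.2 hne.2⟩
  · show height a (p z) = height a (p w) ↔ _
    refine ⟨fun e => ?_, fun e => by rw [e]⟩
    rw [← (h.height_of_mem_half hz).2, ← (h.height_of_mem_half hw).2, e]

end HalfArc

end HalfArcStrip

end FoliatedSurface
namespace FoliatedSurface

/-! ### The half-arcs adjacent to a point of the cut. -/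

section Ends

variable {Z Y : Type*} [TopologicalSpace Z] [TopologicalSpace Y] {p : Z → Y} {M : Set Y}

namespace ArcSystem

variable {K : Type*} (S : ArcSystem p M K)

theorem disjoint_closure_B {l m : K × Bool} (h : l ≠ m) : Disjoint (S.B l) (closure (S.B m)) :=
  (S.disj_B l m h).closure_right (S.isOpen_B l)

theorem mem_cut_of_closure {l : K × Bool} {y : Y} (hy : y ∈ closure (S.B l)) (hyB : y ∉ S.B l) :
    y ∈ S.cut := by
  by_contra hc
  have : y ∈ ⋃ l, S.B l := S.cut_compl ▸ hc
  obtain ⟨m, hm⟩ := mem_iUnion.1 this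
  have hne : m ≠ l := fun e => hyB (e ▸ hm)
  exact disjoint_left.1 (S.disjoint_closure_B hne) hm hy

theorem notMem_B {y : Y} (hy : y ∈ S.cut) (l : K × Bool) : y ∉ S.B l := fun hl => by
  have : y ∈ S.cutᶜ := S.cut_compl ▸ mem_iUnion.2 ⟨l, hl⟩
  exact this hy

/-- Each side of a point of the cut runs in one half-arc. -/
theorem exists_ends (hC : IsThin S.cut) {ι : Type} [Finite ι] {c : ι → ℝ → Y} {y : Y}
    (hc : Sides c y) : ∃ ε > 0, ∃ k : ι → K × Bool, ∀ i, c i '' Ioo 0 ε ⊆ S.B (k i) := by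
  have hp : ∀ i, ∃ δ > 0, ∃ l, c i '' Ioo 0 δ ⊆ S.B l := fun i =>
    path_subset hC S.isOpen_B S.disj_B S.cut_compl.subset (hc.cont i) (hc.lim i) (hc.ne i)
  choose δ hδ k hk using hp
  have hne : ∃ ε > 0, ∀ i, ε ≤ δ i := by
    cases isEmpty_or_nonempty ι
    · exact ⟨1, one_pos, fun i => isEmptyElim i⟩
    · obtain ⟨i, hi⟩ := Finite.exists_min δ
      exact ⟨δ i, hδ i, hi⟩
  obtain ⟨ε, hε, hεδ⟩ := hne
  exact ⟨ε, hε, k, fun i => (image_mono (Ioo_subset_Ioo_right (hεδ i))).trans (hk i)⟩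

section

variable {ι : Type} {c : ι → ℝ → Y} {y : Y} {ε : ℝ} {k : ι → K × Bool}

theorem eventually_B (hc : Sides c y) (hy : y ∈ S.cut) (hε : 0 < ε)
    (hk : ∀ i, c i '' Ioo 0 ε ⊆ S.B (k i)) :
    ∀ᶠ y' in 𝓝 y, ∀ l, y' ∈ S.B l → l ∈ range k := by
  filter_upwards [hc.nhds ε hε] with y' hy' l hl
  rcases hy' with rfl | hy'
  · exact absurd hl (S.notMem_B hy l)
  · obtain ⟨i, hi⟩ := mem_iUnion.1 hy'
    refine ⟨i, ?_⟩
    by_contra hne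
    exact disjoint_left.1 (S.disj_B _ _ hne) (hk i hi) hl

theorem mem_closure_B_iff (hc : Sides c y) (hy : y ∈ S.cut) (hε : 0 < ε)
    (hk : ∀ i, c i '' Ioo 0 ε ⊆ S.B (k i)) {l : K × Bool} :
    y ∈ closure (S.B l) ↔ l ∈ range k := by
  constructor
  · intro h
    obtain ⟨y', hy', hl⟩ := mem_closure_iff_nhds.1 h _ (S.eventually_B hc hy hε hk)
    exact hy' l hl
  · rintro ⟨i, rfl⟩
    refine mem_closure_of_tendsto (hc.lim i) ?_
    filter_upwards [Ioo_mem_nhdsGT hε] with t ht using hk i ⟨t, ht, rfl⟩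

end

/-- At each point of the cut the space of leaves is an open arc, or it has one side. -/
def HasSides : Prop := ∀ y ∈ S.cut, (∃ j : ℝ → Y, IsOpenEmbedding j ∧ j 0 = y) ∨
  ∃ d : ℝ → Y, Sides (fun _ : Unit => d) y

theorem exists_sides (hs : S.HasSides) {y : Y} (hy : y ∈ S.cut) :
    ∃ (ι : Type) (_ : Finite ι) (c : ι → ℝ → Y), Sides c y := by
  rcases hs y hy with ⟨j, hj, rfl⟩ | ⟨d, hd⟩
  · exact ⟨Bool, inferInstance, _, sides_of_arc hj⟩
  · exact ⟨Unit, inferInstance, _, hd⟩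

/-- Near a point of the cut only those half-arcs occur that carry one of its finitely many sides. -/
theorem locallyFinite_B (hC : IsThin S.cut) (hs : S.HasSides) : LocallyFinite S.B := by
  intro y
  by_cases hy : y ∈ S.cut
  · obtain ⟨ι, _, c, hc⟩ := S.exists_sides hs hy
    obtain ⟨ε, hε, k, hk⟩ := S.exists_ends hC hc
    refine ⟨_, S.eventually_B hc hy hε hk, (finite_range k).subset ?_⟩
    rintro l ⟨y', hl, hy'⟩
    exact hy' l hl
  · have : y ∈ ⋃ l, S.B l := S.cut_compl ▸ hy
    obtain ⟨l, hl⟩ := mem_iUnion.1 this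
    refine ⟨_, (S.isOpen_B l).mem_nhds hl, (finite_singleton l).subset ?_⟩
    rintro m ⟨y', hm, hl'⟩
    by_contra hne
    exact disjoint_left.1 (S.disj_B m l hne) hm hl'

theorem halfArc (hC : IsThin S.cut) (hs : S.HasSides)
    (hsep : ∀ y ∈ M, ∀ y', y ≠ y' → Disjoint (𝓝 y) (𝓝 y')) (l : K × Bool) :
    HalfArc p (S.half l) (S.R l.1) where
  source := S.half_source l
  sep y hy := hsep y (S.sub _ (S.target_sub _ (S.half_target l ▸ hy)))
  ord := by rw [S.half_target l]; exact S.ord l.1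
  tail y hy hyt := by
    have hyB : y ∉ S.B l := fun h => hyt (S.half_target l ▸ S.B_sub_target l h)
    have hyc := S.mem_cut_of_closure hy hyB
    obtain ⟨ι, _, c, hc⟩ := S.exists_sides hs hyc
    obtain ⟨ε, hε, k, hk⟩ := S.exists_ends hC hc
    obtain ⟨i, rfl⟩ := (S.mem_closure_B_iff hc hyc hε hk).1 hy
    exact ⟨c i, hc.cont i, hc.lim i, ε, hε, hk i⟩

/-- A point of the cut lies in the closure of one or two half-arcs. -/
theorem exists_closure_B (hC : IsThin S.cut) (hs : S.HasSides)
    (hsep : ∀ y ∈ M, ∀ y', y ≠ y' → Disjoint (𝓝 y) (𝓝 y')) {y : Y}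
    (hy : y ∈ S.cut) : (∃ l, ∀ n, y ∈ closure (S.B n) ↔ n = l) ∨
      ∃ l m, l ≠ m ∧ ∀ n, y ∈ closure (S.B n) ↔ n = l ∨ n = m := by
  rcases hs y hy with ⟨j, hj, rfl⟩ | ⟨d, hd⟩
  · have hc := sides_of_arc hj
    obtain ⟨ε, hε, k, hk⟩ := S.exists_ends hC hc
    have hiff : ∀ n, j 0 ∈ closure (S.B n) ↔ n = k true ∨ n = k false := fun n => by
      rw [S.mem_closure_B_iff hc hy hε hk]
      simp [or_comm]
    refine Or.inr ⟨k true, k false, fun e => ?_, hiff⟩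
    -- It remains to exclude that both sides run in the same half-arc. A point of the cut that lies
    -- on the arc is its middle, and this is a limit of both halves.
    by_cases hyt : j 0 ∈ (S.half (k true)).target
    · have hzero : j 0 = S.half (k true) 0 := by
        rw [half_target] at hyt
        rcases hy with hM | ⟨k', hk', h⟩
        · exact absurd (S.sub _ (S.target_sub _ hyt)) hM
        · obtain rfl : k' = (k true).1 := by
            by_contra hne
            exact disjoint_left.1 (S.disj _ _ hne) hk' (S.target_sub _ hyt)
          rw [half_zero]
          exact h.resolve_left fun hn => hn hyt
      have hmem : ∀ b, j 0 ∈ closure (S.B ((k true).1, b)) := by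
        intro b
        rw [hzero, half_zero, ← S.half_zero ((k true).1, b)]
        have h0 : (0 : ℝ) ∈ (S.half ((k true).1, b)).source := by
          rw [half_source]; constructor <;> norm_num
        refine ((S.half _).continuousAt h0).continuousWithinAt.mem_closure_image ?_
        rw [closure_Ioo zero_ne_one]
        simp
      have h1 := (hiff _).1 (hmem true)
      have h2 := (hiff _).1 (hmem false)
      rw [← e, or_self] at h1 h2
      simpa using h1.trans h2.symm
    -- At a limit outside the arc, both sides would cover the end of the same half-arc and so would
    -- meet, against injectivity of `j`.
    · have ha := S.halfArc hC hs hsep (k true)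
      obtain ⟨s, hs1, hsub⟩ := ha.exists_tail hyt (hc.cont true) (hc.lim true) hε (hk true)
      obtain ⟨s', hs1', hsub'⟩ := ha.exists_tail hyt (hc.cont false) (hc.lim false) hε
        (e ▸ hk false)
      obtain ⟨r, hr, hr1⟩ := exists_between (max_lt hs1 hs1')
      obtain ⟨t, ht, et⟩ := hsub ⟨r, ⟨(le_max_left _ _).trans_lt hr, hr1⟩, rfl⟩
      obtain ⟨t', ht', et'⟩ := hsub' ⟨r, ⟨(le_max_right _ _).trans_lt hr, hr1⟩, rfl⟩
      have : t = -t' := hj.injective (by simpa using et.trans et'.symm)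
      linarith [ht.1, ht'.1]
  · obtain ⟨ε, hε, k, hk⟩ := S.exists_ends hC hd
    refine Or.inl ⟨k (), fun n => ?_⟩
    rw [S.mem_closure_B_iff hd hy hε hk]
    exact ⟨fun ⟨_, e⟩ => e.symm, fun e => ⟨(), e.symm⟩⟩

end ArcSystem

end Ends

end FoliatedSurface
namespace FoliatedSurface

/-! ### Gluing strips to a striped atlas. -/

section Gluing

variable {Z Y : Type*} [TopologicalSpace Z] [TopologicalSpace Y] {p : Z → Y}

/-- The surface is cut, along the fibres over a thin set `C`, into strips. -/
structure StripCover (p : Z → Y) (C : Set Y) {L : Type} (V : L → Set Y) (S : L → Strip)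
    (Φ : ∀ l, p ⁻¹' closure (V l) ≃ₜ (S l).carrier) : Prop where
  cont : Continuous p
  conn : ∀ y, IsPreconnected (p ⁻¹' {y})
  surj : Function.Surjective p
  thin : IsThin C
  isOpen : ∀ l, IsOpen (V l)
  disj : ∀ l m, l ≠ m → Disjoint (V l) (V m)
  compl : Cᶜ = ⋃ l, V l
  locallyFinite : LocallyFinite V
  count : ∀ y ∈ C, (∃ l, ∀ n, y ∈ closure (V n) ↔ n = l) ∨
    ∃ l m, l ≠ m ∧ ∀ n, y ∈ closure (V n) ↔ n = l ∨ n = m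
  bd : ∀ l z, Φ l z ∈ (S l).bd ↔ p z ∉ V l
  level : ∀ l (z w : p ⁻¹' closure (V l)), p z ∈ V l → p w ∈ V l →
    ((Φ l z).1.2 = (Φ l w).1.2 ↔ p z = p w)

theorem IsThin.subsingleton {C s : Set Y} (hC : IsThin C) (hs : IsPreconnected s) (hsC : s ⊆ C) :
    s.Subsingleton := fun x hx y hy =>
  hs.induction₂ (fun x y => x = y)
    (fun x _ => by
      filter_upwards [nhdsWithin_le_nhds (hC x), self_mem_nhdsWithin] with y h1 h2 using
        (h1 (hsC h2)).symm)
    (fun _ _ _ _ _ _ h1 h2 => h1.trans h2) (fun _ _ _ _ h => h.symm) hx hy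

namespace StripCover

variable {C : Set Y} {L : Type} {V : L → Set Y} {S : L → Strip}
  {Φ : ∀ l, p ⁻¹' closure (V l) ≃ₜ (S l).carrier}

/-- The map that glues the strips together. -/
def glue (_ : StripCover p C V S Φ) (s : StripSum S) : Z := (Φ s.1).symm s.2

/-- The part of the strip `l` over `y`. -/
def piece (h : StripCover p C V S Φ) (l : L) (y : Y) : Set (StripSum S) :=
  {s | s.1 = l ∧ p (h.glue s) = y}

theorem p_glue_mem (h : StripCover p C V S Φ) (s : StripSum S) :
    p (h.glue s) ∈ closure (V s.1) := ((Φ s.1).symm s.2).2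

theorem glue_mk (h : StripCover p C V S Φ) (l : L) (z : p ⁻¹' closure (V l)) :
    h.glue ⟨l, Φ l z⟩ = z := congrArg Subtype.val ((Φ l).symm_apply_apply z)

theorem glue_inj (h : StripCover p C V S Φ) {s t : StripSum S} (h1 : s.1 = t.1)
    (h2 : h.glue s = h.glue t) : s = t := by
  obtain ⟨l, s⟩ := s
  obtain ⟨m, t⟩ := t
  obtain rfl : l = m := h1
  exact congrArg (Sigma.mk l) ((Φ l).symm.injective (Subtype.ext h2))

theorem continuous_glue (h : StripCover p C V S Φ) : Continuous h.glue :=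
  continuous_sigma fun l => continuous_subtype_val.comp (Φ l).symm.continuous

theorem eq_of_mem (h : StripCover p C V S Φ) {y : Y} {l m : L} (hl : y ∈ V l)
    (hm : y ∈ closure (V m)) : m = l := by
  by_contra hne
  exact disjoint_left.1 ((h.disj l m (Ne.symm hne)).closure_right (h.isOpen l)) hl hm

theorem mem_or (h : StripCover p C V S Φ) (y : Y) : y ∈ C ∨ ∃ l, y ∈ V l := by
  by_cases hy : y ∈ C
  · exact Or.inl hy
  · have : y ∈ ⋃ l, V l := h.compl ▸ hy
    exact Or.inr (mem_iUnion.1 this)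

theorem notMem_C (h : StripCover p C V S Φ) {y : Y} {l : L} (hl : y ∈ V l) : y ∉ C := by
  have : y ∈ Cᶜ := h.compl ▸ mem_iUnion.2 ⟨l, hl⟩
  exact this

theorem exists_closure (h : StripCover p C V S Φ) (y : Y) : ∃ l, y ∈ closure (V l) := by
  rcases h.mem_or y with hy | ⟨l, hl⟩
  · rcases h.count y hy with ⟨l, hl⟩ | ⟨l, m, -, hl⟩
    · exact ⟨l, (hl l).2 rfl⟩
    · exact ⟨l, (hl l).2 (Or.inl rfl)⟩
  · exact ⟨l, subset_closure hl⟩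

theorem surjective_glue (h : StripCover p C V S Φ) : Function.Surjective h.glue := by
  intro z
  obtain ⟨l, hl⟩ := h.exists_closure (p z)
  exact ⟨⟨l, Φ l ⟨z, hl⟩⟩, h.glue_mk l _⟩

/-- Each strip is embedded onto a closed set and these sets form a locally finite family. A
continuous closed surjection is a quotient map. -/
theorem isClosedMap_glue (h : StripCover p C V S Φ) : IsClosedMap h.glue := by
  intro F hF
  have : h.glue '' F =
      ⋃ l, Subtype.val '' ((Φ l).symm '' {s | (⟨l, s⟩ : StripSum S) ∈ F}) := by
    ext z
    simp only [mem_iUnion]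
    constructor
    · rintro ⟨⟨l, s⟩, hs, rfl⟩
      exact ⟨l, _, ⟨s, hs, rfl⟩, rfl⟩
    · rintro ⟨l, _, ⟨s, hs, rfl⟩, rfl⟩
      exact ⟨⟨l, s⟩, hs, rfl⟩
  rw [this]
  refine LocallyFinite.isClosed_iUnion ?_ fun l => ?_
  · refine ((h.locallyFinite.closure).preimage_continuous h.cont).subset fun l => ?_
    rintro _ ⟨w, -, rfl⟩
    exact w.2
  · have hc : IsClosed (p ⁻¹' closure (V l)) := isClosed_closure.preimage h.cont
    refine hc.isClosedEmbedding_subtypeVal.isClosedMap _ ((Φ l).symm.isClosedMap _ ?_)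
    exact hF.preimage (continuous_sigmaMk (σ := fun l => (S l).carrier))

theorem image_piece (h : StripCover p C V S Φ) {l : L} {y : Y} (hy : y ∈ closure (V l)) :
    h.glue '' h.piece l y = p ⁻¹' {y} := by
  ext z
  constructor
  · rintro ⟨s, hs, rfl⟩
    exact hs.2
  · intro hz
    have hz : p z = y := hz
    subst hz
    exact ⟨⟨l, Φ l ⟨z, hy⟩⟩, ⟨rfl, congrArg p (h.glue_mk l _)⟩, h.glue_mk l _⟩

theorem piece_injective (h : StripCover p C V S Φ) {l l' : L} {y y' : Y}
    (hy : y ∈ closure (V l)) (e : h.piece l y = h.piece l' y') : l = l' ∧ y = y' := by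
  obtain ⟨z, rfl⟩ := h.surj y
  have hm : (⟨l, Φ l ⟨z, hy⟩⟩ : StripSum S) ∈ h.piece l (p z) :=
    ⟨rfl, congrArg p (h.glue_mk l _)⟩
  have hm' := hm
  rw [e] at hm'
  exact ⟨hm'.1, hm.2.symm.trans hm'.2⟩

theorem isClosedEmbedding_piece [T1Space Y] (h : StripCover p C V S Φ) (l : L) (y : Y) :
    IsClosedEmbedding fun s : h.piece l y => h.glue s := by
  have hc : IsClosed (h.piece l y) := by
    refine IsClosed.inter (s₁ := {s : StripSum S | s.1 = l}) ?_ ?_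
    · have : {s : StripSum S | s.1 = l} = range (Sigma.mk l) := by
        rw [Set.range_sigmaMk]; rfl
      rw [this]
      exact isClosed_range_sigmaMk
    · exact isClosed_singleton.preimage (h.cont.comp h.continuous_glue)
  refine .of_continuous_injective_isClosedMap (h.continuous_glue.comp continuous_subtype_val) ?_
    (h.isClosedMap_glue.comp hc.isClosedEmbedding_subtypeVal.isClosedMap)
  intro s t e
  exact Subtype.ext (h.glue_inj (s.2.1.trans t.2.1.symm) e)

/-- The part of a strip over `y` as a subset of this strip. -/
def slice (_ : StripCover p C V S Φ) (l : L) (y : Y) : Set (S l).carrier :=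
  {s | p ((Φ l).symm s) = y}

theorem piece_eq (h : StripCover p C V S Φ) (l : L) (y : Y) :
    h.piece l y = Sigma.mk l '' h.slice l y := by
  ext ⟨m, s⟩
  constructor
  · rintro ⟨rfl, hs⟩
    exact ⟨s, hs, rfl⟩
  · rintro ⟨t, ht, e⟩
    rw [← e]
    exact ⟨rfl, ht⟩

theorem mem_bd_iff (h : StripCover p C V S Φ) {l : L} {s : (S l).carrier} :
    s ∈ (S l).bd ↔ p ((Φ l).symm s) ∈ C := by
  have h1 := h.bd l ((Φ l).symm s)
  rw [(Φ l).apply_symm_apply] at h1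
  rw [h1]
  constructor
  · intro hn
    rcases h.mem_or (p ((Φ l).symm s)) with hy | ⟨m, hm⟩
    · exact hy
    · exact absurd (h.eq_of_mem hm ((Φ l).symm s).2 ▸ hm) hn
  · exact fun hC hV => h.notMem_C hV hC

/-- The boundary of a strip lies over the thin set `C`, so a connected part of it lies over one
point; conversely each fibre is connected. Boundary intervals are therefore exactly the fibres over
the cut. -/
theorem connectedComponentIn_bd (h : StripCover p C V S Φ) {l : L} {s : (S l).carrier}
    (hs : s ∈ (S l).bd) :
    connectedComponentIn (S l).bd s = h.slice l (p ((Φ l).symm s)) := by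
  refine Subset.antisymm (fun t ht => ?_) ?_
  · have hc : Continuous fun s : (S l).carrier => p ((Φ l).symm s) :=
      h.cont.comp (continuous_subtype_val.comp (Φ l).symm.continuous)
    have hpre := (isPreconnected_connectedComponentIn (F := (S l).bd) (x := s)).image _
      hc.continuousOn
    refine h.thin.subsingleton hpre ?_ ⟨t, ht, rfl⟩ ⟨s, mem_connectedComponentIn hs, rfl⟩
    rintro _ ⟨r, hr, rfl⟩
    exact h.mem_bd_iff.1 (connectedComponentIn_subset _ _ hr)
  · refine IsPreconnected.subset_connectedComponentIn ?_ rfl fun t ht => ?_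
    · have hy := ((Φ l).symm s).2
      have hsl : h.slice l (p ((Φ l).symm s)) =
          Φ l '' (Subtype.val ⁻¹' (p ⁻¹' {p ((Φ l).symm s)})) := by
        rw [(Φ l).image_eq_preimage_symm]
        rfl
      rw [hsl]
      refine IsPreconnected.image ?_ _ (Φ l).continuous.continuousOn
      rw [← IsInducing.subtypeVal.isPreconnected_image, Subtype.image_preimage_val,
        inter_eq_right.2]
      · exact h.conn _
      · rintro z hz
        have hz : p z = _ := hz
        rw [mem_preimage, hz]
        exact hy
    · have ht : p ((Φ l).symm t) = _ := ht
      rw [h.mem_bd_iff, ht]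
      exact h.mem_bd_iff.1 hs

theorem exists_symm_apply (h : StripCover p C V S Φ) {l : L} {y : Y}
    (hy : y ∈ closure (V l)) : ∃ s, p ((Φ l).symm s) = y := by
  obtain ⟨z, rfl⟩ := h.surj y
  exact ⟨Φ l ⟨z, hy⟩, by rw [(Φ l).symm_apply_apply]⟩

theorem piece_mem_bdIntervals (h : StripCover p C V S Φ) {l : L} {y : Y} (hyC : y ∈ C)
    (hy : y ∈ closure (V l)) : h.piece l y ∈ bdIntervals S := by
  obtain ⟨s, rfl⟩ := h.exists_symm_apply hy
  have hs := h.mem_bd_iff.2 hyC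
  exact ⟨l, _, ⟨s, hs, rfl⟩, by rw [h.connectedComponentIn_bd hs, h.piece_eq]⟩

theorem symm_apply_level (h : StripCover p C V S Φ) {l : L} {s t : (S l).carrier}
    (hs : s ∉ (S l).bd) (ht : t ∉ (S l).bd) :
    s.1.2 = t.1.2 ↔ p ((Φ l).symm s) = p ((Φ l).symm t) := by
  have hV : ∀ s ∉ (S l).bd, p ((Φ l).symm s) ∈ V l := by
    intro s hs
    have h1 := h.bd l ((Φ l).symm s)
    rw [(Φ l).apply_symm_apply] at h1
    exact not_not.1 fun hn => hs (h1.2 hn)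
  have := h.level l _ _ (hV s hs) (hV t ht)
  rwa [(Φ l).apply_symm_apply, (Φ l).apply_symm_apply] at this

theorem mem_leaves_iff (h : StripCover p C V S Φ) {l : L} {I : Set (S l).carrier} :
    I ∈ (S l).leaves ↔ ∃ s, I = h.slice l (p ((Φ l).symm s)) := by
  have line : ∀ s ∉ (S l).bd, {r : (S l).carrier | r.1.2 = s.1.2} = h.slice l (p ((Φ l).symm s)) := by
    intro s hs
    ext r
    have hrl : r.1.2 = s.1.2 → r ∉ (S l).bd := by
      intro e hr
      refine hs ?_
      show s.1.2 = _ ∨ s.1.2 = _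
      rw [← e]
      exact hr
    have hrp : p ((Φ l).symm r) = p ((Φ l).symm s) → r ∉ (S l).bd := by
      intro e hr
      rw [h.mem_bd_iff] at hr hs
      exact hs (e ▸ hr)
    exact ⟨fun e => (h.symm_apply_level (hrl e) hs).1 e,
      fun e => (h.symm_apply_level (hrp e) hs).2 e⟩
  constructor
  · rintro (⟨t, ht, rfl⟩ | ⟨s, hs, rfl⟩)
    · let s : (S l).carrier := ⟨(0, t), (S l).le_carrier ⟨mem_univ _, ht⟩⟩
      have hs : s ∉ (S l).bd := by
        rintro (e | e)
        · exact ht.1.ne' e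
        · exact ht.2.ne e
      exact ⟨s, line s hs⟩
    · exact ⟨s, h.connectedComponentIn_bd hs⟩
  · rintro ⟨s, rfl⟩
    by_cases hs : s ∈ (S l).bd
    · exact Or.inr ⟨s, hs, (h.connectedComponentIn_bd hs).symm⟩
    · refine Or.inl ⟨s.1.2, ?_, (line s hs).symm⟩
      have hm := ((S l).carrier_le s.2).2
      exact ⟨lt_of_le_of_ne hm.1 fun e => hs (Or.inl e.symm),
        lt_of_le_of_ne hm.2 fun e => hs (Or.inr e)⟩

/-- The leaves of the strips are mapped onto the fibres. -/
theorem exists_stripLeaf_iff (h : StripCover p C V S Φ) {ω : Set Z} :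
    (∃ A ∈ stripLeaves S, ω = h.glue '' A) ↔ ∃ y, ω = p ⁻¹' {y} := by
  constructor
  · rintro ⟨_, ⟨l, I, hI, rfl⟩, rfl⟩
    obtain ⟨s, rfl⟩ := h.mem_leaves_iff.1 hI
    exact ⟨_, by rw [← h.piece_eq, h.image_piece ((Φ l).symm s).2]⟩
  · rintro ⟨y, rfl⟩
    obtain ⟨l, hl⟩ := h.exists_closure y
    obtain ⟨s, rfl⟩ := h.exists_symm_apply hl
    exact ⟨_, ⟨l, _, h.mem_leaves_iff.2 ⟨s, rfl⟩, rfl⟩, by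
      rw [← h.piece_eq, h.image_piece ((Φ l).symm s).2]⟩

theorem isStripedAtlas_glue [T1Space Y] [Countable L] (h : StripCover p C V S Φ) :
    IsStripedAtlas S h.glue := by
  refine ⟨inferInstance, h.isClosedMap_glue.isQuotientMap h.continuous_glue h.surjective_glue, ?_⟩
  -- The points of the cut at which two different strips meet. Over the other points of the cut
  -- there is a single boundary interval, and it stays free.
  let D : Set Y := {y | y ∈ C ∧ ∃ l m, l ≠ m ∧ ∀ n, y ∈ closure (V n) ↔ n = l ∨ n = m}
  have hD : ∀ y : D, ∃ l m, l ≠ m ∧ ∀ n, y.1 ∈ closure (V n) ↔ n = l ∨ n = m :=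
    fun y => y.2.2
  choose l m hlm hiff using hD
  have hl : ∀ y, y.1 ∈ closure (V (l y)) := fun y => (hiff y _).2 (Or.inl rfl)
  have hm : ∀ y, y.1 ∈ closure (V (m y)) := fun y => (hiff y _).2 (Or.inr rfl)
  have hXi : Function.Injective fun y : D => h.piece (l y) y := fun y y' e =>
    Subtype.ext (h.piece_injective (hl y) e).2
  have hYi : Function.Injective fun y : D => h.piece (m y) y := fun y y' e =>
    Subtype.ext (h.piece_injective (hm y) e).2
  -- The index type of the gluing has to live in `Type`. The pieces are sets of points of the
  -- strips, which are in `Type`, so they bound the size of `D`.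
  have hsmall : Small.{0} D := small_of_injective hXi
  let ε : Shrink.{0} D ≃ D := (equivShrink D).symm
  refine ⟨Shrink.{0} D, fun g => h.piece (l (ε g)) (ε g), fun g => h.piece (m (ε g)) (ε g),
    fun g => h.piece_mem_bdIntervals (ε g).2.1 (hl _),
    fun g => h.piece_mem_bdIntervals (ε g).2.1 (hm _), hXi.comp ε.injective, hYi.comp ε.injective,
    ?_, ?_, ?_, fun g => h.isClosedEmbedding_piece _ _, fun g => h.isClosedEmbedding_piece _ _⟩
  · intro g g' e
    obtain ⟨e1, e2⟩ := h.piece_injective (hl _) e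
    rw [Subtype.ext e2] at e1
    exact hlm _ e1
  · intro s hs t _ e
    refine h.glue_inj ?_ e
    have hsc := h.p_glue_mem s
    have htc := h.p_glue_mem t
    rw [← e] at htc
    rcases h.mem_or (p (h.glue s)) with hy | ⟨n, hn⟩
    · rcases h.count _ hy with ⟨n, hn⟩ | hn
      · rw [(hn _).1 hsc, (hn _).1 htc]
      · let y : D := ⟨_, hy, hn⟩
        refine absurd ?_ hs
        have hyε : ε (ε.symm y) = y := ε.apply_symm_apply y
        rcases (hiff y _).1 hsc with h1 | h1
        · exact Or.inl (mem_iUnion.2 ⟨ε.symm y, by rw [hyε]; exact ⟨h1, rfl⟩⟩)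
        · exact Or.inr (mem_iUnion.2 ⟨ε.symm y, by rw [hyε]; exact ⟨h1, rfl⟩⟩)
    · rw [h.eq_of_mem hn hsc, h.eq_of_mem hn htc]
  · intro g
    rw [h.image_piece (hl _), h.image_piece (hm _)]

end StripCover

end Gluing

end FoliatedSurface
namespace FoliatedSurface

/-! ### Regular leaves, boundary transversals and the striped atlas. -/

section Application

variable {Z : Type*} [TopologicalSpace Z] {Δ : Setoid Z}

/-- A continuous function on an interval that is locally injective is injective. -/
theorem injOn_of_locally_injOn {g : ℝ → ℝ} {a b : ℝ} (hg : ContinuousOn g (Ioo a b))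
    (hloc : ∀ t ∈ Ioo a b, ∃ ε > 0, InjOn g (Icc (t - ε) (t + ε))) : InjOn g (Ioo a b) := by
  have key : ∀ s ∈ Ioo a b, ∀ t ∈ Ioo a b, s < t → g s ≠ g t := by
    intro s hs t ht hst e
    have hsub : Icc s t ⊆ Ioo a b := Icc_subset_Ioo hs.1 ht.2
    obtain ⟨c, hc, hext⟩ := exists_isLocalExtr_Ioo hst (hg.mono hsub) e
    obtain ⟨ε, hε, hinj⟩ := hloc c (hsub (Ioo_subset_Icc_self hc))
    -- Local injectivity makes `g` map neighbourhoods of `c` onto neighbourhoods of `g c`, which is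
    -- impossible at a local extremum.
    have side : ∀ P : ℝ → Prop, (∀ᶠ x in 𝓝 c, P (g x)) → ∀ᶠ x in 𝓝 (g c), P x := by
      intro P hP
      obtain ⟨δ, hδ, hball⟩ := Metric.nhds_basis_closedBall.mem_iff.1
        (Filter.inter_mem hP (Ioo_mem_nhds hc.1 hc.2))
      have hmin : Icc (c - min δ ε) (c + min δ ε) ⊆ Icc (c - δ) (c + δ) :=
        Icc_subset_Icc (by linarith [min_le_left δ ε]) (by linarith [min_le_left δ ε])
      have hmin' : Icc (c - min δ ε) (c + min δ ε) ⊆ Icc (c - ε) (c + ε) :=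
        Icc_subset_Icc (by linarith [min_le_right δ ε]) (by linarith [min_le_right δ ε])
      rw [Real.closedBall_eq_Icc] at hball
      have := image_mem_nhds_of_injOn (g := g) (lt_min hδ hε)
        (hg.mono fun x hx => hsub (Ioo_subset_Icc_self (hball (hmin hx)).2)) (hinj.mono hmin')
      refine Filter.mem_of_superset this ?_
      rintro _ ⟨x, hx, rfl⟩
      exact (hball (hmin hx)).1
    rcases hext with hmin | hmax
    · obtain ⟨x, hx, hx'⟩ := (((side (fun x => g c ≤ x) hmin).filter_mono
        (nhdsWithin_le_nhds (s := Iio (g c)))).and self_mem_nhdsWithin).exists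
      exact absurd hx' (not_lt.2 hx)
    · obtain ⟨x, hx, hx'⟩ := (((side (fun x => x ≤ g c) hmax).filter_mono
        (nhdsWithin_le_nhds (s := Ioi (g c)))).and self_mem_nhdsWithin).exists
      exact absurd hx' (not_lt.2 hx)
  intro s hs t ht e
  by_contra hne
  rcases lt_or_gt_of_ne hne with h | h
  · exact key s hs t ht h e
  · exact key t ht s hs h e.symm

theorem preimage_mk (z : Z) : Quotient.mk Δ ⁻¹' {Quotient.mk Δ z} = leafOf Δ z := by
  ext w
  exact Quotient.eq

theorem leafOf_mem_classes (z : Z) : leafOf Δ z ∈ Δ.classes := ⟨z, rfl⟩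

theorem leafOf_subset_surfInt (hΔ : IsFoliatedSurface Δ) {z : Z} (hz : z ∈ surfInt Z) :
    leafOf Δ z ⊆ surfInt Z := by
  intro w hw
  by_contra hn
  exact leafOf_subset_surfBd hΔ hn (Δ.symm hw) hz

theorem t1Space_quotient (h : ∀ z, IsClosed (leafOf Δ z)) : T1Space (Quotient Δ) := by
  refine ⟨fun y => ?_⟩
  induction y using Quotient.inductionOn with
  | h z => rw [← isQuotientMap_quotient_mk'.isClosed_preimage]; exact (preimage_mk z).symm ▸ h z

/-- The leaves that are regular and lie in the interior. -/
def regularSet (Δ : Setoid Z) : Set (Quotient Δ) :=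
  {y | ∃ z ∈ surfInt Z, Quotient.mk Δ z = y ∧ IsRegularLeaf Δ (leafOf Δ z)}

/-- Only finitely many singular leaves come near `z`, and leaves are closed, so those that do not
pass through `z` can be avoided. -/
theorem isThin_singular (hop : IsOpenMap (Quotient.mk Δ)) (hcl : ∀ z, IsClosed (leafOf Δ z))
    (hsing : LocallyFinite (fun ω : singLeaves Δ => (ω : Set Z))) :
    IsThin {y | ∃ z, Quotient.mk Δ z = y ∧ ¬ IsRegularLeaf Δ (leafOf Δ z)} := by
  intro y
  induction y using Quotient.inductionOn with
  | h z =>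
    obtain ⟨U, hU, hfin⟩ := hsing z
    let F : Set Z := ⋃ ω ∈ {ω : singLeaves Δ | ((ω : Set Z) ∩ U).Nonempty ∧ z ∉ (ω : Set Z)}, ω
    have hF : IsClosed F := by
      refine Set.Finite.isClosed_biUnion (hfin.subset fun ω hω => hω.1) ?_
      rintro ⟨_, ⟨w, rfl⟩, -⟩ -
      exact hcl w
    have hzF : z ∉ F := by
      intro hz
      obtain ⟨ω, hω, hzω⟩ := mem_iUnion₂.1 hz
      exact hω.2 hzω
    filter_upwards [hop.image_mem_nhds (Filter.inter_mem hU (hF.isOpen_compl.mem_nhds hzF))]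
    rintro _ ⟨w, ⟨hwU, hwF⟩, rfl⟩ ⟨w', e, hw'⟩
    by_contra hne
    have hww : Δ w w' := Quotient.exact e.symm
    refine hwF (mem_iUnion₂.2 ⟨⟨leafOf Δ w', leafOf_mem_classes w', hw'⟩,
      ⟨⟨w, hww, hwU⟩, fun hz => hne ?_⟩, hww⟩)
    exact (Quotient.sound (Δ.trans hww (Δ.symm hz)))

theorem isThin_boundary (hΔ : IsFoliatedSurface Δ) (hop : IsOpenMap (Quotient.mk Δ))
    (hint : ∀ z ∈ surfInt Z, LocLeafConn Δ z) :
    IsThin {y | ∃ z ∈ surfBd Z, Quotient.mk Δ z = y} := by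
  intro y
  induction y using Quotient.inductionOn with
  | h z =>
    by_cases hz : z ∈ surfInt Z
    · filter_upwards [hop.image_mem_nhds (isOpen_surfInt.mem_nhds hz)]
      rintro _ ⟨w, hw, rfl⟩ ⟨w', hw', e⟩
      exact absurd hw (leafOf_subset_surfBd hΔ hw' (Quotient.exact e.symm))
    · obtain ⟨c, -, h0, hpos, hn, -⟩ := exists_transversal hΔ hop hint (show z ∈ surfBd Z from hz)
      filter_upwards [hn 1 one_pos]
      rintro _ ⟨t, ht, rfl⟩ ⟨w', hw', e⟩
      rcases ht.1.eq_or_lt with rfl | h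
      · simp only [h0]
      · exact absurd (hpos t h) (leafOf_subset_surfBd hΔ hw' (Quotient.exact e.symm))

theorem isThin_compl_regularSet (hΔ : IsFoliatedSurface Δ) (hop : IsOpenMap (Quotient.mk Δ))
    (hint : ∀ z ∈ surfInt Z, LocLeafConn Δ z) (hcl : ∀ z, IsClosed (leafOf Δ z))
    (hsing : LocallyFinite (fun ω : singLeaves Δ => (ω : Set Z))) :
    IsThin (regularSet Δ)ᶜ := by
  intro y
  filter_upwards [isThin_singular hop hcl hsing y, isThin_boundary hΔ hop hint y] with y' h1 h2 hy'
  induction y' using Quotient.inductionOn with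
  | h w =>
    by_cases hw : w ∈ surfInt Z
    · exact h1 ⟨w, rfl, fun hr => hy' ⟨w, hw, rfl, hr⟩⟩
    · exact h2 ⟨w, hw, rfl⟩

/-- The tube of a regular leaf is used for the separation only; the arcs and the boxes come from
`hint`, and the openness from thinness of the complement. -/
theorem isLeafSpace_regularSet (hΔ : IsFoliatedSurface Δ) (hop : IsOpenMap (Quotient.mk Δ))
    (hint : ∀ z ∈ surfInt Z, LocLeafConn Δ z) (hthin : IsThin (regularSet Δ)ᶜ) :
    IsLeafSpace (Quotient.mk Δ) (regularSet Δ) where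
  cont := continuous_quotient_mk'
  isOpenMap := hop
  isOpen := isOpen_iff_mem_nhds.2 fun y hy => by
    filter_upwards [hthin y] with y' hy'
    by_contra hn
    exact hn (hy' hn ▸ hy)
  arc := by
    rintro _ ⟨z, hz, rfl, -⟩
    exact (hint z hz).exists_arc hΔ hop hz
  sep := by
    rintro _ ⟨z, hz, rfl, hr⟩ y' hne
    induction y' using Quotient.inductionOn with
    | h w =>
      rcases hr with ⟨-, hr⟩ | ⟨hb, -⟩
      · exact hr.disjoint_nhds hop hne
      · exact absurd hz (hb (Δ.refl z))
  box := by
    rintro z ⟨w, hw, e, -⟩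
    exact (hint z (leafOf_subset_surfInt hΔ hw (Quotient.exact e.symm))).hasBox hΔ hop

/-- A transversal through the boundary is, near the boundary, a cross section. -/
theorem ArcSystem.injOn_transversal {K : Type*} {M : Set (Quotient Δ)}
    (S : ArcSystem (Quotient.mk Δ) M K) (hC : IsThin S.cut) (hΔ : IsFoliatedSurface Δ) {z : Z}
    (hz : z ∈ surfBd Z) {c : ℝ → Z}
    (hc : Continuous c) (h0 : c 0 = z) (hpos : ∀ t > 0, c t ∈ surfInt Z)
    (hn : ∀ δ > 0, (fun t => Quotient.mk Δ (c t)) '' Ico 0 δ ∈ 𝓝 (Quotient.mk Δ z))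
    (hinj : ∀ t > 0, ∃ ε > 0, InjOn (fun t => Quotient.mk Δ (c t)) (Icc (t - ε) (t + ε))) :
    ∃ δ > 0, InjOn (fun t => Quotient.mk Δ (c t)) (Ico 0 δ) := by
  have hsat : ∀ w, Δ w z → w ∈ surfBd Z := fun w hw => leafOf_subset_surfBd hΔ hz hw
  have hs := sides_of_transversal hsat hc h0 hpos hn
  obtain ⟨δ, hδ, k, hk⟩ := S.exists_ends hC hs
  have hk : ∀ t ∈ Ioo 0 δ, Quotient.mk Δ (c t) ∈ S.B (k ()) := fun t ht => hk () ⟨t, ht, rfl⟩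
  have hkt : ∀ t ∈ Ioo 0 δ, Quotient.mk Δ (c t) ∈ (S.half (k ())).target := fun t ht => by
    rw [S.half_target]; exact S.B_sub_target _ (hk t ht)
  -- The transversal read in the parameter of the half-arc that contains its beginning. The foot at
  -- parameter 0 lies on a boundary leaf and is treated apart.
  let g : ℝ → ℝ := fun t => (S.half (k ())).symm (Quotient.mk Δ (c t))
  have hgc : ContinuousOn g (Ioo 0 δ) :=
    (S.half (k ())).continuousOn_symm.comp (continuous_quotient_mk'.comp hc).continuousOn hkt
  have hgi : InjOn g (Ioo 0 δ) := by
    refine injOn_of_locally_injOn hgc fun t ht => ?_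
    obtain ⟨ε, hε, hi⟩ := hinj t ht.1
    obtain ⟨ε', hε', hball⟩ := Metric.nhds_basis_closedBall.mem_iff.1 (Ioo_mem_nhds ht.1 ht.2)
    rw [Real.closedBall_eq_Icc] at hball
    refine ⟨min ε ε', lt_min hε hε', fun s hs s' hs' e => ?_⟩
    have m1 : ∀ {s}, s ∈ Icc (t - min ε ε') (t + min ε ε') → s ∈ Icc (t - ε) (t + ε) :=
      fun hs => ⟨by linarith [min_le_left ε ε', hs.1], by linarith [min_le_left ε ε', hs.2]⟩
    have m2 : ∀ {s}, s ∈ Icc (t - min ε ε') (t + min ε ε') → s ∈ Icc (t - ε') (t + ε') :=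
      fun hs => ⟨by linarith [min_le_right ε ε', hs.1], by linarith [min_le_right ε ε', hs.2]⟩
    exact hi (m1 hs) (m1 hs')
      ((S.half (k ())).symm.injOn (hkt s (hball (m2 hs))) (hkt s' (hball (m2 hs'))) e)
  have hne : ∀ t > 0, Quotient.mk Δ (c t) ≠ Quotient.mk Δ (c 0) := by
    intro t ht e
    rw [h0] at e
    exact hs.ne () t ht e
  refine ⟨δ, hδ, fun s hs s' hs' e => ?_⟩
  rcases hs.1.eq_or_lt with rfl | h1 <;> rcases hs'.1.eq_or_lt with rfl | h2
  · rfl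
  · exact absurd e.symm (hne s' h2)
  · exact absurd e (hne s h1)
  · exact hgi ⟨h1, hs.2⟩ ⟨h2, hs'.2⟩ (congrArg (S.half (k ())).symm e)

/-- An arc system whose half-arcs carry strips gives a striped atlas. -/
theorem ArcSystem.isStriped [T2Space Z] [SecondCountableTopology Z] [T1Space (Quotient Δ)]
    {K : Type*} [Countable K] {M : Set (Quotient Δ)} (S : ArcSystem (Quotient.mk Δ) M K)
    (hM : IsLeafSpace (Quotient.mk Δ) M) (hC : IsThin S.cut) (hs : S.HasSides)
    (c : LeafCoord (Quotient.mk Δ)) (hbox : ∀ z, HasBox (Quotient.mk Δ) z) : IsStriped Δ := by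
  have hstrip := fun l => (S.halfArc hC hs hM.sep l).exists_strip hM.cont hM.isOpenMap c hbox
  choose T Φ hbd hlev using hstrip
  -- The strips must be indexed by a type in `Type`; countability provides one.
  let e : Shrink.{0} (K × Bool) ≃ K × Bool := (equivShrink _).symm
  have hcov : StripCover (Quotient.mk Δ) S.cut (fun l => S.B (e l)) (fun l => T (e l))
      (fun l => Φ (e l)) :=
    { cont := hM.cont
      conn := fun y => by
        have : Quotient.mk Δ ⁻¹' {y} = range (c.par y) := by
          ext z
          constructor
          · rintro rfl
            exact ⟨c.e z, c.par_e z⟩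
          · rintro ⟨t, rfl⟩
            exact c.p_par y t
        rw [this]
        exact isPreconnected_range (c.par_cont y)
      surj := Quotient.mk_surjective
      thin := hC
      isOpen := fun l => S.isOpen_B _
      disj := fun l m h => S.disj_B _ _ fun h' => h (e.injective h')
      compl := by rw [S.cut_compl, ← e.surjective.iUnion_comp]
      locallyFinite := (S.locallyFinite_B hC hs).comp_injective e.injective
      count := fun y hy => by
        have hiff : ∀ n l, e n = l ↔ n = e.symm l := fun n l => (e.eq_symm_apply).symm
        rcases S.exists_closure_B hC hs hM.sep hy with ⟨l, hl⟩ | ⟨l, m, hlm, hl⟩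
        · exact Or.inl ⟨e.symm l, fun n => by rw [hl, hiff]⟩
        · exact Or.inr ⟨e.symm l, e.symm m, fun h => hlm (e.symm.injective h), fun n => by
            rw [hl, hiff, hiff]⟩
      bd := fun l => hbd (e l)
      level := fun l => hlev (e l) }
  have : Countable (Shrink.{0} (K × Bool)) := e.injective.countable
  refine ⟨_, _, _, hcov.isStripedAtlas_glue, ?_⟩
  ext ω
  rw [mem_ofPred_eq, hcov.exists_stripLeaf_iff]
  constructor
  · rintro ⟨z, rfl⟩
    exact ⟨Quotient.mk Δ z, (preimage_mk z).symm⟩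
  · rintro ⟨y, rfl⟩
    induction y using Quotient.inductionOn with
    | h z => rw [preimage_mk]; exact leafOf_mem_classes z

end Application

end FoliatedSurface
open FoliatedSurface in
theorem mainTheorem2 {Z : Type*} [TopologicalSpace Z] [T2Space Z] [SecondCountableTopology Z]
    (Δ : Setoid Z) (hΔ : IsFoliatedSurface Δ)
    (hleaf : ∀ ω ∈ Δ.classes, IsClosed ω ∧ Nonempty (ω ≃ₜ ℝ))
    (hsing : LocallyFinite (fun ω : singLeaves Δ => (ω : Set Z)))
    (hcross : ∀ ω ∈ Δ.classes, ω ⊆ surfInt Z → AdmitsCrossSection Δ ω) :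
    (∀ ω ∈ Δ.classes, ω ⊆ surfBd Z → AdmitsCrossSection Δ ω) ∧ IsStriped Δ := by
  have hl : ∀ z, Nonempty (leafOf Δ z ≃ₜ ℝ) := fun z => (hleaf _ (leafOf_mem_classes z)).2
  have hcl : ∀ z, IsClosed (leafOf Δ z) := fun z => (hleaf _ (leafOf_mem_classes z)).1
  have hop : IsOpenMap (Quotient.mk Δ) := isOpenMap_mk hΔ hl
  have hT1 : T1Space (Quotient Δ) := t1Space_quotient hcl
  have hsc : SecondCountableTopology (Quotient Δ) :=
    isQuotientMap_quotient_mk'.secondCountableTopology hop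
  -- The cross section meets the leaf of `z` somewhere; the property obtained there is carried along
  -- the leaf to `z`.
  have hint : ∀ z ∈ surfInt Z, LocLeafConn Δ z := by
    intro z hz
    obtain ⟨a, b, J, γ, hγ, t, ht⟩ :=
      hcross _ (leafOf_mem_classes z) (leafOf_subset_surfInt hΔ hz)
    exact (hγ.locLeafConn hΔ t (leafOf_subset_surfInt hΔ hz ht)).of_rel hΔ hl ht
  obtain ⟨c⟩ := exists_leafCoord (p := Quotient.mk Δ) fun y => by
    induction y using Quotient.inductionOn with
    | h z => rw [preimage_mk]; exact hl z
  have hthin := isThin_compl_regularSet hΔ hop hint hcl hsing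
  have hM := isLeafSpace_regularSet hΔ hop hint hthin
  obtain ⟨K, hK, ⟨S⟩⟩ := exists_arcSystem hM c
  have hsides : ∀ y : Quotient Δ, (∃ j : ℝ → Quotient Δ, IsOpenEmbedding j ∧ j 0 = y) ∨
      ∃ d : ℝ → Quotient Δ, Sides (fun _ : Unit => d) y := by
    intro y
    induction y using Quotient.inductionOn with
    | h z =>
      by_cases hz : z ∈ surfInt Z
      · exact Or.inl ((hint z hz).exists_arc hΔ hop hz)
      · obtain ⟨d, hd, h0, hpos, hn, -⟩ := exists_transversal hΔ hop hint hz
        exact Or.inr ⟨_, sides_of_transversal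
          (fun w hw => leafOf_subset_surfBd hΔ hz hw) hd h0 hpos hn⟩
  have hC : IsThin S.cut := S.isThin_cut hthin fun y _ => by
    rcases hsides y with ⟨j, hj, rfl⟩ | ⟨d, hd⟩
    · exact ⟨Bool, inferInstance, _, sides_of_arc hj⟩
    · exact ⟨Unit, inferInstance, _, hd⟩
  -- The half-arcs are built from interior leaves alone, so they are available here. They show that
  -- a boundary transversal is injective near its foot, which gives the cross section and also the
  -- box at a boundary point that the strips require.
  have htrans : ∀ z ∈ surfBd Z, AdmitsCrossSection Δ (leafOf Δ z) ∧ LocLeafConn Δ z := by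
    intro z hz
    obtain ⟨d, hd, h0, hpos, hn, hloc, hconn⟩ := exists_transversal hΔ hop hint hz
    obtain ⟨δ, hδ, hinj⟩ := S.injOn_transversal hC hΔ hz hd h0 hpos hn hloc
    refine ⟨⟨0, δ, Ico 0 δ, fun t => d t, ⟨hδ, Or.inl rfl, hd.comp continuous_subtype_val,
      fun t ht => ?_, fun s t e => Subtype.ext (hinj s.2 t.2 e)⟩, ⟨0, le_rfl, hδ⟩, ?_⟩,
      hconn δ hδ hinj⟩
    · show d t ∈ _
      rw [ht, h0]; exact hz
    · show d 0 ∈ _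
      rw [h0]; exact Δ.refl z
  have hbox : ∀ z, HasBox (Quotient.mk Δ) z := fun z => by
    by_cases hz : z ∈ surfInt Z
    · exact (hint z hz).hasBox hΔ hop
    · exact (htrans z hz).2.hasBox hΔ hop
  have : Countable K := hK.to_subtype
  refine ⟨?_, S.isStriped hM hC (fun y _ => hsides y) c hbox⟩
  rintro _ ⟨z, rfl⟩ hω
  exact (htrans z (hω (Δ.refl z))).1
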